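/- **Theorem A.** Let $k$ be a field of characteristic zero. For a finite-dimensional Lie algebra $\mathfrak g$ over $k$ let $\mu(\mathfrak g)$ be the minimal dimension of a faithful (finite-dimensional) representation of $\mathfrak g$, and $\mu_{nil}(\mathfrak g)$ the minimal dimension of a faithful nilrepresentation, i.e. of a faithful representation $\pi$ such that $\pi(X)$ is nilpotent for every $X\in\mathfrak g$. Consider the following 6-dimensional Lie algebras over $k$ (De Graaf's list), where $\varepsilon\in k$, a basis is indicated, and the brackets of basis vectors that are not listed and do not follow by antisymmetry are zero. - $L_{6,1}$: abelian, basis $A_1,\dots,A_6$. - $L_{6,2}$: basis $X_1,X_2,Z_1,A_1,A_2,A_3$; $[X_1,X_2]=Z_1$. - $L_{6,3}$: basis $X_1,X_2,X_3,Z_1,A_1,A_2$; $[X_1,X_2]=X_3$, $[X_1,X_3]=Z_1$. - $L_{6,4},\dots,L_{6,7}$: basis $X_1,\dots,X_4,Z_1,A_1$, with - $L_{6,4}$: $[X_1,X_2]=[X_3,X_4]=Z_1$; - $L_{6,5}$: $[X_1,X_2]=X_3$, $[X_1,X_3]=[X_2,X_4]=Z_1$; - $L_{6,6}$: $[X_1,X_2]=X_3$,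 $[X_1,X_3]=X_4$, $[X_1,X_4]=[X_2,X_3]=Z_1$; - $L_{6,7}$: $[X_1,X_2]=X_3$, $[X_1,X_3]=X_4$, $[X_1,X_4]=Z_1$. - $L_{6,8}$, $L_{6,9}$: basis $X_1,X_2,X_3,Z_1,Z_2,A_1$, with - $L_{6,8}$: $[X_1,X_2]=Z_1$, $[X_1,X_3]=Z_2$; - $L_{6,9}$: $[X_1,X_2]=X_3$, $[X_1,X_3]=Z_1$, $[X_2,X_3]=Z_2$. - $L_{6,10},\dots,L_{6,21}$: basis $X_1,\dots,X_5,Z_1$, with - $L_{6,10}$: $[X_1,X_2]=X_3$, $[X_1,X_3]=[X_4,X_5]=Z_1$; - $L_{6,11}$: $[X_1,X_2]=X_3$, $[X_1,X_3]=X_4$, $[X_1,X_4]=[X_2,X_3]=[X_2,X_5]=Z_1$; - $L_{6,12}$: $[X_1,X_2]=X_3$, $[X_1,X_3]=X_4$, $[X_1,X_4]=[X_2,X_5]=Z_1$; - $L_{6,13}$: $[X_1,X_2]=X_3$, $[X_1,X_3]=[X_2,X_4]=X_5$, $[X_1,X_5]=[X_3,X_4]=Z_1$; - $L_{6,14}$: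 $[X_1,X_2]=X_3$, $[X_1,X_3]=X_4$, $[X_1,X_4]=[X_2,X_3]=X_5$, $[X_2,X_5]=Z_1$, $[X_3,X_4]=-Z_1$; - $L_{6,15}$: $[X_1,X_2]=X_3$, $[X_1,X_3]=X_4$, $[X_1,X_4]=[X_2,X_3]=X_5$, $[X_1,X_5]=[X_2,X_4]=Z_1$; - $L_{6,16}$: $[X_1,X_2]=X_3$, $[X_1,X_3]=X_4$, $[X_1,X_4]=X_5$, $[X_2,X_5]=Z_1$, $[X_3,X_4]=-Z_1$; - $L_{6,17}$: $[X_1,X_2]=X_3$, $[X_1,X_3]=X_4$, $[X_1,X_4]=X_5$, $[X_1,X_5]=[X_2,X_3]=Z_1$; - $L_{6,18}$: $[X_1,X_2]=X_3$, $[X_1,X_3]=X_4$, $[X_1,X_4]=X_5$, $[X_1,X_5]=Z_1$; - $L_{6,19}(\varepsilon)$: $[X_1,X_2]=X_4$, $[X_1,X_3]=X_5$, $[X_2,X_4]=Z_1$, $[X_3,X_5]=\varepsilon Z_1$; - $L_{6,20}$: $[X_1,X_2]=X_4$, $[X_1,X_3]=X_5$, $[X_1,X_5]=[X_2,X_4]=Z_1$;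 - $L_{6,21}(\varepsilon)$: $[X_1,X_2]=X_3$, $[X_1,X_3]=X_4$, $[X_2,X_3]=X_5$, $[X_1,X_4]=Z_1$, $[X_2,X_5]=\varepsilon Z_1$. - $L_{6,22}(\varepsilon),\dots,L_{6,25}$: basis $X_1,\dots,X_4,Z_1,Z_2$, with - $L_{6,22}(\varepsilon)$: $[X_1,X_2]=[X_3,X_4]=Z_1$, $[X_1,X_3]=Z_2$, $[X_2,X_4]=\varepsilon Z_2$; - $L_{6,23}$: $[X_1,X_2]=X_3$, $[X_1,X_3]=[X_2,X_4]=Z_1$, $[X_1,X_4]=Z_2$; - $L_{6,24}(\varepsilon)$: $[X_1,X_2]=X_3$, $[X_1,X_3]=[X_2,X_4]=Z_1$, $[X_1,X_4]=\varepsilon Z_2$, $[X_2,X_3]=Z_2$; - $L_{6,25}$: $[X_1,X_2]=X_3$, $[X_1,X_3]=Z_1$, $[X_1,X_4]=Z_2$. - $L_{6,26}$: basis $X_1,X_2,X_3,Z_1,Z_2,Z_3$; $[X_1,X_2]=Z_1$, $[X_1,X_3]=Z_2$, $[X_2,X_3]=Z_3$. **(1) Values.** For every $\varepsilon\in k$,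 the values are as follows. | Lie algebra | $\mu$ | $\mu_{nil}$ | |---|---|---| | $L_{6,19}(\varepsilon)$, if $\alpha^2+\varepsilon=0$ for some $\alpha\in k^*$ | 4 | 4 | | $L_{6,3}, L_{6,4}, L_{6,5}, L_{6,8}$ | 4 | 5 | | $L_{6,1}, L_{6,2}, L_{6,6}, L_{6,7}, L_{6,10}, L_{6,11}, L_{6,12}, L_{6,13}, L_{6,20}, L_{6,21}(\varepsilon), L_{6,22}(\varepsilon), L_{6,23}, L_{6,25}, L_{6,26}$ | 5 | 5 | | $L_{6,24}(\varepsilon)$, if $\alpha^2-\varepsilon=0$ for some $\alpha\in k$ | 5 | 5 | | $L_{6,19}(\varepsilon)$, if $\alpha^2+\varepsilon\ne0$ for all $\alpha\in k^*$ | 5 | 5 | | $L_{6,9}$ | 5 | 6 | | $L_{6,14}, L_{6,15}, L_{6,16}, L_{6,17}, L_{6,18}$ | 6 | 6 | | $L_{6,24}(\varepsilon)$, if $\alpha^2-\varepsilon\neq0$ for all $\alpha\in k$ | 6 | 6 | **(2) Explicit representations.** Each matrix below, as the image of $\sum x_iX_i+\sum z_iZ_i+\sum a_iA_i$, defines a faithful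 representation of the Lie algebra named; those under (b) are nilrepresentations. (a) Faithful representations of dimension $\mu<\mu_{nil}$: - $L_{6,3}$: $\begin{pmatrix}a_2&x_1&x_3+a_1&-2z_1\\ 0&a_2&x_2&-x_3+a_1\\ 0&0&a_2&x_1\\ 0&0&0&a_2\end{pmatrix}$ - $L_{6,4}$: $\begin{pmatrix}a_1&x_1&x_3&z_1\\ 0&a_1&0&x_2\\ 0&0&a_1&x_4\\ 0&0&0&a_1\end{pmatrix}$ - $L_{6,5}$: $\begin{pmatrix}a_1&x_1&-x_4&z_1\\ 0&a_1&x_1&x_3\\ 0&0&a_1&x_2\\ 0&0&0&a_1\end{pmatrix}$ - $L_{6,8}$: $\begin{pmatrix}a_1&x_1&z_1&z_2\\ 0&a_1&x_2&x_3\\ 0&0&a_1&0\\ 0&0&0&a_1\end{pmatrix}$ - $L_{6,9}$: $\begin{pmatrix}a_1&0&\tfrac{x_2}{2}&-\tfrac{x_3}{2}&z_2\\ 0&a_1&x_1&0&z_1\\ 0&0&a_1&x_1&x_3\\ 0&0&0&a_1&x_2\\ 0&0&0&0&a_1\end{pmatrix}$ (b) Faithful nilrepresentations (of dimension $\mu_{nil}$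 in the cases stated): - $L_{6,1}$: $\begin{pmatrix}0&0&a_1&a_2&a_3\\ 0&0&a_4&a_5&a_6\\ 0&0&0&0&0\\ 0&0&0&0&0\\ 0&0&0&0&0\end{pmatrix}$ - $L_{6,2}$: $\begin{pmatrix}0&0&x_1&z_1&a_1\\ 0&0&0&a_2&a_3\\ 0&0&0&x_2&0\\ 0&0&0&0&0\\ 0&0&0&0&0\end{pmatrix}$ - $L_{6,3}$: $\begin{pmatrix}0&x_1&x_3+a_1&-2z_1&a_2\\ 0&0&x_2&-x_3+a_1&0\\ 0&0&0&x_1&0\\ 0&0&0&0&0\\ 0&0&0&0&0\end{pmatrix}$ - $L_{6,4}$: $\begin{pmatrix}0&x_1&x_3&z_1&a_1\\ 0&0&0&x_2&0\\ 0&0&0&x_4&0\\ 0&0&0&0&0\\ 0&0&0&0&0\end{pmatrix}$ - $L_{6,5}$: $\begin{pmatrix}0&x_1&-x_4&z_1&a_1\\ 0&0&x_1&x_3&0\\ 0&0&0&x_2&0\\ 0&0&0&0&0\\ 0&0&0&0&0\end{pmatrix}$ - $L_{6,6}$: $\begin{pmatrix}0&x_1&3x_2&x_4+a_1&-3z_1\\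 0&0&x_1&x_3&-2x_4+a_1\\ 0&0&0&x_2&-x_3\\ 0&0&0&0&x_1\\ 0&0&0&0&0\end{pmatrix}$ - $L_{6,7}$: $\begin{pmatrix}0&x_1&0&x_4+a_1&-3z_1\\ 0&0&x_1&x_3&-2x_4+a_1\\ 0&0&0&x_2&-x_3\\ 0&0&0&0&x_1\\ 0&0&0&0&0\end{pmatrix}$ - $L_{6,8}$: $\begin{pmatrix}0&x_1&z_1&z_2&a_1\\ 0&0&x_2&x_3&0\\ 0&0&0&0&0\\ 0&0&0&0&0\\ 0&0&0&0&0\end{pmatrix}$ - $L_{6,9}$: $\begin{pmatrix}0&0&\tfrac{x_2}{2}&-\tfrac{x_3}{2}&z_2&a_1\\ 0&0&x_1&0&z_1&0\\ 0&0&0&x_1&x_3&0\\ 0&0&0&0&x_2&0\\ 0&0&0&0&0&0\\ 0&0&0&0&0&0\end{pmatrix}$ - $L_{6,10}$: $\begin{pmatrix}0&x_1&0&x_4&z_1\\ 0&0&x_1&0&x_3\\ 0&0&0&0&x_2\\ 0&0&0&0&x_5\\ 0&0&0&0&0\end{pmatrix}$ - $L_{6,11}$: $\begin{pmatrix}0&x_1&x_2&-x_5&z_1\\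 0&0&x_1&x_2&x_4\\ 0&0&0&x_1&x_3\\ 0&0&0&0&x_2\\ 0&0&0&0&0\end{pmatrix}$ - $L_{6,12}$: $\begin{pmatrix}0&x_1&0&-x_5&z_1\\ 0&0&x_1&0&x_4\\ 0&0&0&x_1&x_3\\ 0&0&0&0&x_2\\ 0&0&0&0&0\end{pmatrix}$ - $L_{6,13}$: $\begin{pmatrix}0&x_1&-x_4&0&z_1\\ 0&0&x_1&-x_4&x_5\\ 0&0&0&x_1&x_3\\ 0&0&0&0&x_2\\ 0&0&0&0&0\end{pmatrix}$ - $L_{6,14}$: $\begin{pmatrix}0&x_2&-x_3&x_4&-x_5&2z_1\\ 0&0&x_1&\tfrac{x_2}{3}&-\tfrac{2x_3}{3}&x_5\\ 0&0&0&x_1&-\tfrac{x_2}{3}&x_4\\ 0&0&0&0&x_1&x_3\\ 0&0&0&0&0&x_2\\ 0&0&0&0&0&0\end{pmatrix}$ - $L_{6,15}$: $\begin{pmatrix}0&x_1&\tfrac{x_2}{2}&0&-\tfrac{x_4}{2}&z_1\\ 0&0&x_1&\tfrac{x_2}{2}&-\tfrac{x_3}{2}&x_5\\ 0&0&0&x_1&0&x_4\\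 0&0&0&0&x_1&x_3\\ 0&0&0&0&0&x_2\\ 0&0&0&0&0&0\end{pmatrix}$ - $L_{6,16}$: $\begin{pmatrix}0&x_1&x_3&-2x_4&3x_5&-3z_1\\ 0&0&x_2&-x_3&x_4&0\\ 0&0&0&x_1&0&x_4\\ 0&0&0&0&x_1&x_3\\ 0&0&0&0&0&x_2\\ 0&0&0&0&0&0\end{pmatrix}$ - $L_{6,17}$: $\begin{pmatrix}0&x_1&0&\tfrac{x_2}{2}&-\tfrac{x_3}{2}&z_1\\ 0&0&x_1&0&0&x_5\\ 0&0&0&x_1&0&x_4\\ 0&0&0&0&x_1&x_3\\ 0&0&0&0&0&x_2\\ 0&0&0&0&0&0\end{pmatrix}$ - $L_{6,18}$: $\begin{pmatrix}0&x_1&0&0&0&z_1\\ 0&0&x_1&0&0&x_5\\ 0&0&0&x_1&0&x_4\\ 0&0&0&0&x_1&x_3\\ 0&0&0&0&0&x_2\\ 0&0&0&0&0&0\end{pmatrix}$ - $L_{6,19}(\varepsilon)$, if $\alpha\in k^*$ and $\alpha^2+\varepsilon=0$: $\begin{pmatrix}0&-\tfrac{x_2}{\alpha }+x_3&\tfrac{x_4}{\alpha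 }-x_5&-\tfrac{2z_1}{\alpha }\\ 0&0&x_1&x_4+\alpha x_5\\ 0&0&0&x_2+\alpha x_3\\ 0&0&0&0\end{pmatrix}$ - $L_{6,19}(\varepsilon)$, for every $\varepsilon$ (minimal if $-\varepsilon$ is not a nonzero square): $\begin{pmatrix}0&x_1&x_4&x_5&z_1\\ 0&0&x_2&x_3&0\\ 0&0&0&0&-x_2\\ 0&0&0&0&-\varepsilon x_3\\ 0&0&0&0&0\end{pmatrix}$ - $L_{6,20}$: $\begin{pmatrix}0&x_1&0&x_4&z_1\\ 0&0&x_1&x_2&x_5\\ 0&0&0&0&x_3\\ 0&0&0&0&-x_2\\ 0&0&0&0&0\end{pmatrix}$ - $L_{6,21}(\varepsilon)$, $\varepsilon\neq0$: $\begin{pmatrix}0&-x_1+x_2&(\varepsilon +1)x_3&-x_4-\varepsilon x_5&3z_1\\ 0&0&x_1-(\varepsilon +2)x_2&x_3&-2x_4+\varepsilon x_5\\ 0&0&0&x_2&-x_3\\ 0&0&0&0&2x_2+x_1\\ 0&0&0&0&0\end{pmatrix}$ - $L_{6,21}(0)$: $\begin{pmatrix}0&x_1&x_3&-2x_4-x_5&3z_1\\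 0&0&x_2&-x_3&x_4-x_5\\ 0&0&0&x_1+x_2&-x_3\\ 0&0&0&0&x_1\\ 0&0&0&0&0\end{pmatrix}$ - $L_{6,22}(\varepsilon)$: $\begin{pmatrix}0&x_1&-x_4&z_1&z_2\\ 0&0&0&x_2&x_3\\ 0&0&0&x_3&\varepsilon x_2\\ 0&0&0&0&0\\ 0&0&0&0&0\end{pmatrix}$ - $L_{6,23}$: $\begin{pmatrix}0&x_1&-x_4&z_2&z_1\\ 0&0&x_1&0&x_3\\ 0&0&0&x_1&x_2\\ 0&0&0&0&0\\ 0&0&0&0&0\end{pmatrix}$ - $L_{6,24}(\varepsilon)$, if $\alpha\in k$, $\alpha^2-\varepsilon=0$ and $\alpha\neq1$ (if $\varepsilon=1$ take $\alpha=-1$): $\begin{pmatrix}0&\alpha x_1+x_2&(\alpha -\alpha ^2)x_4+(\alpha -1)x_3&(3\alpha -1)z_1+(3-\alpha )z_2&(1-\alpha )z_1+(1-\alpha )z_2\\ 0&0&x_1+x_2&(-\alpha ^2+4\alpha -1)x_4+2x_3&(1-\alpha ^2)x_4\\ 0&0&0&-x_1+x_2&x_1+x_2\\ 0&0&0&0&0\\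 0&0&0&0&0\end{pmatrix}$ - $L_{6,24}(\varepsilon)$, for every $\varepsilon$ (minimal if $\varepsilon$ is not a square): $\begin{pmatrix}0&x_2&x_1&x_3&-2z_1&-z_2\\ 0&0&0&0&-2x_4&0\\ 0&0&0&x_2&-x_3&-\varepsilon x_4\\ 0&0&0&0&x_1&x_2\\ 0&0&0&0&0&0\\ 0&0&0&0&0&0\end{pmatrix}$ - $L_{6,25}$: $\begin{pmatrix}0&x_1&x_3&2z_1&z_2\\ 0&0&x_2&x_3&x_4\\ 0&0&0&-x_1&0\\ 0&0&0&0&0\\ 0&0&0&0&0\end{pmatrix}$ - $L_{6,26}$: $\begin{pmatrix}0&0&x_1&z_1&z_2\\ 0&0&x_2&0&z_3\\ 0&0&0&x_2&x_3\\ 0&0&0&0&0\\ 0&0&0&0&0\end{pmatrix}$ -/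

import Mathlib

universe u

namespace NilSix

/-- The names of De Graaf's 6-dimensional nilpotent Lie algebras `L_{6,1}, …, L_{6,26}` over `k`;
four of the families depend on a parameter `ε ∈ k`. -/
inductive Name (k : Type u) : Type u
  | L1 | L2 | L3 | L4 | L5 | L6 | L7 | L8 | L9 | L10 | L11 | L12 | L13 | L14 | L15 | L16 | L17 | L18
  | L19 (ε : k)
  | L20
  | L21 (ε : k)
  | L22 (ε : k)
  | L23
  | L24 (ε : k)
  | L25 | L26

variable {k : Type u}

/-- `w x y i j = x_i y_j - x_j y_i` is the factor that the bracket `[b_i, b_j]` of two basis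
vectors (`i < j`) gets in the expansion of `[∑ x_i b_i, ∑ y_j b_j]`. -/
def w [Ring k] (x y : Fin 6 → k) (i j : Fin 6) : k := x i * y j - x j * y i

/-- The bracket of the algebra with a given name in coordinates with respect to its basis. The
basis vectors are numbered `0, …, 5`, in the order `X_1, X_2, …, Z_1, Z_2, …, A_1, A_2, …`: so
`w x y 0 1` in position `2` means that `[b_0, b_1] = b_2`, and so on.
`L1, …, L9` are the 5-dimensional algebras `L_{5,1}, …, L_{5,9}` plus a one-dimensional abelian
summand, which is spanned by the last basis vector. -/
def bracket [Ring k] : Name k → (Fin 6 → k) → (Fin 6 → k) → (Fin 6 → k)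
  -- abelian
  | .L1, _, _ => ![0, 0, 0, 0, 0, 0]
  -- basis X1 X2 Z1 A1 A2 A3: [X1,X2] = Z1
  | .L2, x, y => ![0, 0, w x y 0 1, 0, 0, 0]
  -- basis X1 X2 X3 Z1 A1 A2: [X1,X2] = X3, [X1,X3] = Z1
  | .L3, x, y => ![0, 0, w x y 0 1, w x y 0 2, 0, 0]
  -- basis X1 X2 X3 X4 Z1 A1: [X1,X2] = Z1, [X3,X4] = Z1
  | .L4, x, y => ![0, 0, 0, 0, w x y 0 1 + w x y 2 3, 0]
  -- basis X1 X2 X3 X4 Z1 A1: [X1,X2] = X3, [X1,X3] = Z1, [X2,X4] = Z1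
  | .L5, x, y => ![0, 0, w x y 0 1, 0, w x y 0 2 + w x y 1 3, 0]
  -- basis X1 X2 X3 X4 Z1 A1: [X1,X2] = X3, [X1,X3] = X4, [X1,X4] = Z1, [X2,X3] = Z1
  | .L6, x, y => ![0, 0, w x y 0 1, w x y 0 2, w x y 0 3 + w x y 1 2, 0]
  -- basis X1 X2 X3 X4 Z1 A1: [X1,X2] = X3, [X1,X3] = X4, [X1,X4] = Z1
  | .L7, x, y => ![0, 0, w x y 0 1, w x y 0 2, w x y 0 3, 0]
  -- basis X1 X2 X3 Z1 Z2 A1: [X1,X2] = Z1, [X1,X3] = Z2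
  | .L8, x, y => ![0, 0, 0, w x y 0 1, w x y 0 2, 0]
  -- basis X1 X2 X3 Z1 Z2 A1: [X1,X2] = X3, [X1,X3] = Z1, [X2,X3] = Z2
  | .L9, x, y => ![0, 0, w x y 0 1, w x y 0 2, w x y 1 2, 0]
  -- basis X1 X2 X3 X4 X5 Z1: [X1,X2] = X3, [X1,X3] = Z1, [X4,X5] = Z1
  | .L10, x, y => ![0, 0, w x y 0 1, 0, 0, w x y 0 2 + w x y 3 4]
  -- [X1,X2] = X3, [X1,X3] = X4, [X1,X4] = Z1, [X2,X3] = Z1, [X2,X5] = Z1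
  | .L11, x, y => ![0, 0, w x y 0 1, w x y 0 2, 0, w x y 0 3 + w x y 1 2 + w x y 1 4]
  -- [X1,X2] = X3, [X1,X3] = X4, [X1,X4] = Z1, [X2,X5] = Z1
  | .L12, x, y => ![0, 0, w x y 0 1, w x y 0 2, 0, w x y 0 3 + w x y 1 4]
  -- [X1,X2] = X3, [X1,X3] = X5, [X2,X4] = X5, [X1,X5] = Z1, [X3,X4] = Z1
  | .L13, x, y => ![0, 0, w x y 0 1, 0, w x y 0 2 + w x y 1 3, w x y 0 4 + w x y 2 3]
  -- [X1,X2] = X3, [X1,X3] = X4, [X1,X4] = X5, [X2,X3] = X5, [X2,X5] = Z1, [X3,X4] = -Z1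
  | .L14, x, y =>
    ![0, 0, w x y 0 1, w x y 0 2, w x y 0 3 + w x y 1 2, w x y 1 4 - w x y 2 3]
  -- [X1,X2] = X3, [X1,X3] = X4, [X1,X4] = X5, [X2,X3] = X5, [X1,X5] = Z1, [X2,X4] = Z1
  | .L15, x, y =>
    ![0, 0, w x y 0 1, w x y 0 2, w x y 0 3 + w x y 1 2, w x y 0 4 + w x y 1 3]
  -- [X1,X2] = X3, [X1,X3] = X4, [X1,X4] = X5, [X2,X5] = Z1, [X3,X4] = -Z1
  | .L16, x, y => ![0, 0, w x y 0 1, w x y 0 2, w x y 0 3, w x y 1 4 - w x y 2 3]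
  -- [X1,X2] = X3, [X1,X3] = X4, [X1,X4] = X5, [X1,X5] = Z1, [X2,X3] = Z1
  | .L17, x, y => ![0, 0, w x y 0 1, w x y 0 2, w x y 0 3, w x y 0 4 + w x y 1 2]
  -- [X1,X2] = X3, [X1,X3] = X4, [X1,X4] = X5, [X1,X5] = Z1
  | .L18, x, y => ![0, 0, w x y 0 1, w x y 0 2, w x y 0 3, w x y 0 4]
  -- [X1,X2] = X4, [X1,X3] = X5, [X2,X4] = Z1, [X3,X5] = ε Z1
  | .L19 ε, x, y => ![0, 0, 0, w x y 0 1, w x y 0 2, w x y 1 3 + ε * w x y 2 4]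
  -- [X1,X2] = X4, [X1,X3] = X5, [X1,X5] = Z1, [X2,X4] = Z1
  | .L20, x, y => ![0, 0, 0, w x y 0 1, w x y 0 2, w x y 0 4 + w x y 1 3]
  -- [X1,X2] = X3, [X1,X3] = X4, [X2,X3] = X5, [X1,X4] = Z1, [X2,X5] = ε Z1
  | .L21 ε, x, y =>
    ![0, 0, w x y 0 1, w x y 0 2, w x y 1 2, w x y 0 3 + ε * w x y 1 4]
  -- basis X1 X2 X3 X4 Z1 Z2: [X1,X2] = Z1, [X1,X3] = Z2, [X2,X4] = ε Z2, [X3,X4] = Z1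
  | .L22 ε, x, y =>
    ![0, 0, 0, 0, w x y 0 1 + w x y 2 3, w x y 0 2 + ε * w x y 1 3]
  -- basis X1 X2 X3 X4 Z1 Z2: [X1,X2] = X3, [X1,X3] = Z1, [X1,X4] = Z2, [X2,X4] = Z1
  | .L23, x, y => ![0, 0, w x y 0 1, 0, w x y 0 2 + w x y 1 3, w x y 0 3]
  -- basis X1 X2 X3 X4 Z1 Z2:
  -- [X1,X2] = X3, [X1,X3] = Z1, [X1,X4] = ε Z2, [X2,X3] = Z2, [X2,X4] = Z1
  | .L24 ε, x, y =>
    ![0, 0, w x y 0 1, 0, w x y 0 2 + w x y 1 3, ε * w x y 0 3 + w x y 1 2]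
  -- basis X1 X2 X3 X4 Z1 Z2: [X1,X2] = X3, [X1,X3] = Z1, [X1,X4] = Z2
  | .L25, x, y => ![0, 0, w x y 0 1, 0, w x y 0 2, w x y 0 3]
  -- basis X1 X2 X3 Z1 Z2 Z3: [X1,X2] = Z1, [X1,X3] = Z2, [X2,X3] = Z3
  | .L26, x, y => ![0, 0, 0, w x y 0 1, w x y 0 2, w x y 1 2]

/-- The Lie algebra with a given name: the space `k^6` with the bracket above. -/
def Alg (_c : Name k) : Type u := Fin 6 → k

instance [Ring k] (c : Name k) : AddCommGroup (Alg c) := inferInstanceAs (AddCommGroup (Fin 6 → k))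

instance [Ring k] (c : Name k) : Module k (Alg c) := inferInstanceAs (Module k (Fin 6 → k))

theorem bracket_add_left [CommRing k] (c : Name k) (x y z : Fin 6 → k) :
    bracket c (x + y) z = bracket c x z + bracket c y z := by
  cases c <;> funext i <;> fin_cases i <;> simp [bracket, w] <;> ring

theorem bracket_add_right [CommRing k] (c : Name k) (x y z : Fin 6 → k) :
    bracket c x (y + z) = bracket c x y + bracket c x z := by
  cases c <;> funext i <;> fin_cases i <;> simp [bracket, w] <;> ring

theorem bracket_smul_right [CommRing k] (c : Name k) (t : k) (x y : Fin 6 → k) :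
    bracket c x (t • y) = t • bracket c x y := by
  cases c <;> funext i <;> fin_cases i <;> simp [bracket, w] <;> ring

theorem bracket_self [CommRing k] (c : Name k) (x : Fin 6 → k) : bracket c x x = 0 := by
  cases c <;> funext i <;> fin_cases i <;> simp [bracket, w] <;> ring

set_option maxHeartbeats 4000000 in
theorem bracket_jacobi [CommRing k] (c : Name k) (x y z : Fin 6 → k) :
    bracket c x (bracket c y z)
      = bracket c (bracket c x y) z + bracket c y (bracket c x z) := by
  cases c <;> funext i <;> fin_cases i <;> simp [bracket, w] <;> ring

instance [CommRing k] (c : Name k) : LieRing (Alg c) where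
  bracket x y := bracket c x y
  add_lie := bracket_add_left c
  lie_add := bracket_add_right c
  lie_self := bracket_self c
  leibniz_lie := bracket_jacobi c

instance [CommRing k] (c : Name k) : LieAlgebra k (Alg c) where
  lie_smul := bracket_smul_right c

attribute [local instance] LieRing.ofAssociativeRing

/-- The dimensions of the finite-dimensional faithful representations of `L`. -/
def faithfulDims (k : Type u) [Field k] (L : Type u) [LieRing L] [LieAlgebra k L] : Set ℕ :=
  {n | ∃ (V : Type u) (_ : AddCommGroup V) (_ : Module k V) (π : L →ₗ⁅k⁆ Module.End k V),
    Module.Finite k V ∧ Module.finrank k V = n ∧ Function.Injective π}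

/-- The dimensions of the finite-dimensional faithful nilrepresentations of `L`: those
representations in which every element of `L` acts as a nilpotent endomorphism. -/
def faithfulNilDims (k : Type u) [Field k] (L : Type u) [LieRing L] [LieAlgebra k L] : Set ℕ :=
  {n | ∃ (V : Type u) (_ : AddCommGroup V) (_ : Module k V) (π : L →ₗ⁅k⁆ Module.End k V),
    Module.Finite k V ∧ Module.finrank k V = n ∧ Function.Injective π ∧ ∀ X : L, IsNilpotent (π X)}

/-- `μ = m` and `μ_nil = n` for the algebra with name `c`; both minima exist. -/
def Values [Field k] (c : Name k) (m n : ℕ) : Prop :=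
  IsLeast (faithfulDims k (Alg c)) m ∧ IsLeast (faithfulNilDims k (Alg c)) n

/-- A matrix whose entries are functions of the coordinates `x` is a faithful representation of
the algebra with name `c` on `k^n`. -/
def IsFaithfulRep [Field k] (c : Name k) {n : ℕ}
    (f : (Fin 6 → k) → Matrix (Fin n) (Fin n) k) : Prop :=
  ∃ π : Alg c →ₗ⁅k⁆ Matrix (Fin n) (Fin n) k, (∀ x, π x = f x) ∧ Function.Injective π

/-- A matrix whose entries are functions of the coordinates `x` is a faithful nilrepresentation of
the algebra with name `c` on `k^n`. -/
def IsFaithfulNilrep [Field k] (c : Name k) {n : ℕ}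
    (f : (Fin 6 → k) → Matrix (Fin n) (Fin n) k) : Prop :=
  IsFaithfulRep c f ∧ ∀ x, IsNilpotent (f x)

-- Explicit matrices depending on the coordinates `x` of an element of the algebra.
-- `rep` is a representation, `nil` a nilrepresentation; the number is that of the algebra.
-- `nil19sq` and `nil24sq` are those for the case that `-ε`, respectively `ε`, is a square; `α` is a
-- square root of it.

def nil1 [Field k] (x : Fin 6 → k) : Matrix (Fin 5) (Fin 5) k :=
  !![0, 0, x 0, x 1, x 2;
     0, 0, x 3, x 4, x 5;
     0, 0, 0, 0, 0;
     0, 0, 0, 0, 0;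
     0, 0, 0, 0, 0]

def nil2 [Field k] (x : Fin 6 → k) : Matrix (Fin 5) (Fin 5) k :=
  !![0, 0, x 0, x 2, x 3;
     0, 0, 0, x 4, x 5;
     0, 0, 0, x 1, 0;
     0, 0, 0, 0, 0;
     0, 0, 0, 0, 0]

def nil3 [Field k] (x : Fin 6 → k) : Matrix (Fin 5) (Fin 5) k :=
  !![0, x 0, x 2 + x 4, -2 * x 3, x 5;
     0, 0, x 1, -x 2 + x 4, 0;
     0, 0, 0, x 0, 0;
     0, 0, 0, 0, 0;
     0, 0, 0, 0, 0]

def rep3 [Field k] (x : Fin 6 → k) : Matrix (Fin 4) (Fin 4) k :=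
  !![x 5, x 0, x 2 + x 4, -2 * x 3;
     0, x 5, x 1, -x 2 + x 4;
     0, 0, x 5, x 0;
     0, 0, 0, x 5]

def nil4 [Field k] (x : Fin 6 → k) : Matrix (Fin 5) (Fin 5) k :=
  !![0, x 0, x 2, x 4, x 5;
     0, 0, 0, x 1, 0;
     0, 0, 0, x 3, 0;
     0, 0, 0, 0, 0;
     0, 0, 0, 0, 0]

def rep4 [Field k] (x : Fin 6 → k) : Matrix (Fin 4) (Fin 4) k :=
  !![x 5, x 0, x 2, x 4;
     0, x 5, 0, x 1;
     0, 0, x 5, x 3;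
     0, 0, 0, x 5]

def nil5 [Field k] (x : Fin 6 → k) : Matrix (Fin 5) (Fin 5) k :=
  !![0, x 0, -x 3, x 4, x 5;
     0, 0, x 0, x 2, 0;
     0, 0, 0, x 1, 0;
     0, 0, 0, 0, 0;
     0, 0, 0, 0, 0]

def rep5 [Field k] (x : Fin 6 → k) : Matrix (Fin 4) (Fin 4) k :=
  !![x 5, x 0, -x 3, x 4;
     0, x 5, x 0, x 2;
     0, 0, x 5, x 1;
     0, 0, 0, x 5]

def nil6 [Field k] (x : Fin 6 → k) : Matrix (Fin 5) (Fin 5) k :=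
  !![0, x 0, 3 * x 1, x 3 + x 5, -3 * x 4;
     0, 0, x 0, x 2, -2 * x 3 + x 5;
     0, 0, 0, x 1, -x 2;
     0, 0, 0, 0, x 0;
     0, 0, 0, 0, 0]

def nil7 [Field k] (x : Fin 6 → k) : Matrix (Fin 5) (Fin 5) k :=
  !![0, x 0, 0, x 3 + x 5, -3 * x 4;
     0, 0, x 0, x 2, -2 * x 3 + x 5;
     0, 0, 0, x 1, -x 2;
     0, 0, 0, 0, x 0;
     0, 0, 0, 0, 0]

def nil8 [Field k] (x : Fin 6 → k) : Matrix (Fin 5) (Fin 5) k :=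
  !![0, x 0, x 3, x 4, x 5;
     0, 0, x 1, x 2, 0;
     0, 0, 0, 0, 0;
     0, 0, 0, 0, 0;
     0, 0, 0, 0, 0]

def rep8 [Field k] (x : Fin 6 → k) : Matrix (Fin 4) (Fin 4) k :=
  !![x 5, x 0, x 3, x 4;
     0, x 5, x 1, x 2;
     0, 0, x 5, 0;
     0, 0, 0, x 5]

def nil9 [Field k] (x : Fin 6 → k) : Matrix (Fin 6) (Fin 6) k :=
  !![0, 0, x 1 / 2, -x 2 / 2, x 4, x 5;
     0, 0, x 0, 0, x 3, 0;
     0, 0, 0, x 0, x 2, 0;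
     0, 0, 0, 0, x 1, 0;
     0, 0, 0, 0, 0, 0;
     0, 0, 0, 0, 0, 0]

def rep9 [Field k] (x : Fin 6 → k) : Matrix (Fin 5) (Fin 5) k :=
  !![x 5, 0, x 1 / 2, -x 2 / 2, x 4;
     0, x 5, x 0, 0, x 3;
     0, 0, x 5, x 0, x 2;
     0, 0, 0, x 5, x 1;
     0, 0, 0, 0, x 5]

def nil10 [Field k] (x : Fin 6 → k) : Matrix (Fin 5) (Fin 5) k :=
  !![0, x 0, 0, x 3, x 5;
     0, 0, x 0, 0, x 2;
     0, 0, 0, 0, x 1;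
     0, 0, 0, 0, x 4;
     0, 0, 0, 0, 0]

def nil11 [Field k] (x : Fin 6 → k) : Matrix (Fin 5) (Fin 5) k :=
  !![0, x 0, x 1, -x 4, x 5;
     0, 0, x 0, x 1, x 3;
     0, 0, 0, x 0, x 2;
     0, 0, 0, 0, x 1;
     0, 0, 0, 0, 0]

def nil12 [Field k] (x : Fin 6 → k) : Matrix (Fin 5) (Fin 5) k :=
  !![0, x 0, 0, -x 4, x 5;
     0, 0, x 0, 0, x 3;
     0, 0, 0, x 0, x 2;
     0, 0, 0, 0, x 1;
     0, 0, 0, 0, 0]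

def nil13 [Field k] (x : Fin 6 → k) : Matrix (Fin 5) (Fin 5) k :=
  !![0, x 0, -x 3, 0, x 5;
     0, 0, x 0, -x 3, x 4;
     0, 0, 0, x 0, x 2;
     0, 0, 0, 0, x 1;
     0, 0, 0, 0, 0]

def nil14 [Field k] (x : Fin 6 → k) : Matrix (Fin 6) (Fin 6) k :=
  !![0, x 1, -x 2, x 3, -x 4, 2 * x 5;
     0, 0, x 0, x 1 / 3, -2 * x 2 / 3, x 4;
     0, 0, 0, x 0, -x 1 / 3, x 3;
     0, 0, 0, 0, x 0, x 2;
     0, 0, 0, 0, 0, x 1;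
     0, 0, 0, 0, 0, 0]

def nil15 [Field k] (x : Fin 6 → k) : Matrix (Fin 6) (Fin 6) k :=
  !![0, x 0, x 1 / 2, 0, -x 3 / 2, x 5;
     0, 0, x 0, x 1 / 2, -x 2 / 2, x 4;
     0, 0, 0, x 0, 0, x 3;
     0, 0, 0, 0, x 0, x 2;
     0, 0, 0, 0, 0, x 1;
     0, 0, 0, 0, 0, 0]

def nil16 [Field k] (x : Fin 6 → k) : Matrix (Fin 6) (Fin 6) k :=
  !![0, x 0, x 2, -2 * x 3, 3 * x 4, -3 * x 5;
     0, 0, x 1, -x 2, x 3, 0;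
     0, 0, 0, x 0, 0, x 3;
     0, 0, 0, 0, x 0, x 2;
     0, 0, 0, 0, 0, x 1;
     0, 0, 0, 0, 0, 0]

def nil17 [Field k] (x : Fin 6 → k) : Matrix (Fin 6) (Fin 6) k :=
  !![0, x 0, 0, x 1 / 2, -x 2 / 2, x 5;
     0, 0, x 0, 0, 0, x 4;
     0, 0, 0, x 0, 0, x 3;
     0, 0, 0, 0, x 0, x 2;
     0, 0, 0, 0, 0, x 1;
     0, 0, 0, 0, 0, 0]

def nil18 [Field k] (x : Fin 6 → k) : Matrix (Fin 6) (Fin 6) k :=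
  !![0, x 0, 0, 0, 0, x 5;
     0, 0, x 0, 0, 0, x 4;
     0, 0, 0, x 0, 0, x 3;
     0, 0, 0, 0, x 0, x 2;
     0, 0, 0, 0, 0, x 1;
     0, 0, 0, 0, 0, 0]

def nil19sq [Field k] (α : k) (x : Fin 6 → k) : Matrix (Fin 4) (Fin 4) k :=
  !![0, -x 1 / α + x 2, x 3 / α - x 4, -2 * x 5 / α;
     0, 0, x 0, x 3 + α * x 4;
     0, 0, 0, x 1 + α * x 2;
     0, 0, 0, 0]

def nil19 [Field k] (ε : k) (x : Fin 6 → k) : Matrix (Fin 5) (Fin 5) k :=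
  !![0, x 0, x 3, x 4, x 5;
     0, 0, x 1, x 2, 0;
     0, 0, 0, 0, -x 1;
     0, 0, 0, 0, -ε * x 2;
     0, 0, 0, 0, 0]

def nil20 [Field k] (x : Fin 6 → k) : Matrix (Fin 5) (Fin 5) k :=
  !![0, x 0, 0, x 3, x 5;
     0, 0, x 0, x 1, x 4;
     0, 0, 0, 0, x 2;
     0, 0, 0, 0, -x 1;
     0, 0, 0, 0, 0]

def nil21 [Field k] (ε : k) (x : Fin 6 → k) : Matrix (Fin 5) (Fin 5) k :=
  !![0, -x 0 + x 1, (ε + 1) * x 2, -x 3 - ε * x 4, 3 * x 5;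
     0, 0, x 0 - (ε + 2) * x 1, x 2, -2 * x 3 + ε * x 4;
     0, 0, 0, x 1, -x 2;
     0, 0, 0, 0, 2 * x 1 + x 0;
     0, 0, 0, 0, 0]

def nil21zero [Field k] (x : Fin 6 → k) : Matrix (Fin 5) (Fin 5) k :=
  !![0, x 0, x 2, -2 * x 3 - x 4, 3 * x 5;
     0, 0, x 1, -x 2, x 3 - x 4;
     0, 0, 0, x 0 + x 1, -x 2;
     0, 0, 0, 0, x 0;
     0, 0, 0, 0, 0]

def nil22 [Field k] (ε : k) (x : Fin 6 → k) : Matrix (Fin 5) (Fin 5) k :=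
  !![0, x 0, -x 3, x 4, x 5;
     0, 0, 0, x 1, x 2;
     0, 0, 0, x 2, ε * x 1;
     0, 0, 0, 0, 0;
     0, 0, 0, 0, 0]

def nil23 [Field k] (x : Fin 6 → k) : Matrix (Fin 5) (Fin 5) k :=
  !![0, x 0, -x 3, x 5, x 4;
     0, 0, x 0, 0, x 2;
     0, 0, 0, x 0, x 1;
     0, 0, 0, 0, 0;
     0, 0, 0, 0, 0]

def nil24sq [Field k] (α : k) (x : Fin 6 → k) : Matrix (Fin 5) (Fin 5) k :=
  !![0, α * x 0 + x 1, (α - α ^ 2) * x 3 + (α - 1) * x 2, (3 * α - 1) * x 4 + (3 - α) * x 5, (1 - α) * x 4 + (1 - α) * x 5;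
     0, 0, x 0 + x 1, (-α ^ 2 + 4 * α - 1) * x 3 + 2 * x 2, (1 - α ^ 2) * x 3;
     0, 0, 0, -x 0 + x 1, x 0 + x 1;
     0, 0, 0, 0, 0;
     0, 0, 0, 0, 0]

def nil24 [Field k] (ε : k) (x : Fin 6 → k) : Matrix (Fin 6) (Fin 6) k :=
  !![0, x 1, x 0, x 2, -2 * x 4, -x 5;
     0, 0, 0, 0, -2 * x 3, 0;
     0, 0, 0, x 1, -x 2, -ε * x 3;
     0, 0, 0, 0, x 0, x 1;
     0, 0, 0, 0, 0, 0;
     0, 0, 0, 0, 0, 0]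

def nil25 [Field k] (x : Fin 6 → k) : Matrix (Fin 5) (Fin 5) k :=
  !![0, x 0, x 2, 2 * x 4, x 5;
     0, 0, x 1, x 2, x 3;
     0, 0, 0, -x 0, 0;
     0, 0, 0, 0, 0;
     0, 0, 0, 0, 0]

def nil26 [Field k] (x : Fin 6 → k) : Matrix (Fin 5) (Fin 5) k :=
  !![0, 0, x 0, x 3, x 4;
     0, 0, x 1, 0, x 5;
     0, 0, 0, x 1, x 2;
     0, 0, 0, 0, 0;
     0, 0, 0, 0, 0]

end NilSix

/-!
The upper bounds come from the explicit matrices, which are checked entry by entry. The lower bounds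
rest on two reductions to strictly upper triangular matrices and on computations with those.

For nilrepresentations, Engel's theorem (`exists_isUpper_of_isNilpotent`) turns a faithful
nilrepresentation of dimension at most `n` into a faithful representation by strictly upper
triangular `n × n` matrices, `HasUpperRep c n`.

For arbitrary representations, one extends scalars to an algebraic closure and splits the module
into generalized weight spaces; the algebra is nilpotent, so these are submodules, on each of which
it acts by a weight plus strictly upper triangular matrices. On a weight space of dimension `d ≤ 3`
it acts through a quotient of dimension at most `4 d / 3`, so that a faithful module of a
6-dimensional algebra has dimension at least `4`, and in dimension `4` there is only one weight
(`three_mul_finrank_le`). Brackets have weight zero. Hence a nonzero fivefold bracket requires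
dimension at least `6`, and if there are two independent threefold brackets, a faithful module of
dimension `5` has only one weight (`exists_genWeightSpace_eq_top_of_lie_lie`). When there is only
one weight it is a normalized trace, so it is defined over the base field, and the algebra has a
representation by strictly upper triangular matrices plus a scalar character that is jointly
faithful, `HasScalarUpperRep c n`. If the centre lies in the derived algebra, the scalars can be
dropped (`HasScalarUpperRep.hasUpperRep`).

The algebra of strictly upper triangular `4 × 4` matrices has dimension `6`, so that
`HasUpperRep c 4` means an isomorphism with it. It has a one-dimensional centre, its threefold
brackets span a line, and its fourfold brackets vanish; where these invariants do not decide, the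
relations between the elementary matrices `E₀₁`, `E₁₂`, `E₂₃` do (`HasUpperRep.exists_generators`).
For two algebras with a big centre there is a separate dimension count
(`not_hasScalarUpperRep_four_of_central`).

What is left are the strictly upper triangular `5 × 5` matrices for `L9` and `L24 ε`. In both cases
there are elements `X`, `Y` such that `⁅X, ⁅X, Y⁆⁆` and `⁅Y, ⁅X, Y⁆⁆` are central and independent.
This determines the superdiagonals of `X` and `Y` up to few parameters (`exists_ratio`). For `L9`
the further central element has no room (`HasUpperRep.false_of_commute`). For `L24 ε` the fourth
basis vector leads to an eigenvector equation that makes `ε` a square (`HasUpperRep.exists_sq_eq`).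
-/

namespace NilSix
variable {k : Type u}
attribute [local instance] LieRing.ofAssociativeRing

/-! ### Matrices with constant diagonal that vanish below it -/

/-- For strictly upper triangular matrices the sum that defines an entry of the product is over the
indices strictly between the row and the column. -/
theorem mul_apply_of_strict [CommRing k] {n : ℕ} {A B : Matrix (Fin n) (Fin n) k}
    (hA : ∀ i j, j ≤ i → A i j = 0) (hB : ∀ i j, j ≤ i → B i j = 0) (i j : Fin n) :
    (A * B) i j = ∑ l ∈ Finset.Ioo i j, A i l * B l j := by
  rw [Matrix.mul_apply]
  refine (Finset.sum_subset (Finset.subset_univ _) fun l _ hl => ?_).symm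
  rw [Finset.mem_Ioo, not_and_or, not_lt, not_lt] at hl
  rcases hl with h | h
  · rw [hA i l h, zero_mul]
  · rw [hB l j h, mul_zero]

/-- The form of `C = A * B - B * A` in which the summands pair up to `2 × 2` minors, as they do in
the function `w` in terms of which the brackets are given. -/
theorem eq_commutator_of_strict [CommRing k] {n : ℕ} {A B C : Matrix (Fin n) (Fin n) k}
    (hA : ∀ i j, j ≤ i → A i j = 0) (hB : ∀ i j, j ≤ i → B i j = 0)
    (hC : ∀ i j, j ≤ i → C i j = 0)
    (h : ∀ i j, i < j → C i j = ∑ l ∈ Finset.Ioo i j, (A i l * B l j - B i l * A l j)) :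
    C = A * B - B * A := by
  ext i j
  rw [Matrix.sub_apply, mul_apply_of_strict hA hB, mul_apply_of_strict hB hA,
    ← Finset.sum_sub_distrib]
  rcases lt_or_ge i j with hij | hij
  · exact h i j hij
  · rw [hC i j hij, Finset.Ioo_eq_empty (not_lt.2 hij), Finset.sum_empty]

theorem commutator_smul_one_add [CommRing k] {n : ℕ} (d e : k) (A B : Matrix (Fin n) (Fin n) k) :
    (d • 1 + A) * (e • 1 + B) - (e • 1 + B) * (d • 1 + A) = A * B - B * A := by
  rw [← sub_eq_zero]
  simp [add_mul, mul_add, smul_smul, mul_comm e d]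
  abel

theorem sum_eq_two [CommRing k] {n : ℕ} {s : Finset (Fin n)} {f : Fin n → k} (a b : Fin n)
    (h : s = {a, b}) (hab : a ≠ b) : ∑ i ∈ s, f i = f a + f b := by
  rw [h, Finset.sum_pair hab]

theorem sum_eq_three [CommRing k] {n : ℕ} {s : Finset (Fin n)} {f : Fin n → k} (a b c : Fin n)
    (h : s = {a, b, c}) (hab : a ∉ ({b, c} : Finset _) ∧ b ≠ c) :
    ∑ i ∈ s, f i = f a + (f b + f c) := by
  rw [h, Finset.sum_insert hab.1, Finset.sum_pair hab.2]

theorem sum_eq_four [CommRing k] {n : ℕ} {s : Finset (Fin n)} {f : Fin n → k} (a b c d : Fin n)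
    (h : s = {a, b, c, d}) (hab : a ∉ ({b, c, d} : Finset _) ∧ b ∉ ({c, d} : Finset _) ∧ c ≠ d) :
    ∑ i ∈ s, f i = f a + (f b + (f c + f d)) := by
  rw [h, Finset.sum_insert hab.1, Finset.sum_insert hab.2.1, Finset.sum_pair hab.2.2]

theorem isNilpotent_of_strict [CommRing k] {n : ℕ} {A : Matrix (Fin n) (Fin n) k}
    (hA : ∀ i j, j ≤ i → A i j = 0) : IsNilpotent A := by
  have key : ∀ m : ℕ, ∀ i j : Fin n, (j : ℕ) < i + m → (A ^ m) i j = 0 := by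
    intro m
    induction m with
    | zero =>
      intro i j h
      rw [pow_zero, Matrix.one_apply_ne]
      rintro rfl
      omega
    | succ m ih =>
      intro i j h
      rw [pow_succ, Matrix.mul_apply]
      refine Finset.sum_eq_zero fun l _ => ?_
      by_cases hl : (l : ℕ) < i + m
      · rw [ih i l hl, zero_mul]
      · rw [hA l j (Fin.le_def.2 (by omega)), mul_zero]
  refine ⟨n, ?_⟩
  ext i j
  exact key n i j (by omega)

theorem isFaithfulRep_of [Field k] {c : Name k} {n : ℕ}
    {f : (Fin 6 → k) → Matrix (Fin n) (Fin n) k}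
    (hadd : ∀ x y, f (x + y) = f x + f y) (hsmul : ∀ (t : k) x, f (t • x) = t • f x)
    (hlie : ∀ x y, f (bracket c x y) = f x * f y - f y * f x) (h0 : ∀ x, f x = 0 → x = 0) :
    IsFaithfulRep c f :=
  let π : Alg c →ₗ⁅k⁆ Matrix (Fin n) (Fin n) k :=
    { toFun := f, map_add' := hadd, map_smul' := hsmul, map_lie' := fun {x y} => hlie x y }
  ⟨π, fun _ => rfl, (injective_iff_map_eq_zero π).2 h0⟩

/-- The upper triangular `4 × 4` matrix with constant diagonal `d` and the given entries above it,
listed row by row. -/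
def upperFour [Field k] (d a01 a02 a03 a12 a13 a23 : k) : Matrix (Fin 4) (Fin 4) k :=
  !![d, a01, a02, a03;
     0, d, a12, a13;
     0, 0, d, a23;
     0, 0, 0, d]

theorem upperFour_add [Field k] (d e a01 a02 a03 a12 a13 a23 b01 b02 b03 b12 b13 b23 : k) :
    upperFour d a01 a02 a03 a12 a13 a23 + upperFour e b01 b02 b03 b12 b13 b23 = upperFour (d +
    e) (a01 + b01) (a02 + b02) (a03 + b03) (a12 + b12) (a13 + b13) (a23 + b23) := by
  simp [upperFour]

theorem upperFour_smul [Field k] (t d a01 a02 a03 a12 a13 a23 : k) : t • upperFour d a01 a02 a03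
    a12 a13 a23 = upperFour (t * d) (t * a01) (t * a02) (t * a03) (t * a12) (t * a13) (t * a23)
    := by
  simp [upperFour]

theorem upperFour_eq [Field k] (d a01 a02 a03 a12 a13 a23 : k) : upperFour d a01 a02 a03 a12 a13
    a23 = d • 1 + upperFour 0 a01 a02 a03 a12 a13 a23 := by
  rw [← Matrix.diagonal_one]
  ext i j
  fin_cases i <;> fin_cases j <;> simp [upperFour]

theorem upperFour_strict [Field k] {a01 a02 a03 a12 a13 a23 : k} : ∀ i j, j ≤ i → upperFour 0
    a01 a02 a03 a12 a13 a23 i j = 0 := by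
  intro i j h
  fin_cases i <;> fin_cases j <;> first | rfl | exact absurd h (by decide)

theorem upperFour_lie [Field k] (d e a01 a02 a03 a12 a13 a23 b01 b02 b03 b12 b13 b23 : k) :
    upperFour d a01 a02 a03 a12 a13 a23 * upperFour e b01 b02 b03 b12 b13 b23 - upperFour e b01
    b02 b03 b12 b13 b23 * upperFour d a01 a02 a03 a12 a13 a23 = upperFour 0 0 (a01 * b12 - b01 *
    a12) ((a01 * b13 - b01 * a13) + (a02 * b23 - b02 * a23)) 0 (a12 * b23 - b12 * a23) 0 := by
  rw [upperFour_eq d, upperFour_eq e, commutator_smul_one_add]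
  refine (eq_commutator_of_strict upperFour_strict upperFour_strict upperFour_strict ?_).symm
  intro i j h
  fin_cases i <;> fin_cases j <;> first | exact absurd h (by decide) | skip
  · rfl
  · exact (Finset.sum_singleton _ _).symm
  · refine Eq.trans ?_ (sum_eq_two (n := 4) 1 2 ?_ (by decide)).symm <;> rfl
  · rfl
  · exact (Finset.sum_singleton _ _).symm
  · rfl

/-- The upper triangular `5 × 5` matrix with constant diagonal `d` and the given entries above it,
listed row by row. -/
def upperFive [Field k] (d a01 a02 a03 a04 a12 a13 a14 a23 a24 a34 : k) :
    Matrix (Fin 5) (Fin 5) k :=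
  !![d, a01, a02, a03, a04;
     0, d, a12, a13, a14;
     0, 0, d, a23, a24;
     0, 0, 0, d, a34;
     0, 0, 0, 0, d]

theorem upperFive_add [Field k] (d e a01 a02 a03 a04 a12 a13 a14 a23 a24 a34 b01 b02 b03 b04 b12
    b13 b14 b23 b24 b34 : k) : upperFive d a01 a02 a03 a04 a12 a13 a14 a23 a24 a34 + upperFive e
    b01 b02 b03 b04 b12 b13 b14 b23 b24 b34 = upperFive (d + e) (a01 + b01) (a02 + b02) (a03 +
    b03) (a04 + b04) (a12 + b12) (a13 + b13) (a14 + b14) (a23 + b23) (a24 + b24) (a34 + b34) :=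
    by
  simp [upperFive]

theorem upperFive_smul [Field k] (t d a01 a02 a03 a04 a12 a13 a14 a23 a24 a34 : k) : t •
    upperFive d a01 a02 a03 a04 a12 a13 a14 a23 a24 a34 = upperFive (t * d) (t * a01) (t * a02)
    (t * a03) (t * a04) (t * a12) (t * a13) (t * a14) (t * a23) (t * a24) (t * a34) := by
  simp [upperFive]

theorem upperFive_eq [Field k] (d a01 a02 a03 a04 a12 a13 a14 a23 a24 a34 : k) : upperFive d a01
    a02 a03 a04 a12 a13 a14 a23 a24 a34 = d • 1 + upperFive 0 a01 a02 a03 a04 a12 a13 a14 a23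
    a24 a34 := by
  rw [← Matrix.diagonal_one]
  ext i j
  fin_cases i <;> fin_cases j <;> simp [upperFive]

theorem upperFive_strict [Field k] {a01 a02 a03 a04 a12 a13 a14 a23 a24 a34 : k} : ∀ i j, j ≤ i
    → upperFive 0 a01 a02 a03 a04 a12 a13 a14 a23 a24 a34 i j = 0 := by
  intro i j h
  fin_cases i <;> fin_cases j <;> first | rfl | exact absurd h (by decide)

theorem upperFive_lie [Field k] (d e a01 a02 a03 a04 a12 a13 a14 a23 a24 a34 b01 b02 b03 b04 b12
    b13 b14 b23 b24 b34 : k) : upperFive d a01 a02 a03 a04 a12 a13 a14 a23 a24 a34 * upperFive e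
    b01 b02 b03 b04 b12 b13 b14 b23 b24 b34 - upperFive e b01 b02 b03 b04 b12 b13 b14 b23 b24
    b34 * upperFive d a01 a02 a03 a04 a12 a13 a14 a23 a24 a34 = upperFive 0 0 (a01 * b12 - b01 *
    a12) ((a01 * b13 - b01 * a13) + (a02 * b23 - b02 * a23)) ((a01 * b14 - b01 * a14) + ((a02 *
    b24 - b02 * a24) + (a03 * b34 - b03 * a34))) 0 (a12 * b23 - b12 * a23) ((a12 * b24 - b12 *
    a24) + (a13 * b34 - b13 * a34)) 0 (a23 * b34 - b23 * a34) 0 := by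
  rw [upperFive_eq d, upperFive_eq e, commutator_smul_one_add]
  refine (eq_commutator_of_strict upperFive_strict upperFive_strict upperFive_strict ?_).symm
  intro i j h
  fin_cases i <;> fin_cases j <;> first | exact absurd h (by decide) | skip
  · rfl
  · exact (Finset.sum_singleton _ _).symm
  · refine Eq.trans ?_ (sum_eq_two (n := 5) 1 2 ?_ (by decide)).symm <;> rfl
  · refine Eq.trans ?_ (sum_eq_three (n := 5) 1 2 3 ?_ (by decide)).symm <;> rfl
  · rfl
  · exact (Finset.sum_singleton _ _).symm
  · refine Eq.trans ?_ (sum_eq_two (n := 5) 2 3 ?_ (by decide)).symm <;> rfl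
  · rfl
  · exact (Finset.sum_singleton _ _).symm
  · rfl

/-- The upper triangular `6 × 6` matrix with constant diagonal `d` and the given entries above it,
listed row by row. -/
def upperSix [Field k] (d a01 a02 a03 a04 a05 a12 a13 a14 a15 a23 a24 a25 a34 a35 a45 : k) :
    Matrix (Fin 6) (Fin 6) k :=
  !![d, a01, a02, a03, a04, a05;
     0, d, a12, a13, a14, a15;
     0, 0, d, a23, a24, a25;
     0, 0, 0, d, a34, a35;
     0, 0, 0, 0, d, a45;
     0, 0, 0, 0, 0, d]

theorem upperSix_add [Field k] (d e a01 a02 a03 a04 a05 a12 a13 a14 a15 a23 a24 a25 a34 a35 a45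
    b01 b02 b03 b04 b05 b12 b13 b14 b15 b23 b24 b25 b34 b35 b45 : k) : upperSix d a01 a02 a03
    a04 a05 a12 a13 a14 a15 a23 a24 a25 a34 a35 a45 + upperSix e b01 b02 b03 b04 b05 b12 b13 b14
    b15 b23 b24 b25 b34 b35 b45 = upperSix (d + e) (a01 + b01) (a02 + b02) (a03 + b03) (a04 +
    b04) (a05 + b05) (a12 + b12) (a13 + b13) (a14 + b14) (a15 + b15) (a23 + b23) (a24 + b24)
    (a25 + b25) (a34 + b34) (a35 + b35) (a45 + b45) := by
  simp [upperSix]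

theorem upperSix_smul [Field k] (t d a01 a02 a03 a04 a05 a12 a13 a14 a15 a23 a24 a25 a34 a35 a45
    : k) : t • upperSix d a01 a02 a03 a04 a05 a12 a13 a14 a15 a23 a24 a25 a34 a35 a45 = upperSix
    (t * d) (t * a01) (t * a02) (t * a03) (t * a04) (t * a05) (t * a12) (t * a13) (t * a14) (t *
    a15) (t * a23) (t * a24) (t * a25) (t * a34) (t * a35) (t * a45) := by
  simp [upperSix]

theorem upperSix_eq [Field k] (d a01 a02 a03 a04 a05 a12 a13 a14 a15 a23 a24 a25 a34 a35 a45 :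
    k) : upperSix d a01 a02 a03 a04 a05 a12 a13 a14 a15 a23 a24 a25 a34 a35 a45 = d • 1 +
    upperSix 0 a01 a02 a03 a04 a05 a12 a13 a14 a15 a23 a24 a25 a34 a35 a45 := by
  rw [← Matrix.diagonal_one]
  ext i j
  fin_cases i <;> fin_cases j <;> simp [upperSix]

theorem upperSix_strict [Field k] {a01 a02 a03 a04 a05 a12 a13 a14 a15 a23 a24 a25 a34 a35 a45 :
    k} : ∀ i j, j ≤ i → upperSix 0 a01 a02 a03 a04 a05 a12 a13 a14 a15 a23 a24 a25 a34 a35 a45 i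
    j = 0 := by
  intro i j h
  fin_cases i <;> fin_cases j <;> first | rfl | exact absurd h (by decide)

theorem upperSix_lie [Field k] (d e a01 a02 a03 a04 a05 a12 a13 a14 a15 a23 a24 a25 a34 a35 a45
    b01 b02 b03 b04 b05 b12 b13 b14 b15 b23 b24 b25 b34 b35 b45 : k) : upperSix d a01 a02 a03
    a04 a05 a12 a13 a14 a15 a23 a24 a25 a34 a35 a45 * upperSix e b01 b02 b03 b04 b05 b12 b13 b14
    b15 b23 b24 b25 b34 b35 b45 - upperSix e b01 b02 b03 b04 b05 b12 b13 b14 b15 b23 b24 b25 b34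
    b35 b45 * upperSix d a01 a02 a03 a04 a05 a12 a13 a14 a15 a23 a24 a25 a34 a35 a45 = upperSix
    0 0 (a01 * b12 - b01 * a12) ((a01 * b13 - b01 * a13) + (a02 * b23 - b02 * a23)) ((a01 * b14
    - b01 * a14) + ((a02 * b24 - b02 * a24) + (a03 * b34 - b03 * a34))) ((a01 * b15 - b01 * a15)
    + ((a02 * b25 - b02 * a25) + ((a03 * b35 - b03 * a35) + (a04 * b45 - b04 * a45)))) 0 (a12 *
    b23 - b12 * a23) ((a12 * b24 - b12 * a24) + (a13 * b34 - b13 * a34)) ((a12 * b25 - b12 *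
    a25) + ((a13 * b35 - b13 * a35) + (a14 * b45 - b14 * a45))) 0 (a23 * b34 - b23 * a34) ((a23
    * b35 - b23 * a35) + (a24 * b45 - b24 * a45)) 0 (a34 * b45 - b34 * a45) 0 := by
  rw [upperSix_eq d, upperSix_eq e, commutator_smul_one_add]
  refine (eq_commutator_of_strict upperSix_strict upperSix_strict upperSix_strict ?_).symm
  intro i j h
  fin_cases i <;> fin_cases j <;> first | exact absurd h (by decide) | skip
  · rfl
  · exact (Finset.sum_singleton _ _).symm
  · refine Eq.trans ?_ (sum_eq_two (n := 6) 1 2 ?_ (by decide)).symm <;> rfl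
  · refine Eq.trans ?_ (sum_eq_three (n := 6) 1 2 3 ?_ (by decide)).symm <;> rfl
  · refine Eq.trans ?_ (sum_eq_four (n := 6) 1 2 3 4 ?_ (by decide)).symm <;> rfl
  · rfl
  · exact (Finset.sum_singleton _ _).symm
  · refine Eq.trans ?_ (sum_eq_two (n := 6) 2 3 ?_ (by decide)).symm <;> rfl
  · refine Eq.trans ?_ (sum_eq_three (n := 6) 2 3 4 ?_ (by decide)).symm <;> rfl
  · rfl
  · exact (Finset.sum_singleton _ _).symm
  · refine Eq.trans ?_ (sum_eq_two (n := 6) 3 4 ?_ (by decide)).symm <;> rfl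
  · rfl
  · exact (Finset.sum_singleton _ _).symm
  · rfl

/-- Entrywise criterion for a representation by upper triangular `4 × 4` matrices with constant
diagonal. -/
theorem isFaithfulRep_upperFour [Field k] {c : Name k}
    {f : (Fin 6 → k) → Matrix (Fin 4) (Fin 4) k}
    {g a01 a02 a03 a12 a13 a23 : (Fin 6 → k) → k}
    (hf : ∀ x, f x = upperFour (g x) (a01 x) (a02 x) (a03 x) (a12 x) (a13 x) (a23 x))
    (hadd : ∀ x y, g (x + y) = g x + g y ∧ a01 (x + y) = a01 x + a01 y ∧ a02 (x + y) = a02 x +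
      a02 y ∧ a03 (x + y) = a03 x + a03 y ∧ a12 (x + y) = a12 x + a12 y ∧ a13 (x + y) = a13 x +
      a13 y ∧ a23 (x + y) = a23 x + a23 y)
    (hsmul : ∀ (t : k) x, g (t • x) = t * g x ∧ a01 (t • x) = t * a01 x ∧ a02 (t • x) = t * a02
      x ∧ a03 (t • x) = t * a03 x ∧ a12 (t • x) = t * a12 x ∧ a13 (t • x) = t * a13 x ∧ a23 (t •
      x) = t * a23 x)
    (hlie : ∀ x y, g (bracket c x y) = 0 ∧ a01 (bracket c x y) = 0 ∧ a02 (bracket c x y) = (a01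
      x * a12 y - a01 y * a12 x) ∧ a03 (bracket c x y) = ((a01 x * a13 y - a01 y * a13 x) + (a02
      x * a23 y - a02 y * a23 x)) ∧ a12 (bracket c x y) = 0 ∧ a13 (bracket c x y) = (a12 x * a23
      y - a12 y * a23 x) ∧ a23 (bracket c x y) = 0)
    (h0 : ∀ x, g x = 0 ∧ a01 x = 0 ∧ a02 x = 0 ∧ a03 x = 0 ∧ a12 x = 0 ∧ a13 x = 0 ∧ a23 x = 0 →
      x = 0) :
    IsFaithfulRep c f := by
  refine isFaithfulRep_of (fun x y => ?_) (fun t x => ?_) (fun x y => ?_) fun x h => h0 x ?_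
  · rw [hf, hf, hf, upperFour_add]
    obtain ⟨hg, h01, h02, h03, h12, h13, h23⟩ := hadd x y
    rw [hg, h01, h02, h03, h12, h13, h23]
  · rw [hf, hf, upperFour_smul]
    obtain ⟨hg, h01, h02, h03, h12, h13, h23⟩ := hsmul t x
    rw [hg, h01, h02, h03, h12, h13, h23]
  · rw [hf, hf, hf, upperFour_lie]
    obtain ⟨hg, h01, h02, h03, h12, h13, h23⟩ := hlie x y
    rw [hg, h01, h02, h03, h12, h13, h23]
  · rw [hf] at h
    exact ⟨congrFun (congrFun h 0) 0, congrFun (congrFun h 0) 1, congrFun (congrFun h 0) 2,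
      congrFun (congrFun h 0) 3, congrFun (congrFun h 1) 2, congrFun (congrFun h 1) 3,
      congrFun (congrFun h 2) 3⟩

theorem isFaithfulNilrep_upperFour [Field k] {c : Name k}
    {f : (Fin 6 → k) → Matrix (Fin 4) (Fin 4) k}
    {a01 a02 a03 a12 a13 a23 : (Fin 6 → k) → k}
    (hf : ∀ x, f x = upperFour 0 (a01 x) (a02 x) (a03 x) (a12 x) (a13 x) (a23 x))
    (hadd : ∀ x y, a01 (x + y) = a01 x + a01 y ∧ a02 (x + y) = a02 x + a02 y ∧ a03 (x + y) = a03
      x + a03 y ∧ a12 (x + y) = a12 x + a12 y ∧ a13 (x + y) = a13 x + a13 y ∧ a23 (x + y) = a23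
      x + a23 y)
    (hsmul : ∀ (t : k) x, a01 (t • x) = t * a01 x ∧ a02 (t • x) = t * a02 x ∧ a03 (t • x) = t *
      a03 x ∧ a12 (t • x) = t * a12 x ∧ a13 (t • x) = t * a13 x ∧ a23 (t • x) = t * a23 x)
    (hlie : ∀ x y, a01 (bracket c x y) = 0 ∧ a02 (bracket c x y) = (a01 x * a12 y - a01 y * a12
      x) ∧ a03 (bracket c x y) = ((a01 x * a13 y - a01 y * a13 x) + (a02 x * a23 y - a02 y * a23
      x)) ∧ a12 (bracket c x y) = 0 ∧ a13 (bracket c x y) = (a12 x * a23 y - a12 y * a23 x) ∧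
      a23 (bracket c x y) = 0)
    (h0 : ∀ x, a01 x = 0 ∧ a02 x = 0 ∧ a03 x = 0 ∧ a12 x = 0 ∧ a13 x = 0 ∧ a23 x = 0 → x = 0) :
    IsFaithfulNilrep c f :=
  ⟨isFaithfulRep_upperFour (g := fun _ => 0) hf
      (fun x y => ⟨(add_zero 0).symm, hadd x y⟩) (fun t x => ⟨(mul_zero t).symm, hsmul t x⟩)
      (fun x y => ⟨rfl, hlie x y⟩) fun x h => h0 x h.2,
    fun x => isNilpotent_of_strict (hf x ▸ upperFour_strict)⟩

/-- Entrywise criterion for a representation by upper triangular `5 × 5` matrices with constant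
diagonal. -/
theorem isFaithfulRep_upperFive [Field k] {c : Name k}
    {f : (Fin 6 → k) → Matrix (Fin 5) (Fin 5) k}
    {g a01 a02 a03 a04 a12 a13 a14 a23 a24 a34 : (Fin 6 → k) → k}
    (hf : ∀ x, f x = upperFive (g x) (a01 x) (a02 x) (a03 x) (a04 x) (a12 x) (a13 x) (a14 x)
      (a23 x) (a24 x) (a34 x))
    (hadd : ∀ x y, g (x + y) = g x + g y ∧ a01 (x + y) = a01 x + a01 y ∧ a02 (x + y) = a02 x +
      a02 y ∧ a03 (x + y) = a03 x + a03 y ∧ a04 (x + y) = a04 x + a04 y ∧ a12 (x + y) = a12 x +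
      a12 y ∧ a13 (x + y) = a13 x + a13 y ∧ a14 (x + y) = a14 x + a14 y ∧ a23 (x + y) = a23 x +
      a23 y ∧ a24 (x + y) = a24 x + a24 y ∧ a34 (x + y) = a34 x + a34 y)
    (hsmul : ∀ (t : k) x, g (t • x) = t * g x ∧ a01 (t • x) = t * a01 x ∧ a02 (t • x) = t * a02
      x ∧ a03 (t • x) = t * a03 x ∧ a04 (t • x) = t * a04 x ∧ a12 (t • x) = t * a12 x ∧ a13 (t •
      x) = t * a13 x ∧ a14 (t • x) = t * a14 x ∧ a23 (t • x) = t * a23 x ∧ a24 (t • x) = t * a24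
      x ∧ a34 (t • x) = t * a34 x)
    (hlie : ∀ x y, g (bracket c x y) = 0 ∧ a01 (bracket c x y) = 0 ∧ a02 (bracket c x y) = (a01
      x * a12 y - a01 y * a12 x) ∧ a03 (bracket c x y) = ((a01 x * a13 y - a01 y * a13 x) + (a02
      x * a23 y - a02 y * a23 x)) ∧ a04 (bracket c x y) = ((a01 x * a14 y - a01 y * a14 x) +
      ((a02 x * a24 y - a02 y * a24 x) + (a03 x * a34 y - a03 y * a34 x))) ∧ a12 (bracket c x y)
      = 0 ∧ a13 (bracket c x y) = (a12 x * a23 y - a12 y * a23 x) ∧ a14 (bracket c x y) = ((a12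
      x * a24 y - a12 y * a24 x) + (a13 x * a34 y - a13 y * a34 x)) ∧ a23 (bracket c x y) = 0 ∧
      a24 (bracket c x y) = (a23 x * a34 y - a23 y * a34 x) ∧ a34 (bracket c x y) = 0)
    (h0 : ∀ x, g x = 0 ∧ a01 x = 0 ∧ a02 x = 0 ∧ a03 x = 0 ∧ a04 x = 0 ∧ a12 x = 0 ∧ a13 x = 0 ∧
      a14 x = 0 ∧ a23 x = 0 ∧ a24 x = 0 ∧ a34 x = 0 → x = 0) :
    IsFaithfulRep c f := by
  refine isFaithfulRep_of (fun x y => ?_) (fun t x => ?_) (fun x y => ?_) fun x h => h0 x ?_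
  · rw [hf, hf, hf, upperFive_add]
    obtain ⟨hg, h01, h02, h03, h04, h12, h13, h14, h23, h24, h34⟩ := hadd x y
    rw [hg, h01, h02, h03, h04, h12, h13, h14, h23, h24, h34]
  · rw [hf, hf, upperFive_smul]
    obtain ⟨hg, h01, h02, h03, h04, h12, h13, h14, h23, h24, h34⟩ := hsmul t x
    rw [hg, h01, h02, h03, h04, h12, h13, h14, h23, h24, h34]
  · rw [hf, hf, hf, upperFive_lie]
    obtain ⟨hg, h01, h02, h03, h04, h12, h13, h14, h23, h24, h34⟩ := hlie x y
    rw [hg, h01, h02, h03, h04, h12, h13, h14, h23, h24, h34]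
  · rw [hf] at h
    exact ⟨congrFun (congrFun h 0) 0, congrFun (congrFun h 0) 1, congrFun (congrFun h 0) 2,
      congrFun (congrFun h 0) 3, congrFun (congrFun h 0) 4, congrFun (congrFun h 1) 2,
      congrFun (congrFun h 1) 3, congrFun (congrFun h 1) 4, congrFun (congrFun h 2) 3,
      congrFun (congrFun h 2) 4, congrFun (congrFun h 3) 4⟩

theorem isFaithfulNilrep_upperFive [Field k] {c : Name k}
    {f : (Fin 6 → k) → Matrix (Fin 5) (Fin 5) k}
    {a01 a02 a03 a04 a12 a13 a14 a23 a24 a34 : (Fin 6 → k) → k}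
    (hf : ∀ x, f x = upperFive 0 (a01 x) (a02 x) (a03 x) (a04 x) (a12 x) (a13 x) (a14 x) (a23 x)
      (a24 x) (a34 x))
    (hadd : ∀ x y, a01 (x + y) = a01 x + a01 y ∧ a02 (x + y) = a02 x + a02 y ∧ a03 (x + y) = a03
      x + a03 y ∧ a04 (x + y) = a04 x + a04 y ∧ a12 (x + y) = a12 x + a12 y ∧ a13 (x + y) = a13
      x + a13 y ∧ a14 (x + y) = a14 x + a14 y ∧ a23 (x + y) = a23 x + a23 y ∧ a24 (x + y) = a24
      x + a24 y ∧ a34 (x + y) = a34 x + a34 y)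
    (hsmul : ∀ (t : k) x, a01 (t • x) = t * a01 x ∧ a02 (t • x) = t * a02 x ∧ a03 (t • x) = t *
      a03 x ∧ a04 (t • x) = t * a04 x ∧ a12 (t • x) = t * a12 x ∧ a13 (t • x) = t * a13 x ∧ a14
      (t • x) = t * a14 x ∧ a23 (t • x) = t * a23 x ∧ a24 (t • x) = t * a24 x ∧ a34 (t • x) = t
      * a34 x)
    (hlie : ∀ x y, a01 (bracket c x y) = 0 ∧ a02 (bracket c x y) = (a01 x * a12 y - a01 y * a12
      x) ∧ a03 (bracket c x y) = ((a01 x * a13 y - a01 y * a13 x) + (a02 x * a23 y - a02 y * a23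
      x)) ∧ a04 (bracket c x y) = ((a01 x * a14 y - a01 y * a14 x) + ((a02 x * a24 y - a02 y *
      a24 x) + (a03 x * a34 y - a03 y * a34 x))) ∧ a12 (bracket c x y) = 0 ∧ a13 (bracket c x y)
      = (a12 x * a23 y - a12 y * a23 x) ∧ a14 (bracket c x y) = ((a12 x * a24 y - a12 y * a24 x)
      + (a13 x * a34 y - a13 y * a34 x)) ∧ a23 (bracket c x y) = 0 ∧ a24 (bracket c x y) = (a23
      x * a34 y - a23 y * a34 x) ∧ a34 (bracket c x y) = 0)
    (h0 : ∀ x, a01 x = 0 ∧ a02 x = 0 ∧ a03 x = 0 ∧ a04 x = 0 ∧ a12 x = 0 ∧ a13 x = 0 ∧ a14 x = 0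
      ∧ a23 x = 0 ∧ a24 x = 0 ∧ a34 x = 0 → x = 0) :
    IsFaithfulNilrep c f :=
  ⟨isFaithfulRep_upperFive (g := fun _ => 0) hf
      (fun x y => ⟨(add_zero 0).symm, hadd x y⟩) (fun t x => ⟨(mul_zero t).symm, hsmul t x⟩)
      (fun x y => ⟨rfl, hlie x y⟩) fun x h => h0 x h.2,
    fun x => isNilpotent_of_strict (hf x ▸ upperFive_strict)⟩

/-- Entrywise criterion for a representation by upper triangular `6 × 6` matrices with constant
diagonal. -/
theorem isFaithfulRep_upperSix [Field k] {c : Name k}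
    {f : (Fin 6 → k) → Matrix (Fin 6) (Fin 6) k}
    {g a01 a02 a03 a04 a05 a12 a13 a14 a15 a23 a24 a25 a34 a35 a45 : (Fin 6 → k) → k}
    (hf : ∀ x, f x = upperSix (g x) (a01 x) (a02 x) (a03 x) (a04 x) (a05 x) (a12 x) (a13 x) (a14
      x) (a15 x) (a23 x) (a24 x) (a25 x) (a34 x) (a35 x) (a45 x))
    (hadd : ∀ x y, g (x + y) = g x + g y ∧ a01 (x + y) = a01 x + a01 y ∧ a02 (x + y) = a02 x +
      a02 y ∧ a03 (x + y) = a03 x + a03 y ∧ a04 (x + y) = a04 x + a04 y ∧ a05 (x + y) = a05 x +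
      a05 y ∧ a12 (x + y) = a12 x + a12 y ∧ a13 (x + y) = a13 x + a13 y ∧ a14 (x + y) = a14 x +
      a14 y ∧ a15 (x + y) = a15 x + a15 y ∧ a23 (x + y) = a23 x + a23 y ∧ a24 (x + y) = a24 x +
      a24 y ∧ a25 (x + y) = a25 x + a25 y ∧ a34 (x + y) = a34 x + a34 y ∧ a35 (x + y) = a35 x +
      a35 y ∧ a45 (x + y) = a45 x + a45 y)
    (hsmul : ∀ (t : k) x, g (t • x) = t * g x ∧ a01 (t • x) = t * a01 x ∧ a02 (t • x) = t * a02
      x ∧ a03 (t • x) = t * a03 x ∧ a04 (t • x) = t * a04 x ∧ a05 (t • x) = t * a05 x ∧ a12 (t •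
      x) = t * a12 x ∧ a13 (t • x) = t * a13 x ∧ a14 (t • x) = t * a14 x ∧ a15 (t • x) = t * a15
      x ∧ a23 (t • x) = t * a23 x ∧ a24 (t • x) = t * a24 x ∧ a25 (t • x) = t * a25 x ∧ a34 (t •
      x) = t * a34 x ∧ a35 (t • x) = t * a35 x ∧ a45 (t • x) = t * a45 x)
    (hlie : ∀ x y, g (bracket c x y) = 0 ∧ a01 (bracket c x y) = 0 ∧ a02 (bracket c x y) = (a01
      x * a12 y - a01 y * a12 x) ∧ a03 (bracket c x y) = ((a01 x * a13 y - a01 y * a13 x) + (a02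
      x * a23 y - a02 y * a23 x)) ∧ a04 (bracket c x y) = ((a01 x * a14 y - a01 y * a14 x) +
      ((a02 x * a24 y - a02 y * a24 x) + (a03 x * a34 y - a03 y * a34 x))) ∧ a05 (bracket c x y)
      = ((a01 x * a15 y - a01 y * a15 x) + ((a02 x * a25 y - a02 y * a25 x) + ((a03 x * a35 y -
      a03 y * a35 x) + (a04 x * a45 y - a04 y * a45 x)))) ∧ a12 (bracket c x y) = 0 ∧ a13
      (bracket c x y) = (a12 x * a23 y - a12 y * a23 x) ∧ a14 (bracket c x y) = ((a12 x * a24 y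
      - a12 y * a24 x) + (a13 x * a34 y - a13 y * a34 x)) ∧ a15 (bracket c x y) = ((a12 x * a25
      y - a12 y * a25 x) + ((a13 x * a35 y - a13 y * a35 x) + (a14 x * a45 y - a14 y * a45 x)))
      ∧ a23 (bracket c x y) = 0 ∧ a24 (bracket c x y) = (a23 x * a34 y - a23 y * a34 x) ∧ a25
      (bracket c x y) = ((a23 x * a35 y - a23 y * a35 x) + (a24 x * a45 y - a24 y * a45 x)) ∧
      a34 (bracket c x y) = 0 ∧ a35 (bracket c x y) = (a34 x * a45 y - a34 y * a45 x) ∧ a45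
      (bracket c x y) = 0)
    (h0 : ∀ x, g x = 0 ∧ a01 x = 0 ∧ a02 x = 0 ∧ a03 x = 0 ∧ a04 x = 0 ∧ a05 x = 0 ∧ a12 x = 0 ∧
      a13 x = 0 ∧ a14 x = 0 ∧ a15 x = 0 ∧ a23 x = 0 ∧ a24 x = 0 ∧ a25 x = 0 ∧ a34 x = 0 ∧ a35 x
      = 0 ∧ a45 x = 0 → x = 0) :
    IsFaithfulRep c f := by
  refine isFaithfulRep_of (fun x y => ?_) (fun t x => ?_) (fun x y => ?_) fun x h => h0 x ?_
  · rw [hf, hf, hf, upperSix_add]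
    obtain ⟨hg, h01, h02, h03, h04, h05, h12, h13, h14, h15, h23, h24, h25, h34, h35, h45⟩ :=
      hadd x y
    rw [hg, h01, h02, h03, h04, h05, h12, h13, h14, h15, h23, h24, h25, h34, h35, h45]
  · rw [hf, hf, upperSix_smul]
    obtain ⟨hg, h01, h02, h03, h04, h05, h12, h13, h14, h15, h23, h24, h25, h34, h35, h45⟩ :=
      hsmul t x
    rw [hg, h01, h02, h03, h04, h05, h12, h13, h14, h15, h23, h24, h25, h34, h35, h45]
  · rw [hf, hf, hf, upperSix_lie]
    obtain ⟨hg, h01, h02, h03, h04, h05, h12, h13, h14, h15, h23, h24, h25, h34, h35, h45⟩ :=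
      hlie x y
    rw [hg, h01, h02, h03, h04, h05, h12, h13, h14, h15, h23, h24, h25, h34, h35, h45]
  · rw [hf] at h
    exact ⟨congrFun (congrFun h 0) 0, congrFun (congrFun h 0) 1, congrFun (congrFun h 0) 2,
      congrFun (congrFun h 0) 3, congrFun (congrFun h 0) 4, congrFun (congrFun h 0) 5,
      congrFun (congrFun h 1) 2, congrFun (congrFun h 1) 3, congrFun (congrFun h 1) 4,
      congrFun (congrFun h 1) 5, congrFun (congrFun h 2) 3, congrFun (congrFun h 2) 4,
      congrFun (congrFun h 2) 5, congrFun (congrFun h 3) 4, congrFun (congrFun h 3) 5,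
      congrFun (congrFun h 4) 5⟩

theorem isFaithfulNilrep_upperSix [Field k] {c : Name k}
    {f : (Fin 6 → k) → Matrix (Fin 6) (Fin 6) k}
    {a01 a02 a03 a04 a05 a12 a13 a14 a15 a23 a24 a25 a34 a35 a45 : (Fin 6 → k) → k}
    (hf : ∀ x, f x = upperSix 0 (a01 x) (a02 x) (a03 x) (a04 x) (a05 x) (a12 x) (a13 x) (a14 x)
      (a15 x) (a23 x) (a24 x) (a25 x) (a34 x) (a35 x) (a45 x))
    (hadd : ∀ x y, a01 (x + y) = a01 x + a01 y ∧ a02 (x + y) = a02 x + a02 y ∧ a03 (x + y) = a03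
      x + a03 y ∧ a04 (x + y) = a04 x + a04 y ∧ a05 (x + y) = a05 x + a05 y ∧ a12 (x + y) = a12
      x + a12 y ∧ a13 (x + y) = a13 x + a13 y ∧ a14 (x + y) = a14 x + a14 y ∧ a15 (x + y) = a15
      x + a15 y ∧ a23 (x + y) = a23 x + a23 y ∧ a24 (x + y) = a24 x + a24 y ∧ a25 (x + y) = a25
      x + a25 y ∧ a34 (x + y) = a34 x + a34 y ∧ a35 (x + y) = a35 x + a35 y ∧ a45 (x + y) = a45
      x + a45 y)
    (hsmul : ∀ (t : k) x, a01 (t • x) = t * a01 x ∧ a02 (t • x) = t * a02 x ∧ a03 (t • x) = t *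
      a03 x ∧ a04 (t • x) = t * a04 x ∧ a05 (t • x) = t * a05 x ∧ a12 (t • x) = t * a12 x ∧ a13
      (t • x) = t * a13 x ∧ a14 (t • x) = t * a14 x ∧ a15 (t • x) = t * a15 x ∧ a23 (t • x) = t
      * a23 x ∧ a24 (t • x) = t * a24 x ∧ a25 (t • x) = t * a25 x ∧ a34 (t • x) = t * a34 x ∧
      a35 (t • x) = t * a35 x ∧ a45 (t • x) = t * a45 x)
    (hlie : ∀ x y, a01 (bracket c x y) = 0 ∧ a02 (bracket c x y) = (a01 x * a12 y - a01 y * a12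
      x) ∧ a03 (bracket c x y) = ((a01 x * a13 y - a01 y * a13 x) + (a02 x * a23 y - a02 y * a23
      x)) ∧ a04 (bracket c x y) = ((a01 x * a14 y - a01 y * a14 x) + ((a02 x * a24 y - a02 y *
      a24 x) + (a03 x * a34 y - a03 y * a34 x))) ∧ a05 (bracket c x y) = ((a01 x * a15 y - a01 y
      * a15 x) + ((a02 x * a25 y - a02 y * a25 x) + ((a03 x * a35 y - a03 y * a35 x) + (a04 x *
      a45 y - a04 y * a45 x)))) ∧ a12 (bracket c x y) = 0 ∧ a13 (bracket c x y) = (a12 x * a23 y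
      - a12 y * a23 x) ∧ a14 (bracket c x y) = ((a12 x * a24 y - a12 y * a24 x) + (a13 x * a34 y
      - a13 y * a34 x)) ∧ a15 (bracket c x y) = ((a12 x * a25 y - a12 y * a25 x) + ((a13 x * a35
      y - a13 y * a35 x) + (a14 x * a45 y - a14 y * a45 x))) ∧ a23 (bracket c x y) = 0 ∧ a24
      (bracket c x y) = (a23 x * a34 y - a23 y * a34 x) ∧ a25 (bracket c x y) = ((a23 x * a35 y
      - a23 y * a35 x) + (a24 x * a45 y - a24 y * a45 x)) ∧ a34 (bracket c x y) = 0 ∧ a35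
      (bracket c x y) = (a34 x * a45 y - a34 y * a45 x) ∧ a45 (bracket c x y) = 0)
    (h0 : ∀ x, a01 x = 0 ∧ a02 x = 0 ∧ a03 x = 0 ∧ a04 x = 0 ∧ a05 x = 0 ∧ a12 x = 0 ∧ a13 x = 0
      ∧ a14 x = 0 ∧ a15 x = 0 ∧ a23 x = 0 ∧ a24 x = 0 ∧ a25 x = 0 ∧ a34 x = 0 ∧ a35 x = 0 ∧ a45
      x = 0 → x = 0) :
    IsFaithfulNilrep c f :=
  ⟨isFaithfulRep_upperSix (g := fun _ => 0) hf
      (fun x y => ⟨(add_zero 0).symm, hadd x y⟩) (fun t x => ⟨(mul_zero t).symm, hsmul t x⟩)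
      (fun x y => ⟨rfl, hlie x y⟩) fun x h => h0 x h.2,
    fun x => isNilpotent_of_strict (hf x ▸ upperSix_strict)⟩

end NilSix

namespace NilSix
variable {k : Type u}
attribute [local instance] LieRing.ofAssociativeRing
open Name

/-! ### The explicit representations -/

theorem isFaithfulRep_rep3 [Field k] [CharZero k] :
    IsFaithfulRep (L3 : Name k) rep3 := by
  refine isFaithfulRep_upperFour (fun _ => rfl) (fun x y => ?_) (fun t x => ?_)
    (fun x y => ?_) fun x h => ?_
  · and_intros <;> (try simp only [Pi.add_apply]) <;> ring
  · and_intros <;> (try simp only [Pi.smul_apply, smul_eq_mul]) <;> ring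
  · and_intros <;> (try simp only [bracket, w, Matrix.cons_val]) <;> ring
  · ext i
    fin_cases i <;> simp only [Pi.zero_apply, Fin.zero_eta, Fin.mk_one, Fin.reduceFinMk] <;> grind

theorem isFaithfulRep_rep4 [Field k] :
    IsFaithfulRep (L4 : Name k) rep4 := by
  refine isFaithfulRep_upperFour (fun _ => rfl) (fun x y => ?_) (fun t x => ?_)
    (fun x y => ?_) fun x h => ?_
  · and_intros <;> (try simp only [Pi.add_apply]) <;> ring
  · and_intros <;> (try simp only [Pi.smul_apply, smul_eq_mul]) <;> ring
  · and_intros <;> (try simp only [bracket, w, Matrix.cons_val]) <;> ring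
  · ext i
    fin_cases i <;> simp only [Pi.zero_apply, Fin.zero_eta, Fin.mk_one, Fin.reduceFinMk] <;> grind

theorem isFaithfulRep_rep5 [Field k] :
    IsFaithfulRep (L5 : Name k) rep5 := by
  refine isFaithfulRep_upperFour (fun _ => rfl) (fun x y => ?_) (fun t x => ?_)
    (fun x y => ?_) fun x h => ?_
  · and_intros <;> (try simp only [Pi.add_apply]) <;> ring
  · and_intros <;> (try simp only [Pi.smul_apply, smul_eq_mul]) <;> ring
  · and_intros <;> (try simp only [bracket, w, Matrix.cons_val]) <;> ring
  · ext i
    fin_cases i <;> simp only [Pi.zero_apply, Fin.zero_eta, Fin.mk_one, Fin.reduceFinMk] <;> grind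

theorem isFaithfulRep_rep8 [Field k] :
    IsFaithfulRep (L8 : Name k) rep8 := by
  refine isFaithfulRep_upperFour (fun _ => rfl) (fun x y => ?_) (fun t x => ?_)
    (fun x y => ?_) fun x h => ?_
  · and_intros <;> (try simp only [Pi.add_apply]) <;> ring
  · and_intros <;> (try simp only [Pi.smul_apply, smul_eq_mul]) <;> ring
  · and_intros <;> (try simp only [bracket, w, Matrix.cons_val]) <;> ring
  · ext i
    fin_cases i <;> simp only [Pi.zero_apply, Fin.zero_eta, Fin.mk_one, Fin.reduceFinMk] <;> grind

theorem isFaithfulRep_rep9 [Field k] [CharZero k] :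
    IsFaithfulRep (L9 : Name k) rep9 := by
  refine isFaithfulRep_upperFive (fun _ => rfl) (fun x y => ?_) (fun t x => ?_)
    (fun x y => ?_) fun x h => ?_
  · and_intros <;> (try simp only [Pi.add_apply]) <;> ring
  · and_intros <;> (try simp only [Pi.smul_apply, smul_eq_mul]) <;> ring
  · and_intros <;> (try simp only [bracket, w, Matrix.cons_val]) <;> ring
  · ext i
    fin_cases i <;> simp only [Pi.zero_apply, Fin.zero_eta, Fin.mk_one, Fin.reduceFinMk] <;> grind

theorem isFaithfulNilrep_nil1 [Field k] :
    IsFaithfulNilrep (L1 : Name k) nil1 := by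
  refine isFaithfulNilrep_upperFive (fun _ => rfl) (fun x y => ?_) (fun t x => ?_)
    (fun x y => ?_) fun x h => ?_
  · and_intros <;> (try simp only [Pi.add_apply]) <;> ring
  · and_intros <;> (try simp only [Pi.smul_apply, smul_eq_mul]) <;> ring
  · and_intros <;> (try simp only [bracket, Matrix.cons_val]) <;> ring
  · ext i
    fin_cases i <;> simp only [Pi.zero_apply, Fin.zero_eta, Fin.mk_one, Fin.reduceFinMk] <;> grind

theorem isFaithfulNilrep_nil2 [Field k] :
    IsFaithfulNilrep (L2 : Name k) nil2 := by
  refine isFaithfulNilrep_upperFive (fun _ => rfl) (fun x y => ?_) (fun t x => ?_)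
    (fun x y => ?_) fun x h => ?_
  · and_intros <;> (try simp only [Pi.add_apply]) <;> ring
  · and_intros <;> (try simp only [Pi.smul_apply, smul_eq_mul]) <;> ring
  · and_intros <;> (try simp only [bracket, w, Matrix.cons_val]) <;> ring
  · ext i
    fin_cases i <;> simp only [Pi.zero_apply, Fin.zero_eta, Fin.mk_one, Fin.reduceFinMk] <;> grind

theorem isFaithfulNilrep_nil3 [Field k] [CharZero k] :
    IsFaithfulNilrep (L3 : Name k) nil3 := by
  refine isFaithfulNilrep_upperFive (fun _ => rfl) (fun x y => ?_) (fun t x => ?_)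
    (fun x y => ?_) fun x h => ?_
  · and_intros <;> (try simp only [Pi.add_apply]) <;> ring
  · and_intros <;> (try simp only [Pi.smul_apply, smul_eq_mul]) <;> ring
  · and_intros <;> (try simp only [bracket, w, Matrix.cons_val]) <;> ring
  · ext i
    fin_cases i <;> simp only [Pi.zero_apply, Fin.zero_eta, Fin.mk_one, Fin.reduceFinMk] <;> grind

theorem isFaithfulNilrep_nil4 [Field k] :
    IsFaithfulNilrep (L4 : Name k) nil4 := by
  refine isFaithfulNilrep_upperFive (fun _ => rfl) (fun x y => ?_) (fun t x => ?_)
    (fun x y => ?_) fun x h => ?_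
  · and_intros <;> (try simp only [Pi.add_apply]) <;> ring
  · and_intros <;> (try simp only [Pi.smul_apply, smul_eq_mul]) <;> ring
  · and_intros <;> (try simp only [bracket, w, Matrix.cons_val]) <;> ring
  · ext i
    fin_cases i <;> simp only [Pi.zero_apply, Fin.zero_eta, Fin.mk_one, Fin.reduceFinMk] <;> grind

theorem isFaithfulNilrep_nil5 [Field k] :
    IsFaithfulNilrep (L5 : Name k) nil5 := by
  refine isFaithfulNilrep_upperFive (fun _ => rfl) (fun x y => ?_) (fun t x => ?_)
    (fun x y => ?_) fun x h => ?_
  · and_intros <;> (try simp only [Pi.add_apply]) <;> ring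
  · and_intros <;> (try simp only [Pi.smul_apply, smul_eq_mul]) <;> ring
  · and_intros <;> (try simp only [bracket, w, Matrix.cons_val]) <;> ring
  · ext i
    fin_cases i <;> simp only [Pi.zero_apply, Fin.zero_eta, Fin.mk_one, Fin.reduceFinMk] <;> grind

theorem isFaithfulNilrep_nil6 [Field k] [CharZero k] :
    IsFaithfulNilrep (L6 : Name k) nil6 := by
  refine isFaithfulNilrep_upperFive (fun _ => rfl) (fun x y => ?_) (fun t x => ?_)
    (fun x y => ?_) fun x h => ?_
  · and_intros <;> (try simp only [Pi.add_apply]) <;> ring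
  · and_intros <;> (try simp only [Pi.smul_apply, smul_eq_mul]) <;> ring
  · and_intros <;> (try simp only [bracket, w, Matrix.cons_val]) <;> ring
  · ext i
    fin_cases i <;> simp only [Pi.zero_apply, Fin.zero_eta, Fin.mk_one, Fin.reduceFinMk] <;> grind

theorem isFaithfulNilrep_nil7 [Field k] [CharZero k] :
    IsFaithfulNilrep (L7 : Name k) nil7 := by
  refine isFaithfulNilrep_upperFive (fun _ => rfl) (fun x y => ?_) (fun t x => ?_)
    (fun x y => ?_) fun x h => ?_
  · and_intros <;> (try simp only [Pi.add_apply]) <;> ring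
  · and_intros <;> (try simp only [Pi.smul_apply, smul_eq_mul]) <;> ring
  · and_intros <;> (try simp only [bracket, w, Matrix.cons_val]) <;> ring
  · ext i
    fin_cases i <;> simp only [Pi.zero_apply, Fin.zero_eta, Fin.mk_one, Fin.reduceFinMk] <;> grind

theorem isFaithfulNilrep_nil8 [Field k] :
    IsFaithfulNilrep (L8 : Name k) nil8 := by
  refine isFaithfulNilrep_upperFive (fun _ => rfl) (fun x y => ?_) (fun t x => ?_)
    (fun x y => ?_) fun x h => ?_
  · and_intros <;> (try simp only [Pi.add_apply]) <;> ring
  · and_intros <;> (try simp only [Pi.smul_apply, smul_eq_mul]) <;> ring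
  · and_intros <;> (try simp only [bracket, w, Matrix.cons_val]) <;> ring
  · ext i
    fin_cases i <;> simp only [Pi.zero_apply, Fin.zero_eta, Fin.mk_one, Fin.reduceFinMk] <;> grind

theorem isFaithfulNilrep_nil9 [Field k] [CharZero k] :
    IsFaithfulNilrep (L9 : Name k) nil9 := by
  refine isFaithfulNilrep_upperSix (fun _ => rfl) (fun x y => ?_) (fun t x => ?_)
    (fun x y => ?_) fun x h => ?_
  · and_intros <;> (try simp only [Pi.add_apply]) <;> ring
  · and_intros <;> (try simp only [Pi.smul_apply, smul_eq_mul]) <;> ring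
  · and_intros <;> (try simp only [bracket, w, Matrix.cons_val]) <;> ring
  · ext i
    fin_cases i <;> simp only [Pi.zero_apply, Fin.zero_eta, Fin.mk_one, Fin.reduceFinMk] <;> grind

theorem isFaithfulNilrep_nil10 [Field k] :
    IsFaithfulNilrep (L10 : Name k) nil10 := by
  refine isFaithfulNilrep_upperFive (fun _ => rfl) (fun x y => ?_) (fun t x => ?_)
    (fun x y => ?_) fun x h => ?_
  · and_intros <;> (try simp only [Pi.add_apply]) <;> ring
  · and_intros <;> (try simp only [Pi.smul_apply, smul_eq_mul]) <;> ring
  · and_intros <;> (try simp only [bracket, w, Matrix.cons_val]) <;> ring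
  · ext i
    fin_cases i <;> simp only [Pi.zero_apply, Fin.zero_eta, Fin.mk_one, Fin.reduceFinMk] <;> grind

theorem isFaithfulNilrep_nil11 [Field k] :
    IsFaithfulNilrep (L11 : Name k) nil11 := by
  refine isFaithfulNilrep_upperFive (fun _ => rfl) (fun x y => ?_) (fun t x => ?_)
    (fun x y => ?_) fun x h => ?_
  · and_intros <;> (try simp only [Pi.add_apply]) <;> ring
  · and_intros <;> (try simp only [Pi.smul_apply, smul_eq_mul]) <;> ring
  · and_intros <;> (try simp only [bracket, w, Matrix.cons_val]) <;> ring
  · ext i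
    fin_cases i <;> simp only [Pi.zero_apply, Fin.zero_eta, Fin.mk_one, Fin.reduceFinMk] <;> grind

theorem isFaithfulNilrep_nil12 [Field k] :
    IsFaithfulNilrep (L12 : Name k) nil12 := by
  refine isFaithfulNilrep_upperFive (fun _ => rfl) (fun x y => ?_) (fun t x => ?_)
    (fun x y => ?_) fun x h => ?_
  · and_intros <;> (try simp only [Pi.add_apply]) <;> ring
  · and_intros <;> (try simp only [Pi.smul_apply, smul_eq_mul]) <;> ring
  · and_intros <;> (try simp only [bracket, w, Matrix.cons_val]) <;> ring
  · ext i
    fin_cases i <;> simp only [Pi.zero_apply, Fin.zero_eta, Fin.mk_one, Fin.reduceFinMk] <;> grind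

theorem isFaithfulNilrep_nil13 [Field k] :
    IsFaithfulNilrep (L13 : Name k) nil13 := by
  refine isFaithfulNilrep_upperFive (fun _ => rfl) (fun x y => ?_) (fun t x => ?_)
    (fun x y => ?_) fun x h => ?_
  · and_intros <;> (try simp only [Pi.add_apply]) <;> ring
  · and_intros <;> (try simp only [Pi.smul_apply, smul_eq_mul]) <;> ring
  · and_intros <;> (try simp only [bracket, w, Matrix.cons_val]) <;> ring
  · ext i
    fin_cases i <;> simp only [Pi.zero_apply, Fin.zero_eta, Fin.mk_one, Fin.reduceFinMk] <;> grind

theorem isFaithfulNilrep_nil14 [Field k] [CharZero k] :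
    IsFaithfulNilrep (L14 : Name k) nil14 := by
  refine isFaithfulNilrep_upperSix (fun _ => rfl) (fun x y => ?_) (fun t x => ?_)
    (fun x y => ?_) fun x h => ?_
  · and_intros <;> (try simp only [Pi.add_apply]) <;> ring
  · and_intros <;> (try simp only [Pi.smul_apply, smul_eq_mul]) <;> ring
  · and_intros <;> (try simp only [bracket, w, Matrix.cons_val]) <;> ring
  · ext i
    fin_cases i <;> simp only [Pi.zero_apply, Fin.zero_eta, Fin.mk_one, Fin.reduceFinMk] <;> grind

theorem isFaithfulNilrep_nil15 [Field k] [CharZero k] :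
    IsFaithfulNilrep (L15 : Name k) nil15 := by
  refine isFaithfulNilrep_upperSix (fun _ => rfl) (fun x y => ?_) (fun t x => ?_)
    (fun x y => ?_) fun x h => ?_
  · and_intros <;> (try simp only [Pi.add_apply]) <;> ring
  · and_intros <;> (try simp only [Pi.smul_apply, smul_eq_mul]) <;> ring
  · and_intros <;> (try simp only [bracket, w, Matrix.cons_val]) <;> ring
  · ext i
    fin_cases i <;> simp only [Pi.zero_apply, Fin.zero_eta, Fin.mk_one, Fin.reduceFinMk] <;> grind

theorem isFaithfulNilrep_nil16 [Field k] [CharZero k] :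
    IsFaithfulNilrep (L16 : Name k) nil16 := by
  refine isFaithfulNilrep_upperSix (fun _ => rfl) (fun x y => ?_) (fun t x => ?_)
    (fun x y => ?_) fun x h => ?_
  · and_intros <;> (try simp only [Pi.add_apply]) <;> ring
  · and_intros <;> (try simp only [Pi.smul_apply, smul_eq_mul]) <;> ring
  · and_intros <;> (try simp only [bracket, w, Matrix.cons_val]) <;> ring
  · ext i
    fin_cases i <;> simp only [Pi.zero_apply, Fin.zero_eta, Fin.mk_one, Fin.reduceFinMk] <;> grind

theorem isFaithfulNilrep_nil17 [Field k] [CharZero k] :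
    IsFaithfulNilrep (L17 : Name k) nil17 := by
  refine isFaithfulNilrep_upperSix (fun _ => rfl) (fun x y => ?_) (fun t x => ?_)
    (fun x y => ?_) fun x h => ?_
  · and_intros <;> (try simp only [Pi.add_apply]) <;> ring
  · and_intros <;> (try simp only [Pi.smul_apply, smul_eq_mul]) <;> ring
  · and_intros <;> (try simp only [bracket, w, Matrix.cons_val]) <;> ring
  · ext i
    fin_cases i <;> simp only [Pi.zero_apply, Fin.zero_eta, Fin.mk_one, Fin.reduceFinMk] <;> grind

theorem isFaithfulNilrep_nil18 [Field k] :
    IsFaithfulNilrep (L18 : Name k) nil18 := by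
  refine isFaithfulNilrep_upperSix (fun _ => rfl) (fun x y => ?_) (fun t x => ?_)
    (fun x y => ?_) fun x h => ?_
  · and_intros <;> (try simp only [Pi.add_apply]) <;> ring
  · and_intros <;> (try simp only [Pi.smul_apply, smul_eq_mul]) <;> ring
  · and_intros <;> (try simp only [bracket, w, Matrix.cons_val]) <;> ring
  · ext i
    fin_cases i <;> simp only [Pi.zero_apply, Fin.zero_eta, Fin.mk_one, Fin.reduceFinMk] <;> grind

theorem isFaithfulNilrep_nil20 [Field k] :
    IsFaithfulNilrep (L20 : Name k) nil20 := by
  refine isFaithfulNilrep_upperFive (fun _ => rfl) (fun x y => ?_) (fun t x => ?_)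
    (fun x y => ?_) fun x h => ?_
  · and_intros <;> (try simp only [Pi.add_apply]) <;> ring
  · and_intros <;> (try simp only [Pi.smul_apply, smul_eq_mul]) <;> ring
  · and_intros <;> (try simp only [bracket, w, Matrix.cons_val]) <;> ring
  · ext i
    fin_cases i <;> simp only [Pi.zero_apply, Fin.zero_eta, Fin.mk_one, Fin.reduceFinMk] <;> grind

theorem isFaithfulNilrep_nil23 [Field k] :
    IsFaithfulNilrep (L23 : Name k) nil23 := by
  refine isFaithfulNilrep_upperFive (fun _ => rfl) (fun x y => ?_) (fun t x => ?_)
    (fun x y => ?_) fun x h => ?_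
  · and_intros <;> (try simp only [Pi.add_apply]) <;> ring
  · and_intros <;> (try simp only [Pi.smul_apply, smul_eq_mul]) <;> ring
  · and_intros <;> (try simp only [bracket, w, Matrix.cons_val]) <;> ring
  · ext i
    fin_cases i <;> simp only [Pi.zero_apply, Fin.zero_eta, Fin.mk_one, Fin.reduceFinMk] <;> grind

theorem isFaithfulNilrep_nil25 [Field k] [CharZero k] :
    IsFaithfulNilrep (L25 : Name k) nil25 := by
  refine isFaithfulNilrep_upperFive (fun _ => rfl) (fun x y => ?_) (fun t x => ?_)
    (fun x y => ?_) fun x h => ?_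
  · and_intros <;> (try simp only [Pi.add_apply]) <;> ring
  · and_intros <;> (try simp only [Pi.smul_apply, smul_eq_mul]) <;> ring
  · and_intros <;> (try simp only [bracket, w, Matrix.cons_val]) <;> ring
  · ext i
    fin_cases i <;> simp only [Pi.zero_apply, Fin.zero_eta, Fin.mk_one, Fin.reduceFinMk] <;> grind

theorem isFaithfulNilrep_nil26 [Field k] :
    IsFaithfulNilrep (L26 : Name k) nil26 := by
  refine isFaithfulNilrep_upperFive (fun _ => rfl) (fun x y => ?_) (fun t x => ?_)
    (fun x y => ?_) fun x h => ?_
  · and_intros <;> (try simp only [Pi.add_apply]) <;> ring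
  · and_intros <;> (try simp only [Pi.smul_apply, smul_eq_mul]) <;> ring
  · and_intros <;> (try simp only [bracket, w, Matrix.cons_val]) <;> ring
  · ext i
    fin_cases i <;> simp only [Pi.zero_apply, Fin.zero_eta, Fin.mk_one, Fin.reduceFinMk] <;> grind

theorem isFaithfulNilrep_nil19sq [Field k] [CharZero k] (ε α : k) (h0 : α ≠ 0)
    (h : α ^ 2 + ε = 0) :
    IsFaithfulNilrep (L19 ε) (nil19sq α) := by
  obtain rfl : ε = -α ^ 2 := by linear_combination h
  refine isFaithfulNilrep_upperFour (fun _ => rfl) (fun x y => ?_) (fun t x => ?_)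
    (fun x y => ?_) fun x h => ?_
  · and_intros <;> (try simp only [Pi.add_apply]) <;> ring
  · and_intros <;> (try simp only [Pi.smul_apply, smul_eq_mul]) <;> ring
  · and_intros <;> (try simp only [bracket, w, Matrix.cons_val]) <;> (try field_simp) <;> ring
  · ext i
    fin_cases i <;> simp only [Pi.zero_apply, Fin.zero_eta, Fin.mk_one, Fin.reduceFinMk] <;> grind

theorem isFaithfulNilrep_nil19 [Field k] (ε : k) :
    IsFaithfulNilrep (L19 ε) (nil19 ε) := by
  refine isFaithfulNilrep_upperFive (fun _ => rfl) (fun x y => ?_) (fun t x => ?_)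
    (fun x y => ?_) fun x h => ?_
  · and_intros <;> (try simp only [Pi.add_apply]) <;> ring
  · and_intros <;> (try simp only [Pi.smul_apply, smul_eq_mul]) <;> ring
  · and_intros <;> (try simp only [bracket, w, Matrix.cons_val]) <;> ring
  · ext i
    fin_cases i <;> simp only [Pi.zero_apply, Fin.zero_eta, Fin.mk_one, Fin.reduceFinMk] <;> grind

theorem isFaithfulNilrep_nil21 [Field k] [CharZero k] (ε : k) (h0 : ε ≠ 0) :
    IsFaithfulNilrep (L21 ε) (nil21 ε) := by
  refine isFaithfulNilrep_upperFive (fun _ => rfl) (fun x y => ?_) (fun t x => ?_)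
    (fun x y => ?_) fun x h => ?_
  · and_intros <;> (try simp only [Pi.add_apply]) <;> ring
  · and_intros <;> (try simp only [Pi.smul_apply, smul_eq_mul]) <;> ring
  · and_intros <;> (try simp only [bracket, w, Matrix.cons_val]) <;> ring
  · ext i
    fin_cases i <;> simp only [Pi.zero_apply, Fin.zero_eta, Fin.mk_one, Fin.reduceFinMk] <;> grind

theorem isFaithfulNilrep_nil21zero [Field k] [CharZero k] :
    IsFaithfulNilrep (L21 (0 : k)) nil21zero := by
  refine isFaithfulNilrep_upperFive (fun _ => rfl) (fun x y => ?_) (fun t x => ?_)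
    (fun x y => ?_) fun x h => ?_
  · and_intros <;> (try simp only [Pi.add_apply]) <;> ring
  · and_intros <;> (try simp only [Pi.smul_apply, smul_eq_mul]) <;> ring
  · and_intros <;> (try simp only [bracket, w, Matrix.cons_val]) <;> ring
  · ext i
    fin_cases i <;> simp only [Pi.zero_apply, Fin.zero_eta, Fin.mk_one, Fin.reduceFinMk] <;> grind

theorem isFaithfulNilrep_nil22 [Field k] (ε : k) :
    IsFaithfulNilrep (L22 ε) (nil22 ε) := by
  refine isFaithfulNilrep_upperFive (fun _ => rfl) (fun x y => ?_) (fun t x => ?_)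
    (fun x y => ?_) fun x h => ?_
  · and_intros <;> (try simp only [Pi.add_apply]) <;> ring
  · and_intros <;> (try simp only [Pi.smul_apply, smul_eq_mul]) <;> ring
  · and_intros <;> (try simp only [bracket, w, Matrix.cons_val]) <;> ring
  · ext i
    fin_cases i <;> simp only [Pi.zero_apply, Fin.zero_eta, Fin.mk_one, Fin.reduceFinMk] <;> grind

theorem isFaithfulNilrep_nil24sq [Field k] [CharZero k] (ε α : k) (h : α ^ 2 - ε = 0)
    (h1 : α ≠ 1) :
    IsFaithfulNilrep (L24 ε) (nil24sq α) := by
  obtain rfl : ε = α ^ 2 := by linear_combination -h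
  refine isFaithfulNilrep_upperFive (fun _ => rfl) (fun x y => ?_) (fun t x => ?_)
    (fun x y => ?_) fun x h => ?_
  · and_intros <;> (try simp only [Pi.add_apply]) <;> ring
  · and_intros <;> (try simp only [Pi.smul_apply, smul_eq_mul]) <;> ring
  · and_intros <;> (try simp only [bracket, w, Matrix.cons_val]) <;> ring
  · ext i
    fin_cases i <;> simp only [Pi.zero_apply, Fin.zero_eta, Fin.mk_one, Fin.reduceFinMk] <;> grind

theorem isFaithfulNilrep_nil24 [Field k] [CharZero k] (ε : k) :
    IsFaithfulNilrep (L24 ε) (nil24 ε) := by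
  refine isFaithfulNilrep_upperSix (fun _ => rfl) (fun x y => ?_) (fun t x => ?_)
    (fun x y => ?_) fun x h => ?_
  · and_intros <;> (try simp only [Pi.add_apply]) <;> ring
  · and_intros <;> (try simp only [Pi.smul_apply, smul_eq_mul]) <;> ring
  · and_intros <;> (try simp only [bracket, w, Matrix.cons_val]) <;> ring
  · ext i
    fin_cases i <;> simp only [Pi.zero_apply, Fin.zero_eta, Fin.mk_one, Fin.reduceFinMk] <;> grind

end NilSix

namespace NilSix
variable {k : Type u}
attribute [local instance] LieRing.ofAssociativeRing

open Module

/-! ### Engel's theorem in matrix form -/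

/-- The matrix `A` is supported on the `m`-th superdiagonal and those above it. For `m = 1` this
means strictly upper triangular. -/
def IsUpper {R : Type*} [Zero R] {n : ℕ} (m : ℕ) (A : Matrix (Fin n) (Fin n) R) : Prop :=
  ∀ i j : Fin n, (j : ℕ) < i + m → A i j = 0

theorem IsUpper.mul {R : Type*} [CommRing R] {n a b : ℕ} {A B : Matrix (Fin n) (Fin n) R}
    (hA : IsUpper a A) (hB : IsUpper b B) : IsUpper (a + b) (A * B) := by
  intro i j h
  rw [Matrix.mul_apply]
  refine Finset.sum_eq_zero fun l _ => ?_
  by_cases hl : (l : ℕ) < i + a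
  · rw [hA i l hl, zero_mul]
  · rw [hB l j (by omega), mul_zero]

theorem IsUpper.lie {R : Type*} [CommRing R] {n a b : ℕ} {A B : Matrix (Fin n) (Fin n) R}
    (hA : IsUpper a A) (hB : IsUpper b B) : IsUpper (a + b) ⁅A, B⁆ := by
  intro i j h
  rw [Ring.lie_def, Matrix.sub_apply, hA.mul hB i j h, hB.mul hA i j (by omega), sub_zero]

theorem IsUpper.eq_zero {R : Type*} [Zero R] {n : ℕ} {A : Matrix (Fin n) (Fin n) R}
    (hA : IsUpper n A) : A = 0 := by
  ext i j
  exact hA i j (by omega)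

theorem IsUpper.mono {R : Type*} [Zero R] {n a b : ℕ} (h : b ≤ a) {A : Matrix (Fin n) (Fin n) R}
    (hA : IsUpper a A) : IsUpper b A := fun i j hij => hA i j (by omega)

theorem IsUpper.apply_eq_zero {R : Type*} [Zero R] {n : ℕ} {A : Matrix (Fin n) (Fin n) R}
    (hA : IsUpper 1 A) (i j : Fin n) (h : j ≤ i) : A i j = 0 :=
  hA i j (Nat.lt_succ_of_le h)

section Engel

variable {K L : Type*} [Field K] [LieRing L] [LieAlgebra K L]

/-- A nonzero nilpotent Lie module `V` has a hyperplane that contains `⁅L, V⁆`. -/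
theorem exists_hyperplane_lie_mem {V : Type*} [AddCommGroup V] [Module K V] [LieRingModule L V]
    [LieModule K L V] [LieModule.IsNilpotent L V] [Nontrivial V] :
    ∃ f : Dual K V, f ≠ 0 ∧ ∀ (x : L) (v : V), f ⁅x, v⁆ = 0 := by
  have hlt : (LieModule.lowerCentralSeries K L V 1).toSubmodule < ⊤ := by
    rw [lt_top_iff_ne_top]
    intro h
    have h1 : LieModule.lowerCentralSeries K L V 1 = ⊤ := by
      rwa [← LieSubmodule.toSubmodule_eq_top]
    have hall : ∀ m, LieModule.lowerCentralSeries K L V m = ⊤ := by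
      intro m
      induction m with
      | zero => rfl
      | succ m ih =>
        rw [LieModule.lowerCentralSeries_succ, ih]
        simpa [LieModule.lowerCentralSeries_succ] using h1
    obtain ⟨m, hm⟩ := LieModule.IsNilpotent.nilpotent K L V
    rw [hall m] at hm
    exact top_ne_bot hm
  obtain ⟨f, hf, hle⟩ := Submodule.exists_le_ker_of_lt_top _ hlt
  refine ⟨f, hf, fun x v => hle ?_⟩
  have : ⁅x, v⁆ ∈ LieModule.lowerCentralSeries K L V 1 := by
    rw [LieModule.lowerCentralSeries_succ]
    exact LieSubmodule.lie_mem_lie (LieSubmodule.mem_top x) (LieSubmodule.mem_top v)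
  exact this

/-- A nilpotent Lie module has a basis in which the Lie algebra acts by strictly upper triangular
matrices. The induction is on a hyperplane that contains all `⁅x, v⁆`. -/
theorem exists_basis_repr_lie_eq_zero (d : ℕ) :
    ∀ (V : Type*) [AddCommGroup V] [Module K V] [LieRingModule L V] [LieModule K L V]
      [LieModule.IsNilpotent L V] [Module.Finite K V], finrank K V = d →
      ∃ b : Basis (Fin d) K V, ∀ (x : L) (i j : Fin d), j ≤ i → b.repr ⁅x, b j⁆ i = 0 := by
  induction d with
  | zero =>
    intro V _ _ _ _ _ _ hd
    exact ⟨finBasisOfFinrankEq K V hd, fun x i => i.elim0⟩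
  | succ d ih =>
    intro V _ _ _ _ _ _ hd
    have : Nontrivial V := nontrivial_of_finrank_pos (R := K) (by omega)
    obtain ⟨f, hf, hfl⟩ := exists_hyperplane_lie_mem (K := K) (L := L) (V := V)
    let H : LieSubmodule K L V :=
      { LinearMap.ker f with lie_mem := fun {x v} _ => hfl x v }
    have hH : ∀ v : V, v ∈ H ↔ f v = 0 := fun v => LinearMap.mem_ker
    have hHd : finrank K H = d := by
      have := Dual.finrank_ker_add_one_of_ne_zero hf
      have h2 : finrank K H = finrank K (LinearMap.ker f) := rfl
      omega
    have : LieModule.IsNilpotent L H :=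
      Function.Injective.lieModuleIsNilpotent (R := K) (f := LieHom.id) (g := H.toSubmodule.subtype)
        (fun _ _ => rfl) Subtype.val_injective
    obtain ⟨b, hb⟩ := ih H hHd
    obtain ⟨y, hy⟩ : ∃ y, f y ≠ 0 := by
      by_contra! h
      exact hf (LinearMap.ext h)
    let b' : Basis (Fin d) K H.toSubmodule := b
    let B : Basis (Fin (d + 1)) K V := Basis.mkFinSnoc b' y
      (fun c x hx hc => by
        have h1 := congrArg f hc
        rw [map_add, map_smul, show f x = 0 from hx, map_zero, add_zero, smul_eq_mul] at h1
        exact (mul_eq_zero.1 h1).resolve_right hy)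
      (fun z => ⟨-(f z / f y), by
        change f (z + -(f z / f y) • y) = 0
        rw [map_add, map_smul, smul_eq_mul]
        field_simp
        ring⟩)
    have hB : ∀ j, B j = Fin.snoc (α := fun _ => V) ((↑) ∘ b') y j := fun j =>
      congrFun (Basis.coe_mkFinSnoc b' y _ _) j
    have hBc : ∀ j : Fin d, B j.castSucc = (b j : V) := fun j => by
      rw [hB, Fin.snoc_castSucc]; rfl
    have hsum : ∀ v : H, (v : V) = ∑ i, b.repr v i • B i.castSucc := fun v => by
      conv_lhs => rw [← b.sum_repr v]
      simp only [hBc]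
      exact map_sum H.toSubmodule.subtype _ _
    have hrl : ∀ v : H, B.repr v (Fin.last d) = 0 := fun v => by
      rw [hsum v]
      simp [Fin.castSucc_ne_last]
    have hrc : ∀ (v : H) (i : Fin d), B.repr v i.castSucc = b.repr v i := fun v i => by
      conv_lhs => rw [hsum v]
      simp [Finsupp.single_apply]
    refine ⟨B, fun x i j hij => ?_⟩
    induction i using Fin.lastCases with
    | last => exact hrl ⟨⁅x, B j⁆, (hH _).2 (hfl x _)⟩
    | cast i =>
      induction j using Fin.lastCases with
      | last => exact absurd hij (not_le.2 (Fin.castSucc_lt_last i))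
      | cast j =>
        have := hb x i j (Fin.castSucc_le_castSucc_iff.1 hij)
        rw [← hrc] at this
        rw [hBc]
        exact this

variable {V : Type*} [AddCommGroup V] [Module K V] [Module.Finite K V]

/-- Engel's theorem in matrix form, with the freedom to pass to larger matrices. -/
theorem exists_isUpper_of_isNilpotent (ρ : L →ₗ⁅K⁆ End K V) (hρ : ∀ x, IsNilpotent (ρ x)) {n : ℕ}
    (hn : finrank K V ≤ n) :
    ∃ φ : L →ₗ⁅K⁆ Matrix (Fin n) (Fin n) K, (∀ x, IsUpper 1 (φ x)) ∧ ∀ x, φ x = 0 → ρ x = 0 := by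
  -- `V` is enlarged by a trivial summand to make its dimension equal to `n`.
  obtain ⟨m, rfl⟩ := Nat.exists_eq_add_of_le hn
  let W := V × (Fin m → K)
  let τ : End K V →ₗ⁅K⁆ End K W :=
    { toFun := fun f => LinearMap.prodMap f 0
      map_add' := fun f g => by ext <;> simp
      map_smul' := fun t f => by ext <;> simp
      map_lie' := fun {f g} => LinearMap.ext fun v => Prod.ext rfl (sub_zero (0 : Fin m → K)).symm }
  let σ : L →ₗ⁅K⁆ End K W := τ.comp ρ
  have hσ : ∀ x, IsNilpotent (σ x) := fun x => by
    obtain ⟨r, hr⟩ := hρ x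
    refine ⟨r + 1, ?_⟩
    have : σ x ^ (r + 1) = LinearMap.prodMap (ρ x ^ (r + 1)) (0 ^ (r + 1)) :=
      (map_pow (LinearMap.prodMapRingHom K V (Fin m → K)) (ρ x, 0) (r + 1)).symm
    rw [this, pow_succ, hr, zero_mul, zero_pow (Nat.succ_ne_zero r)]
    ext <;> simp
  let : LieRingModule L W := LieRingModule.compLieHom W σ
  let : LieModule K L W := LieModule.compLieHom W σ
  have : LieModule.IsNilpotent L W := (LieModule.isNilpotent_iff_forall' (R := K)).2 fun x => hσ x
  obtain ⟨b, hb⟩ := exists_basis_repr_lie_eq_zero (K := K) (L := L) (finrank K V + m) W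
    (by simp [W, finrank_prod])
  let e : End K W →ₗ⁅K⁆ Matrix (Fin (finrank K V + m)) (Fin (finrank K V + m)) K :=
    (LinearMap.toMatrixAlgEquiv b).toAlgHom.toLieHom
  refine ⟨e.comp σ, fun x i j hij => ?_, fun x hx => ?_⟩
  · change LinearMap.toMatrixAlgEquiv b (σ x) i j = 0
    rw [LinearMap.toMatrixAlgEquiv_apply]
    exact hb x i j (Nat.lt_succ_iff.1 hij)
  · have h0 : σ x = 0 := (LinearMap.toMatrixAlgEquiv b).injective (hx.trans (map_zero _).symm)
    ext v
    have := congrArg Prod.fst (LinearMap.congr_fun h0 (v, 0))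
    exact this

end Engel

end NilSix

namespace NilSix
variable {k : Type u}
attribute [local instance] LieRing.ofAssociativeRing

open Module LieModule

/-! ### Weight spaces -/

section Weights

theorem finrank_range_le_of_ker_le {K L V : Type*} [Field K]
    [AddCommGroup L] [Module K L] [Module.Finite K L] [AddCommGroup V] [Module K V]
    {m : ℕ} (F : L →ₗ[K] (Fin m → K)) (A : L →ₗ[K] V) (h : ∀ x, F x = 0 → A x = 0) :
    finrank K (LinearMap.range A) ≤ m := by
  have h1 := LinearMap.finrank_range_add_finrank_ker A
  have h2 := LinearMap.finrank_range_add_finrank_ker F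
  have h3 : finrank K (LinearMap.ker F) ≤ finrank K (LinearMap.ker A) :=
    Submodule.finrank_mono fun x hx => h x hx
  have h4 : finrank K (LinearMap.range F) ≤ m :=
    (Submodule.finrank_le _).trans (by rw [finrank_fin_fun])
  omega

variable {K L M : Type*} [Field K] [LieRing L] [LieAlgebra K L] [LieRing.IsNilpotent L]
  [AddCommGroup M] [Module K M] [LieRingModule L M] [LieModule K L M] [Module.Finite K M]

/-- On a generalized weight space the action is, up to the scalar given by the weight, strictly
upper triangular. -/
theorem exists_isUpper_genWeightSpace [CharZero K] (χ : Weight K L M) {n : ℕ}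
    (hn : finrank K (genWeightSpace M χ) ≤ n) :
    ∃ φ : L →ₗ⁅K⁆ Matrix (Fin n) (Fin n) K, (∀ x, IsUpper 1 (φ x)) ∧
      ∀ x, φ x = 0 → χ x = 0 → toEnd K L (genWeightSpace M χ) x = 0 := by
  obtain ⟨φ, hφ, hφ0⟩ := exists_isUpper_of_isNilpotent (K := K)
    (V := shiftedGenWeightSpace K L M χ) (toEnd K L (shiftedGenWeightSpace K L M χ))
    (fun x => isNilpotent_toEnd_of_isNilpotent K L _ x) hn
  refine ⟨φ, hφ, fun x hx hχ => ?_⟩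
  ext m
  have h := LinearMap.congr_fun (hφ0 x hx) (shiftedGenWeightSpace.shift K L M χ m)
  have h2 := congrArg (Subtype.val) h
  have h3 : ⁅x, (m : M)⁆ - χ x • (m : M) = 0 := h2
  rw [hχ, zero_smul, sub_zero] at h3
  exact h3

/-- If some generalized weight space is everything, every element acts as a scalar plus a nilpotent
endomorphism; the scalar is determined by the trace. -/
theorem isNilpotent_sub_trace_of_eq_top [CharZero K] (χ : Weight K L M)
    (hχ : genWeightSpace M χ = ⊤) (x : L) :
    IsNilpotent ((finrank K M : K) • toEnd K L M x -
      algebraMap K _ (LinearMap.trace K M (toEnd K L M x))) := by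
  obtain ⟨r, hr⟩ := exists_genWeightSpace_le_ker_of_isNoetherian M χ x
  have hnil : IsNilpotent (toEnd K L M x - algebraMap K _ (χ x)) := by
    refine ⟨r, LinearMap.ker_eq_top.1 (top_le_iff.1 fun m _ => hr ?_)⟩
    rw [hχ]
    exact LieSubmodule.mem_top m
  have htr : LinearMap.trace K M (toEnd K L M x) = finrank K M * χ x := by
    have := (LinearMap.isNilpotent_trace_of_isNilpotent hnil).eq_zero
    rw [map_sub, sub_eq_zero, Module.algebraMap_end_eq_smul_id, map_smul, LinearMap.trace_id,
      smul_eq_mul, mul_comm] at this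
    exact this
  have : (finrank K M : K) • toEnd K L M x - algebraMap K _ (LinearMap.trace K M (toEnd K L M x)) =
      (finrank K M : K) • (toEnd K L M x - algebraMap K _ (χ x)) := by
    rw [htr, smul_sub, map_mul, Algebra.smul_def, Algebra.smul_def]
  rw [this]
  exact hnil.smul _

/-- On a weight space of dimension `d ≤ 3` the Lie algebra acts through a quotient of dimension at
most `1 + d (d - 1) / 2 ≤ 4 d / 3`. -/
theorem three_mul_finrank_range_le [CharZero K] [Module.Finite K L] (χ : Weight K L M)
    (h3 : finrank K (genWeightSpace M χ) ≤ 3) :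
    3 * finrank K (LinearMap.range (toEnd K L (genWeightSpace M χ)).toLinearMap) ≤
      4 * finrank K (genWeightSpace M χ) := by
  have hpos := zero_lt_finrank_genWeightSpace χ.genWeightSpace_ne_bot
  obtain ⟨φ, hφ, hφ0⟩ := exists_isUpper_genWeightSpace χ le_rfl
  generalize finrank K (genWeightSpace M χ) = d at *
  let E (i j : Fin d) : L →ₗ[K] K := (Matrix.entryLinearMap K K i j).comp (φ : L →ₗ[K] _)
  have hlow : ∀ x i j, j ≤ i → φ x i j = 0 := fun x => (hφ x).apply_eq_zero
  interval_cases d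
  · have := finrank_range_le_of_ker_le (LinearMap.pi ![χ.toLinear])
      (toEnd K L (genWeightSpace M χ)).toLinearMap fun x hx => by
        refine hφ0 x ?_ (congrFun hx 0)
        ext i j
        exact hlow x i j (by omega)
    omega
  · have := finrank_range_le_of_ker_le (LinearMap.pi ![χ.toLinear, E 0 1])
      (toEnd K L (genWeightSpace M χ)).toLinearMap fun x hx => by
        refine hφ0 x ?_ (congrFun hx 0)
        have h01 : φ x 0 1 = 0 := congrFun hx 1
        ext i j
        fin_cases i <;> fin_cases j <;> first | exact h01 | exact hlow x _ _ (by decide)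
    omega
  · have := finrank_range_le_of_ker_le (LinearMap.pi ![χ.toLinear, E 0 1, E 0 2, E 1 2])
      (toEnd K L (genWeightSpace M χ)).toLinearMap fun x hx => by
        refine hφ0 x ?_ (congrFun hx 0)
        have h01 : φ x 0 1 = 0 := congrFun hx 1
        have h02 : φ x 0 2 = 0 := congrFun hx 2
        have h12 : φ x 1 2 = 0 := congrFun hx 3
        ext i j
        fin_cases i <;> fin_cases j <;>
          first | exact h01 | exact h02 | exact h12 | exact hlow x _ _ (by decide)
    omega

/-- Weights vanish on brackets, so that a bracket acts on a weight space as it does through the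
strictly upper triangular part of the action. -/
theorem toEnd_genWeightSpace_lie_eq_zero [CharZero K] (χ : Weight K L M) {n : ℕ}
    (hn : finrank K (genWeightSpace M χ) ≤ n) {x y : L}
    (h : ∀ φ : L →ₗ⁅K⁆ Matrix (Fin n) (Fin n) K, (∀ x, IsUpper 1 (φ x)) → φ ⁅x, y⁆ = 0) :
    toEnd K L (genWeightSpace M χ) ⁅x, y⁆ = 0 := by
  obtain ⟨φ, hφ, hφ0⟩ := exists_isUpper_genWeightSpace χ hn
  exact hφ0 _ (h φ hφ) (χ.apply_lie x y)

variable [IsAlgClosed K]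

variable (K L M) in
theorem sum_finrank_genWeightSpace :
    ∑ χ : Weight K L M, finrank K (genWeightSpace M χ) = finrank K M := by
  classical
  have hint : DirectSum.IsInternal fun χ : Weight K L M => (genWeightSpace M χ).toSubmodule := by
    refine DirectSum.isInternal_submodule_of_iSupIndep_of_iSup_eq_top ?_ ?_
    · exact LieSubmodule.iSupIndep_toSubmodule.2 (iSupIndep_genWeightSpace' K L M)
    · rw [← LieSubmodule.iSup_toSubmodule, iSup_genWeightSpace_eq_top']
      rfl
  rw [← (LinearEquiv.ofBijective (DirectSum.coeLinearMap _) hint).finrank_eq, finrank_directSum]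
  rfl

/-- Over an algebraically closed field the weight spaces span the module, so that an element of a
faithfully acting algebra is zero if it acts as zero on each of them. -/
theorem eq_zero_of_forall_genWeightSpace (hinj : Function.Injective (toEnd K L M)) {x : L}
    (hx : ∀ χ : Weight K L M, toEnd K L (genWeightSpace M χ) x = 0) : x = 0 := by
  refine hinj ?_
  rw [map_zero, ← LinearMap.ker_eq_top, eq_top_iff]
  have h := congrArg LieSubmodule.toSubmodule (iSup_genWeightSpace_eq_top' K L M)
  rw [LieSubmodule.iSup_toSubmodule] at h
  rw [← LieSubmodule.top_toSubmodule (R := K) (L := L), ← h, iSup_le_iff]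
  intro χ m hm
  exact congrArg Subtype.val (LinearMap.congr_fun (hx χ) ⟨m, hm⟩)

/-- Summing `three_mul_finrank_range_le` over the weights: if all weight spaces are small, the
algebra embeds into a product of quotients that is too small for a big algebra. -/
theorem three_mul_finrank_le [CharZero K] [Module.Finite K L]
    (hinj : Function.Injective (toEnd K L M))
    (h3 : ∀ χ : Weight K L M, finrank K (genWeightSpace M χ) ≤ 3) :
    3 * finrank K L ≤ 4 * finrank K M := by
  let F : L →ₗ[K] ((χ : Weight K L M) →
      LinearMap.range (toEnd K L (genWeightSpace M χ)).toLinearMap) :=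
    LinearMap.pi fun χ => LinearMap.rangeRestrict _
  have hF : Function.Injective F := by
    rw [injective_iff_map_eq_zero]
    intro x hx
    refine eq_zero_of_forall_genWeightSpace hinj fun χ => ?_
    exact congrArg Subtype.val (congrFun hx χ)
  have h1 := LinearMap.finrank_le_finrank_of_injective hF
  rw [finrank_pi_fintype] at h1
  rw [← sum_finrank_genWeightSpace K L M, Finset.mul_sum]
  refine (Nat.mul_le_mul_left 3 h1).trans ?_
  rw [Finset.mul_sum]
  exact Finset.sum_le_sum fun χ _ => three_mul_finrank_range_le χ (h3 χ)

end Weights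

end NilSix

namespace NilSix
variable {k : Type u}
attribute [local instance] LieRing.ofAssociativeRing

open Module LieModule TensorProduct

/-! ### Faithful modules of small dimension over an algebraically closed field -/

section AlgClosed

variable {K L M : Type*} [Field K] [LieRing L] [LieAlgebra K L]
  [LieRing.IsNilpotent L] [AddCommGroup M] [Module K M] [LieRingModule L M] [LieModule K L M]
  [Module.Finite K M]

theorem genWeightSpace_eq_top_of_finrank_le (χ : Weight K L M)
    (h : finrank K M ≤ finrank K (genWeightSpace M χ)) : genWeightSpace M χ = ⊤ := by
  rw [← LieSubmodule.toSubmodule_eq_top]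
  exact Submodule.eq_top_of_finrank_eq (le_antisymm (Submodule.finrank_le _) h)

variable [IsAlgClosed K]

theorem finrank_genWeightSpace_add_le {χ χ' : Weight K L M} (h : χ ≠ χ') :
    finrank K (genWeightSpace M χ) + finrank K (genWeightSpace M χ') ≤ finrank K M := by
  classical
  rw [← sum_finrank_genWeightSpace K L M,
    ← Finset.sum_pair (f := fun χ : Weight K L M => finrank K (genWeightSpace M χ)) h]
  exact Finset.sum_le_univ_sum_of_nonneg fun _ => Nat.zero_le _

variable [CharZero K]

theorem exists_genWeightSpace_eq_top_of_finrank_eq_six [Module.Finite K L]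
    (hinj : Function.Injective (toEnd K L M)) (hL : finrank K L = 6) (hM : finrank K M ≤ 4) :
    ∃ χ : Weight K L M, genWeightSpace M χ = ⊤ := by
  by_contra! h
  have := three_mul_finrank_le hinj fun χ => by
    have := mt (genWeightSpace_eq_top_of_finrank_le χ) (h χ)
    omega
  omega

/-- A fivefold product of strictly upper triangular matrices of size at most `5` is zero. -/
theorem lie_lie_lie_lie_eq_zero_of_finrank_le_five (hinj : Function.Injective (toEnd K L M))
    (hM : finrank K M ≤ 5) (a b c d e : L) : ⁅a, ⁅b, ⁅c, ⁅d, e⁆⁆⁆⁆ = 0 := by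
  refine eq_zero_of_forall_genWeightSpace hinj fun χ => ?_
  refine toEnd_genWeightSpace_lie_eq_zero χ (n := 5) ((Submodule.finrank_le _).trans hM) ?_
  intro φ hφ
  simp only [LieHom.map_lie]
  exact ((hφ a).lie ((hφ b).lie ((hφ c).lie ((hφ d).lie (hφ e))))).eq_zero

/-- In a faithful module of dimension at most `5`, two linearly independent threefold brackets can
only be told apart on a weight space of dimension `5`: a strictly upper triangular matrix that is a
threefold bracket vanishes in size `3` and has a single entry in size `4`, and two weight spaces of
dimension at least `4` do not fit. -/
theorem exists_genWeightSpace_eq_top_of_lie_lie (hinj : Function.Injective (toEnd K L M))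
    (hM : finrank K M ≤ 5) {a b c a' b' c' : L}
    (hind : ∀ s t : K, s • ⁅a, ⁅b, c⁆⁆ + t • ⁅a', ⁅b', c'⁆⁆ = 0 → s = 0 ∧ t = 0) :
    ∃ χ : Weight K L M, genWeightSpace M χ = ⊤ := by
  have hsmall : ∀ (χ : Weight K L M), finrank K (genWeightSpace M χ) ≤ 3 → ∀ a b c : L,
      toEnd K L (genWeightSpace M χ) ⁅a, ⁅b, c⁆⁆ = 0 := by
    intro χ hχ a b c
    refine toEnd_genWeightSpace_lie_eq_zero χ hχ ?_
    intro φ hφ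
    simp only [LieHom.map_lie]
    exact ((hφ a).lie ((hφ b).lie (hφ c))).eq_zero
  obtain ⟨χ, hχ⟩ : ∃ χ : Weight K L M, toEnd K L (genWeightSpace M χ) ⁅a, ⁅b, c⁆⁆ ≠ 0 := by
    by_contra! h
    have h0 := eq_zero_of_forall_genWeightSpace hinj h
    have := hind 1 0 (by rw [h0]; simp)
    exact one_ne_zero this.1
  have h4 : 3 < finrank K (genWeightSpace M χ) := by
    by_contra! h
    exact hχ (hsmall χ h a b c)
  refine ⟨χ, genWeightSpace_eq_top_of_finrank_le χ ?_⟩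
  by_contra! h5
  obtain ⟨φ, hφ, hφ0⟩ := exists_isUpper_genWeightSpace χ (n := 4) (by omega)
  have hu : ∀ a b c : L, IsUpper 3 (φ ⁅a, ⁅b, c⁆⁆) := fun a b c => by
    simp only [LieHom.map_lie]
    exact (hφ a).lie ((hφ b).lie (hφ c))
  have hz : ∀ a b c : L, φ ⁅a, ⁅b, c⁆⁆ 0 3 = 0 →
      toEnd K L (genWeightSpace M χ) ⁅a, ⁅b, c⁆⁆ = 0 := by
    intro a b c h
    refine hφ0 _ ?_ (χ.apply_lie _ _)
    ext i j
    by_cases hij : i = 0 ∧ j = 3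
    · rw [hij.1, hij.2, h]; rfl
    · exact hu a b c i j (by omega)
  have hcomb := hind (φ ⁅a', ⁅b', c'⁆⁆ 0 3) (-φ ⁅a, ⁅b, c⁆⁆ 0 3) (by
    refine eq_zero_of_forall_genWeightSpace hinj fun χ' => ?_
    by_cases hχ' : χ = χ'
    · subst hχ'
      refine hφ0 _ ?_ ?_
      · rw [map_add, map_smul, map_smul]
        ext i j
        by_cases hij : i = 0 ∧ j = 3
        · rw [hij.1, hij.2]
          simp [mul_comm]
        · have h1 := hu a b c i j (by omega)
          have h2 := hu a' b' c' i j (by omega)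
          rw [Matrix.add_apply, Matrix.smul_apply, Matrix.smul_apply, h1, h2]
          simp
      · rw [← LieModule.Weight.toLinear_apply, map_add, map_smul, map_smul]
        simp
    · have := finrank_genWeightSpace_add_le hχ'
      rw [map_add, map_smul, map_smul, hsmall χ' (by omega), hsmall χ' (by omega), smul_zero,
        smul_zero, add_zero])
  exact hχ (hz a b c (neg_eq_zero.1 hcomb.2))

end AlgClosed

/-! ### Descent from an extension field -/

section Descent

variable {L V : Type*} [Field k] [LieRing L] [LieAlgebra k L] [AddCommGroup V] [Module k V]
  [LieRingModule L V] [LieModule k L V]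

/-- Faithfulness of a representation is stable under extension of scalars. -/
theorem injective_toEnd_baseChange (K : Type*) [Field K] [Algebra k K]
    (hinj : Function.Injective (toEnd k L V)) :
    Function.Injective (toEnd K (K ⊗[k] L) (K ⊗[k] V)) := by
  classical
  rw [injective_iff_map_eq_zero]
  intro y hy
  let κ := Basis.ofVectorSpace k K
  have key : ∀ (g : K →ₗ[k] k) (v : V) (y : K ⊗[k] L),
      ⁅TensorProduct.lid k L (g.rTensor L y), v⁆ =
        TensorProduct.lid k V (g.rTensor V ⁅y, (1 : K) ⊗ₜ[k] v⁆) := by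
    intro g v y
    induction y with
    | zero => simp
    | tmul s x => simp
    | add y z hy hz => simp only [map_add, add_lie, hy, hz]
  refine (TensorProduct.equivFinsuppOfBasisLeft κ).injective ?_
  rw [map_zero]
  ext i
  rw [TensorProduct.equivFinsuppOfBasisLeft_apply, Finsupp.zero_apply]
  refine (injective_iff_map_eq_zero _).1 hinj _ (LinearMap.ext fun v => ?_)
  rw [toEnd_apply_apply, key]
  have := LinearMap.congr_fun hy ((1 : K) ⊗ₜ[k] v)
  rw [toEnd_apply_apply, LinearMap.zero_apply] at this
  rw [this, map_zero, map_zero, LinearMap.zero_apply]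

theorem isNilpotent_of_baseChange (K : Type*) [Field K] [Algebra k K] (f : End k V)
    (h : IsNilpotent (f.baseChange K)) : IsNilpotent f := by
  obtain ⟨r, hr⟩ := h
  refine ⟨r, LinearMap.ext fun v => ?_⟩
  rw [← LinearMap.baseChange_pow] at hr
  have := LinearMap.congr_fun hr ((1 : K) ⊗ₜ[k] v)
  rw [LinearMap.baseChange_tmul, LinearMap.zero_apply] at this
  have hi : Function.Injective (TensorProduct.mk k K V 1) :=
    Module.FaithfullyFlat.tensorProduct_mk_injective V
  exact hi (this.trans (map_zero _).symm)

variable [CharZero k] [LieRing.IsNilpotent L] [Module.Finite k V]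

/-- If over some extension field there is only one weight, then already over `k` every element acts
as a scalar plus a nilpotent endomorphism, since the scalar is the normalized trace. -/
theorem isNilpotent_sub_trace_of_baseChange {K : Type*} [Field K] [Algebra k K]
    (χ : Weight K (K ⊗[k] L) (K ⊗[k] V)) (hχ : genWeightSpace (K ⊗[k] V) χ = ⊤) (x : L) :
    IsNilpotent (toEnd k L V x -
      ((finrank k V : k)⁻¹ * LinearMap.trace k V (toEnd k L V x)) • (1 : End k V)) := by
  have : CharZero K := charZero_of_injective_algebraMap (algebraMap k K).injective
  have h := isNilpotent_sub_trace_of_eq_top χ hχ (1 ⊗ₜ x)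
  rw [toEnd_baseChange, LinearMap.trace_baseChange, finrank_baseChange] at h
  by_cases hV : (finrank k V : k) = 0
  · rw [Nat.cast_eq_zero] at hV
    have := finrank_zero_iff.1 hV
    have h0 : ∀ f : End k V, f = 0 := fun f => LinearMap.ext fun v => Subsingleton.elim _ _
    rw [h0 (_ - _)]
    exact IsNilpotent.zero
  have h2 : IsNilpotent ((finrank k V : k) • toEnd k L V x -
      LinearMap.trace k V (toEnd k L V x) • (1 : End k V)) := by
    refine isNilpotent_of_baseChange K _ ?_
    rw [LinearMap.baseChange_sub, LinearMap.baseChange_smul, LinearMap.baseChange_smul,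
      LinearMap.baseChange_one]
    convert h using 2
    · rw [← algebraMap_smul K (finrank k V : k), map_natCast]
    · exact (algebraMap_smul K _ _).symm.trans (Algebra.algebraMap_eq_smul_one _).symm
  have h3 := h2.smul (finrank k V : k)⁻¹
  rwa [smul_sub, smul_smul, smul_smul, inv_mul_cancel₀ hV, one_smul] at h3

end Descent

end NilSix

namespace NilSix
variable {k : Type u}
attribute [local instance] LieRing.ofAssociativeRing

open Module LieModule TensorProduct

/-! ### From dimensions to strictly upper triangular matrices -/

section Dims

variable [Field k]

instance (c : Name k) : Module.Finite k (Alg c) := inferInstanceAs (Module.Finite k (Fin 6 → k))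

theorem finrank_alg (c : Name k) : finrank k (Alg c) = 6 :=
  (finrank_fin_fun k : finrank k (Fin 6 → k) = 6)

theorem IsFaithfulRep.mem_faithfulDims {c : Name k} {n : ℕ}
    {f : (Fin 6 → k) → Matrix (Fin n) (Fin n) k} (h : IsFaithfulRep c f) :
    n ∈ faithfulDims k (Alg c) := by
  obtain ⟨π, -, hinj⟩ := h
  let e : Matrix (Fin n) (Fin n) k →ₗ⁅k⁆ End k (Fin n → k) :=
    (Matrix.toLinAlgEquiv' (R := k) (n := Fin n)).toAlgHom.toLieHom
  exact ⟨Fin n → k, inferInstance, inferInstance, e.comp π, inferInstance, finrank_fin_fun k,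
    (Matrix.toLinAlgEquiv' (R := k) (n := Fin n)).injective.comp hinj⟩

theorem IsFaithfulNilrep.mem_faithfulNilDims {c : Name k} {n : ℕ}
    {f : (Fin 6 → k) → Matrix (Fin n) (Fin n) k} (h : IsFaithfulNilrep c f) :
    n ∈ faithfulNilDims k (Alg c) := by
  obtain ⟨⟨π, hf, hinj⟩, hnil⟩ := h
  let e : Matrix (Fin n) (Fin n) k →ₗ⁅k⁆ End k (Fin n → k) :=
    (Matrix.toLinAlgEquiv' (R := k) (n := Fin n)).toAlgHom.toLieHom
  refine ⟨Fin n → k, inferInstance, inferInstance, e.comp π, inferInstance, finrank_fin_fun k,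
    (Matrix.toLinAlgEquiv' (R := k) (n := Fin n)).injective.comp hinj, fun x => ?_⟩
  exact (hf x ▸ hnil x : IsNilpotent (π x)).map (Matrix.toLinAlgEquiv' (R := k) (n := Fin n))

theorem faithfulNilDims_subset (c : Name k) :
    faithfulNilDims k (Alg c) ⊆ faithfulDims k (Alg c) :=
  fun _ ⟨V, _, _, π, hfin, hn, hinj, _⟩ => ⟨V, _, _, π, hfin, hn, hinj⟩

/-- By Engel's theorem, an algebra with a faithful nilrepresentation is nilpotent. -/
theorem IsFaithfulNilrep.isNilpotent_alg {c : Name k} {n : ℕ}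
    {f : (Fin 6 → k) → Matrix (Fin n) (Fin n) k} (h : IsFaithfulNilrep c f) :
    LieRing.IsNilpotent (Alg c) := by
  obtain ⟨⟨π, hf, hinj⟩, hnil⟩ := h
  refine (LieAlgebra.isNilpotent_iff_forall (R := k)).2 fun x => ?_
  obtain ⟨r, hr⟩ : IsNilpotent (LieAlgebra.ad k (Matrix (Fin n) (Fin n) k) (π x)) :=
    LieAlgebra.ad_nilpotent_of_nilpotent (hf x ▸ hnil x)
  refine ⟨r, LinearMap.ext fun y => hinj ?_⟩
  have key : ∀ m y, π ((LieAlgebra.ad k (Alg c) x ^ m) y) =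
      (LieAlgebra.ad k (Matrix (Fin n) (Fin n) k) (π x) ^ m) (π y) := by
    intro m
    induction m with
    | zero => intro y; rfl
    | succ m ih =>
      intro y
      rw [pow_succ, pow_succ, Module.End.mul_apply, Module.End.mul_apply, ih, LieAlgebra.ad_apply,
        LieAlgebra.ad_apply, LieHom.map_lie]
  rw [key, hr, LinearMap.zero_apply, LinearMap.zero_apply, map_zero]

/-- `c` has a representation on `k^n` that is the sum of a representation `φ` by strictly upper
triangular matrices and a character `τ` times the identity, and that is faithful. -/
def HasScalarUpperRep (c : Name k) (n : ℕ) : Prop :=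
  ∃ (φ : Alg c →ₗ⁅k⁆ Matrix (Fin n) (Fin n) k) (τ : Alg c →ₗ[k] k), (∀ x, IsUpper 1 (φ x)) ∧
    (∀ x y : Alg c, τ ⁅x, y⁆ = 0) ∧ ∀ x, φ x = 0 → τ x = 0 → x = 0

/-- `c` has a faithful representation on `k^n` by strictly upper triangular matrices. -/
def HasUpperRep (c : Name k) (n : ℕ) : Prop :=
  ∃ φ : Alg c →ₗ⁅k⁆ Matrix (Fin n) (Fin n) k, (∀ x, IsUpper 1 (φ x)) ∧ ∀ x, φ x = 0 → x = 0

theorem hasUpperRep_of_mem_faithfulNilDims {c : Name k} {n N : ℕ}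
    (h : n ∈ faithfulNilDims k (Alg c)) (hn : n ≤ N) : HasUpperRep c N := by
  obtain ⟨V, _, _, π, _, rfl, hinj, hnil⟩ := h
  obtain ⟨φ, hφ, hφ0⟩ := exists_isUpper_of_isNilpotent π hnil hn
  exact ⟨φ, hφ, fun x hx => (injective_iff_map_eq_zero π).1 hinj x (hφ0 x hx)⟩

theorem hasScalarUpperRep_of_isNilpotent_sub {c : Name k} {V : Type*} [AddCommGroup V] [Module k V]
    [Module.Finite k V] (π : Alg c →ₗ⁅k⁆ End k V) (hinj : Function.Injective π) {N : ℕ}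
    (hN : finrank k V ≤ N)
    (h : ∀ x, IsNilpotent
      (π x - ((finrank k V : k)⁻¹ * LinearMap.trace k V (π x)) • (1 : End k V))) :
    HasScalarUpperRep c N := by
  let τ : Alg c →ₗ[k] k :=
    (finrank k V : k)⁻¹ • (LinearMap.trace k V).comp (π : Alg c →ₗ[k] End k V)
  have hτ : ∀ x y : Alg c, τ ⁅x, y⁆ = 0 := fun x y => by
    change (finrank k V : k)⁻¹ * LinearMap.trace k V (π ⁅x, y⁆) = 0
    rw [LieHom.map_lie, Ring.lie_def, map_sub, LinearMap.trace_mul_comm, sub_self, mul_zero]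
  let ρ : Alg c →ₗ⁅k⁆ End k V :=
    { toFun := fun x => π x - τ x • (1 : End k V)
      map_add' := fun x y => by rw [map_add, map_add, add_smul]; abel
      map_smul' := fun t x => by
        rw [map_smul, map_smul, smul_eq_mul, mul_smul, RingHom.id_apply, smul_sub]
      map_lie' := fun {x y} => by
        change π ⁅x, y⁆ - τ ⁅x, y⁆ • (1 : End k V) =
          ⁅π x - τ x • (1 : End k V), π y - τ y • (1 : End k V)⁆
        rw [hτ, zero_smul, sub_zero, LieHom.map_lie, Ring.lie_def, Ring.lie_def]
        simp only [sub_mul, mul_sub, smul_mul_assoc, mul_smul_comm, one_mul, mul_one, smul_sub,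
          smul_smul, mul_comm (τ y) (τ x)]
        abel }
  obtain ⟨φ, hφ, hφ0⟩ := exists_isUpper_of_isNilpotent ρ h hN
  refine ⟨φ, τ, hφ, hτ, fun x hx hx' => (injective_iff_map_eq_zero π).1 hinj x ?_⟩
  have h1 : π x - τ x • (1 : End k V) = 0 := hφ0 x hx
  rwa [hx', zero_smul, sub_zero] at h1

variable [CharZero k]

instance : CharZero (AlgebraicClosure k) :=
  charZero_of_injective_algebraMap (algebraMap k (AlgebraicClosure k)).injective

variable {c : Name k} [LieRing.IsNilpotent (Alg c)] {n : ℕ}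

theorem four_le_of_mem_faithfulDims (h : n ∈ faithfulDims k (Alg c)) : 4 ≤ n := by
  obtain ⟨V, _, _, π, _, rfl, hinj⟩ := h
  let K := AlgebraicClosure k
  let : LieRingModule (Alg c) V := LieRingModule.compLieHom V π
  have : LieModule k (Alg c) V := LieModule.compLieHom V π
  by_contra! hV
  have h1 := three_mul_finrank_le (K := K) (L := K ⊗[k] Alg c) (M := K ⊗[k] V)
    (injective_toEnd_baseChange K hinj) fun χ => by
      have := Submodule.finrank_le (genWeightSpace (K ⊗[k] V) χ).toSubmodule
      rw [finrank_baseChange] at this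
      exact this.trans (Nat.le_of_lt_succ hV)
  rw [finrank_baseChange, finrank_baseChange, finrank_alg] at h1
  omega

theorem hasScalarUpperRep_four (h : n ∈ faithfulDims k (Alg c)) (hn : n ≤ 4) :
    HasScalarUpperRep c 4 := by
  obtain ⟨V, _, _, π, _, rfl, hinj⟩ := h
  let K := AlgebraicClosure k
  let : LieRingModule (Alg c) V := LieRingModule.compLieHom V π
  have : LieModule k (Alg c) V := LieModule.compLieHom V π
  obtain ⟨χ, hχ⟩ := exists_genWeightSpace_eq_top_of_finrank_eq_six (K := K) (L := K ⊗[k] Alg c)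
    (M := K ⊗[k] V) (injective_toEnd_baseChange K hinj) (by rw [finrank_baseChange, finrank_alg])
    (by rwa [finrank_baseChange])
  exact hasScalarUpperRep_of_isNilpotent_sub π hinj hn
    fun x => isNilpotent_sub_trace_of_baseChange χ hχ x

theorem six_le_of_lie_lie_lie_lie_ne_zero (h : n ∈ faithfulDims k (Alg c)) {v w x y z : Alg c}
    (h0 : ⁅v, ⁅w, ⁅x, ⁅y, z⁆⁆⁆⁆ ≠ 0) : 6 ≤ n := by
  obtain ⟨V, _, _, π, _, rfl, hinj⟩ := h
  let K := AlgebraicClosure k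
  let : LieRingModule (Alg c) V := LieRingModule.compLieHom V π
  have : LieModule k (Alg c) V := LieModule.compLieHom V π
  by_contra! hV
  have h1 := lie_lie_lie_lie_eq_zero_of_finrank_le_five (K := K) (L := K ⊗[k] Alg c)
    (M := K ⊗[k] V) (injective_toEnd_baseChange K hinj)
    (by rw [finrank_baseChange]; exact Nat.le_of_lt_succ hV) (1 ⊗ₜ v) (1 ⊗ₜ w) (1 ⊗ₜ x) (1 ⊗ₜ y)
    (1 ⊗ₜ z)
  simp only [LieAlgebra.ExtendScalars.bracket_tmul, mul_one] at h1
  have hi : Function.Injective (TensorProduct.mk k K (Alg c) 1) :=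
    Module.FaithfullyFlat.tensorProduct_mk_injective _
  exact h0 (hi (h1.trans (map_zero _).symm))

theorem hasScalarUpperRep_five (h : n ∈ faithfulDims k (Alg c)) (hn : n ≤ 5)
    {x y z x' y' z' : Alg c} (f g : Alg c →ₗ[k] k) (hf : f ⁅x, ⁅y, z⁆⁆ = 1)
    (hf' : f ⁅x', ⁅y', z'⁆⁆ = 0) (hg : g ⁅x, ⁅y, z⁆⁆ = 0) (hg' : g ⁅x', ⁅y', z'⁆⁆ = 1) :
    HasScalarUpperRep c 5 := by
  obtain ⟨V, _, _, π, _, rfl, hinj⟩ := h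
  let K := AlgebraicClosure k
  let : LieRingModule (Alg c) V := LieRingModule.compLieHom V π
  have : LieModule k (Alg c) V := LieModule.compLieHom V π
  obtain ⟨χ, hχ⟩ := exists_genWeightSpace_eq_top_of_lie_lie (K := K) (L := K ⊗[k] Alg c)
    (M := K ⊗[k] V) (injective_toEnd_baseChange K hinj) (by rwa [finrank_baseChange])
    (a := 1 ⊗ₜ x) (b := 1 ⊗ₜ y) (c := 1 ⊗ₜ z) (a' := 1 ⊗ₜ x') (b' := 1 ⊗ₜ y') (c' := 1 ⊗ₜ z')
    fun s t hst => by
      simp only [LieAlgebra.ExtendScalars.bracket_tmul, mul_one, smul_tmul', smul_eq_mul] at hst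
      have h1 := congrArg (fun v => TensorProduct.rid k K (f.lTensor K v)) hst
      have h2 := congrArg (fun v => TensorProduct.rid k K (g.lTensor K v)) hst
      simp [hf, hf'] at h1
      simp [hg, hg'] at h2
      exact ⟨h1, h2⟩
  exact hasScalarUpperRep_of_isNilpotent_sub π hinj hn
    fun x => isNilpotent_sub_trace_of_baseChange χ hχ x

end Dims

end NilSix

namespace NilSix
variable {k : Type u}
attribute [local instance] LieRing.ofAssociativeRing

open Module

/-! ### Matrices of size four -/

section SizeFour

variable [Field k]

theorem IsUpper.ext_four {A : Matrix (Fin 4) (Fin 4) k} (hA : IsUpper 1 A) (h01 : A 0 1 = 0)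
    (h02 : A 0 2 = 0) (h03 : A 0 3 = 0) (h12 : A 1 2 = 0) (h13 : A 1 3 = 0) (h23 : A 2 3 = 0) :
    A = 0 := by
  ext i j
  fin_cases i <;> fin_cases j <;> first | assumption | exact hA.apply_eq_zero _ _ (by decide)

theorem IsUpper.eq_upperFour {A : Matrix (Fin 4) (Fin 4) k} (hA : IsUpper 1 A) :
    A = upperFour 0 (A 0 1) (A 0 2) (A 0 3) (A 1 2) (A 1 3) (A 2 3) := by
  ext i j
  fin_cases i <;> fin_cases j <;> first | rfl | exact hA.apply_eq_zero _ _ (by decide)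

/-- The entries of the commutator of two strictly upper triangular `4 × 4` matrices. -/
theorem lie_apply_four {c : Name k} {φ : Alg c →ₗ⁅k⁆ Matrix (Fin 4) (Fin 4) k}
    (hφ : ∀ x, IsUpper 1 (φ x)) (x y : Alg c) :
    φ ⁅x, y⁆ 0 1 = 0 ∧ φ ⁅x, y⁆ 1 2 = 0 ∧ φ ⁅x, y⁆ 2 3 = 0 ∧
    φ ⁅x, y⁆ 0 2 = φ x 0 1 * φ y 1 2 - φ y 0 1 * φ x 1 2 ∧
    φ ⁅x, y⁆ 1 3 = φ x 1 2 * φ y 2 3 - φ y 1 2 * φ x 2 3 ∧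
    φ ⁅x, y⁆ 0 3 = φ x 0 1 * φ y 1 3 - φ y 0 1 * φ x 1 3 +
      (φ x 0 2 * φ y 2 3 - φ y 0 2 * φ x 2 3) := by
  have h : φ ⁅x, y⁆ = φ x * φ y - φ y * φ x := LieHom.map_lie φ x y
  rw [(hφ x).eq_upperFour, (hφ y).eq_upperFour, upperFour_lie] at h
  exact ⟨congrFun (congrFun h 0) 1, congrFun (congrFun h 1) 2, congrFun (congrFun h 2) 3,
    congrFun (congrFun h 0) 2, congrFun (congrFun h 1) 3, congrFun (congrFun h 0) 3⟩

variable {c : Name k}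

/-- A fourfold bracket of strictly upper triangular `4 × 4` matrices is zero. -/
theorem HasScalarUpperRep.lie_lie_lie_eq_zero (h : HasScalarUpperRep c 4) (x y z t : Alg c) :
    ⁅x, ⁅y, ⁅z, t⁆⁆⁆ = 0 := by
  obtain ⟨φ, τ, hφ, hτ, h0⟩ := h
  refine h0 _ ?_ (hτ _ _)
  simp only [LieHom.map_lie]
  exact ((hφ x).lie ((hφ y).lie ((hφ z).lie (hφ t)))).eq_zero

/-- In size `4`, threefold brackets span at most a line. -/
theorem HasScalarUpperRep.not_independent (h : HasScalarUpperRep c 4) {x y z x' y' z' : Alg c}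
    (h1 : ⁅x, ⁅y, z⁆⁆ ≠ 0) (g : Alg c →ₗ[k] k) (hg : g ⁅x, ⁅y, z⁆⁆ = 0)
    (hg' : g ⁅x', ⁅y', z'⁆⁆ = 1) : False := by
  obtain ⟨φ, τ, hφ, hτ, h0⟩ := h
  have hu : ∀ a b c : Alg c, IsUpper 3 (φ ⁅a, ⁅b, c⁆⁆) := fun a b c => by
    simp only [LieHom.map_lie]
    exact (hφ a).lie ((hφ b).lie (hφ c))
  have h2 : φ ⁅x', ⁅y', z'⁆⁆ 0 3 • ⁅x, ⁅y, z⁆⁆ - φ ⁅x, ⁅y, z⁆⁆ 0 3 • ⁅x', ⁅y', z'⁆⁆ = 0 := by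
    refine h0 _ ?_ ?_
    · rw [map_sub, map_smul, map_smul]
      ext i j
      rw [Matrix.sub_apply, Matrix.smul_apply, Matrix.smul_apply, smul_eq_mul, smul_eq_mul,
        Matrix.zero_apply]
      by_cases hij : i = 0 ∧ j = 3
      · rw [hij.1, hij.2]
        ring
      · rw [hu x y z i j (by omega), hu x' y' z' i j (by omega), mul_zero, mul_zero, sub_zero]
    · rw [map_sub, map_smul, map_smul, hτ, hτ, smul_zero, smul_zero, sub_zero]
  have h3 := congrArg g h2
  rw [map_sub, map_smul, map_smul, hg, hg', map_zero, smul_zero, smul_eq_mul, mul_one, zero_sub,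
    neg_eq_zero] at h3
  refine h1 (h0 _ ?_ (hτ _ _))
  ext i j
  by_cases hij : i = 0 ∧ j = 3
  · rw [hij.1, hij.2, h3, Matrix.zero_apply]
  · exact hu x y z i j (by omega)

/-- The kernel of the upper triangular part is central. It is zero if the centre lies in the
derived algebra, where the scalar part vanishes. -/
theorem HasScalarUpperRep.hasUpperRep {n : ℕ} (h : HasScalarUpperRep c n)
    (hc : ∀ x : Fin 6 → k, (∀ y, bracket c x y = 0) →
      ∃ a b a' b', x = bracket c a b + bracket c a' b') : HasUpperRep c n := by
  obtain ⟨φ, τ, hφ, hτ, h0⟩ := h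
  refine ⟨φ, hφ, fun x hx => ?_⟩
  obtain ⟨a, b, a', b', hab⟩ : ∃ a b a' b' : Alg c, x = ⁅a, b⁆ + ⁅a', b'⁆ :=
    hc x fun (y : Alg c) => h0 ⁅x, y⁆ (by rw [LieHom.map_lie, hx, zero_lie]) (hτ x y)
  exact h0 x hx (by rw [hab, map_add, hτ, hτ, add_zero])

/-- For dimension reasons a faithful representation by strictly upper triangular `4 × 4` matrices
is onto. -/
theorem exists_eq_upperFour {φ : Alg c →ₗ⁅k⁆ Matrix (Fin 4) (Fin 4) k}
    (hφ : ∀ x, IsUpper 1 (φ x)) (h0 : ∀ x, φ x = 0 → x = 0) (a01 a02 a03 a12 a13 a23 : k) :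
    ∃ x, φ x = upperFour 0 a01 a02 a03 a12 a13 a23 := by
  let E (i j : Fin 4) : Alg c →ₗ[k] k :=
    (Matrix.entryLinearMap k k i j).comp (φ : Alg c →ₗ[k] Matrix (Fin 4) (Fin 4) k)
  let F : Alg c →ₗ[k] (Fin 6 → k) := LinearMap.pi ![E 0 1, E 0 2, E 0 3, E 1 2, E 1 3, E 2 3]
  have hinj : Function.Injective F := by
    rw [injective_iff_map_eq_zero]
    intro x hx
    exact h0 x ((hφ x).ext_four (congrFun hx 0) (congrFun hx 1) (congrFun hx 2) (congrFun hx 3)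
      (congrFun hx 4) (congrFun hx 5))
  have hsurj := (LinearMap.injective_iff_surjective_of_finrank_eq_finrank
    (by rw [finrank_alg, finrank_fin_fun])).1 hinj
  obtain ⟨x, hx⟩ := hsurj ![a01, a02, a03, a12, a13, a23]
  refine ⟨x, ?_⟩
  rw [(hφ x).eq_upperFour, show φ x 0 1 = a01 from congrFun hx 0,
    show φ x 0 2 = a02 from congrFun hx 1, show φ x 0 3 = a03 from congrFun hx 2,
    show φ x 1 2 = a12 from congrFun hx 3, show φ x 1 3 = a13 from congrFun hx 4,
    show φ x 2 3 = a23 from congrFun hx 5]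

/-- The algebra of strictly upper triangular `4 × 4` matrices has a one-dimensional centre. -/
theorem HasUpperRep.not_independent_of_central (h : HasUpperRep c 4) {z z' : Alg c}
    (hz : ∀ y : Alg c, ⁅z, y⁆ = 0) (hz' : ∀ y : Alg c, ⁅z', y⁆ = 0)
    (hne : z ≠ 0) (g : Alg c →ₗ[k] k) (hg : g z = 0) (hg' : g z' = 1) :
    False := by
  obtain ⟨φ, hφ, h0⟩ := h
  have key : ∀ z : Alg c, (∀ y : Alg c, ⁅z, y⁆ = 0) →
      φ z 0 1 = 0 ∧ φ z 0 2 = 0 ∧ φ z 1 2 = 0 ∧ φ z 1 3 = 0 ∧ φ z 2 3 = 0 := by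
    intro z hz
    obtain ⟨p, hp⟩ := exists_eq_upperFour hφ h0 1 0 0 0 0 0
    obtain ⟨q, hq⟩ := exists_eq_upperFour hφ h0 0 0 0 1 0 0
    obtain ⟨r, hr⟩ := exists_eq_upperFour hφ h0 0 0 0 0 0 1
    obtain ⟨-, -, -, p02, -, p03⟩ := lie_apply_four hφ z p
    obtain ⟨-, -, -, q02, q13, -⟩ := lie_apply_four hφ z q
    obtain ⟨-, -, -, -, -, r03⟩ := lie_apply_four hφ z r
    rw [hz, hp, map_zero] at p02 p03
    rw [hz, hq, map_zero] at q02 q13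
    rw [hz, hr, map_zero] at r03
    simp [upperFour] at p02 p03 q02 q13 r03
    exact ⟨q02.symm, r03.symm, p02, p03, q13⟩
  obtain ⟨h01, h02, h12, h13, h23⟩ := key z hz
  obtain ⟨h01', h02', h12', h13', h23'⟩ := key z' hz'
  have h1 : φ z' 0 3 • z - φ z 0 3 • z' = 0 := by
    refine h0 _ ((hφ _).ext_four ?_ ?_ ?_ ?_ ?_ ?_) <;>
      simp [h01, h02, h12, h13, h23, h01', h02', h12', h13', h23', mul_comm]
  have h2 := congrArg g h1
  rw [map_sub, map_smul, map_smul, hg, hg', map_zero, smul_zero, smul_eq_mul, mul_one, zero_sub,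
    neg_eq_zero] at h2
  exact hne (h0 z ((hφ z).ext_four h01 h02 h2 h12 h13 h23))

/-- An algebra that is isomorphic to that of strictly upper triangular `4 × 4` matrices has
generators with the relations of the elementary matrices `E₀₁`, `E₁₂`, `E₂₃`. -/
theorem HasUpperRep.exists_generators (h : HasUpperRep c 4) :
    ∃ p q r : Fin 6 → k, bracket c p r = 0 ∧ bracket c p (bracket c p q) = 0 ∧
      bracket c r (bracket c r q) = 0 ∧
      (∀ s t u : k, s • bracket c p q + t • bracket c q r + u • bracket c p (bracket c q r) = 0 →
        s = 0 ∧ t = 0 ∧ u = 0) ∧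
      ∀ (s t : k) (x y x' y' x'' y'' : Fin 6 → k),
        s • p + t • r = bracket c x y + bracket c x' y' + bracket c x'' y'' → s = 0 ∧ t = 0 := by
  obtain ⟨φ, hφ, h0⟩ := h
  obtain ⟨p, hp⟩ := exists_eq_upperFour hφ h0 1 0 0 0 0 0
  obtain ⟨q, hq⟩ := exists_eq_upperFour hφ h0 0 0 0 1 0 0
  obtain ⟨r, hr⟩ := exists_eq_upperFour hφ h0 0 0 0 0 0 1
  have hl : ∀ x y, φ ⁅x, y⁆ = φ x * φ y - φ y * φ x := fun x y => LieHom.map_lie φ x y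
  have hpq : φ ⁅p, q⁆ = upperFour 0 0 1 0 0 0 0 := by
    rw [hl, hp, hq, upperFour_lie]; simp
  have hqr : φ ⁅q, r⁆ = upperFour 0 0 0 0 0 1 0 := by
    rw [hl, hq, hr, upperFour_lie]; simp
  have hrq : φ ⁅r, q⁆ = upperFour 0 0 0 0 0 (-1) 0 := by
    rw [hl, hq, hr, upperFour_lie]; simp
  have hpqr : φ ⁅p, ⁅q, r⁆⁆ = upperFour 0 0 0 1 0 0 0 := by
    rw [hl, hp, hqr, upperFour_lie]; simp
  have hzero : upperFour (0 : k) 0 0 0 0 0 0 = 0 := by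
    ext i j
    fin_cases i <;> fin_cases j <;> rfl
  refine ⟨p, q, r, ?_, ?_, ?_, fun s t u hs => ?_, fun s t x y x' y' x'' y'' hs => ?_⟩
  · exact h0 ⁅p, r⁆ (by rw [hl, hp, hr, upperFour_lie]; simp [hzero])
  · exact h0 ⁅p, ⁅p, q⁆⁆ (by rw [hl, hp, hpq, upperFour_lie]; simp [hzero])
  · exact h0 ⁅r, ⁅r, q⁆⁆ (by rw [hl, hr, hrq, upperFour_lie]; simp [hzero])
  · have h1 : φ (s • ⁅p, q⁆ + t • ⁅q, r⁆ + u • ⁅p, ⁅q, r⁆⁆) = 0 :=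
      (congrArg φ hs).trans (map_zero φ)
    rw [map_add, map_add, map_smul, map_smul, map_smul, hpq, hqr, hpqr, upperFour_smul,
      upperFour_smul, upperFour_smul, upperFour_add, upperFour_add] at h1
    have e1 := congrFun (congrFun h1 0) 2
    have e2 := congrFun (congrFun h1 1) 3
    have e3 := congrFun (congrFun h1 0) 3
    simp [upperFour] at e1 e2 e3
    exact ⟨e1, e2, e3⟩
  · have key : ∀ x y x' y' x'' y'' : Alg c, s • p + t • r = ⁅x, y⁆ + ⁅x', y'⁆ + ⁅x'', y''⁆ →
        s = 0 ∧ t = 0 := by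
      intro x y x' y' x'' y'' hs
      have h1 := congrArg φ hs
      obtain ⟨a1, -, b1, -⟩ := lie_apply_four hφ x y
      obtain ⟨a2, -, b2, -⟩ := lie_apply_four hφ x' y'
      obtain ⟨a3, -, b3, -⟩ := lie_apply_four hφ x'' y''
      rw [map_add, map_add, map_add, map_smul, map_smul, hp, hr, upperFour_smul, upperFour_smul,
        upperFour_add] at h1
      have e1 := congrFun (congrFun h1 0) 1
      have e2 := congrFun (congrFun h1 2) 3
      rw [Matrix.add_apply, Matrix.add_apply, a1, a2, a3] at e1
      rw [Matrix.add_apply, Matrix.add_apply, b1, b2, b3] at e2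
      simp [upperFour] at e1 e2
      exact ⟨e1, e2⟩
    exact key x y x' y' x'' y'' hs

theorem exists_ne_zero_of_five (F : Fin 5 → Alg c →ₗ[k] k) :
    ∃ y : Alg c, y ≠ 0 ∧ ∀ i, F i y = 0 := by
  have h : LinearMap.ker (LinearMap.pi F) ≠ ⊥ :=
    LinearMap.ker_ne_bot_of_finrank_lt (by rw [finrank_alg, finrank_fin_fun]; norm_num)
  obtain ⟨y, hy, hy0⟩ := (Submodule.ne_bot_iff _).1 h
  exact ⟨y, hy0, fun i => congrFun hy i⟩

/-- If all elements whose first two coordinates vanish are central, the algebra does not act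
faithfully on `k^4` as above. For such an element `x` the equations `⁅x, y⁆ = 0` force the
superdiagonal of `φ x` to vanish, because no two independent linear conditions hold for all `φ y`.
What is left are enough `x` to make two superdiagonal entries of all `φ y` vanish. -/
theorem not_hasScalarUpperRep_four_of_central
    (hc : ∀ x y : Fin 6 → k, x 0 = 0 → x 1 = 0 → bracket c x y = 0) : ¬ HasScalarUpperRep c 4 := by
  rintro ⟨φ, τ, hφ, hτ, h0⟩
  let E (i j : Fin 4) : Alg c →ₗ[k] k :=
    (Matrix.entryLinearMap k k i j).comp (φ : Alg c →ₗ[k] Matrix (Fin 4) (Fin 4) k)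
  let X (i : Fin 6) : Alg c →ₗ[k] k := (LinearMap.proj i : (Fin 6 → k) →ₗ[k] k)
  have hrel : ∀ x y : Alg c, X 0 x = 0 → X 1 x = 0 →
      φ x 0 1 * φ y 1 2 - φ y 0 1 * φ x 1 2 = 0 ∧ φ x 1 2 * φ y 2 3 - φ y 1 2 * φ x 2 3 = 0 ∧
      φ x 0 1 * φ y 1 3 - φ y 0 1 * φ x 1 3 + (φ x 0 2 * φ y 2 3 - φ y 0 2 * φ x 2 3) = 0 := by
    intro x y h1 h2
    obtain ⟨-, -, -, a, b, d⟩ := lie_apply_four hφ x y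
    rw [show ⁅x, y⁆ = 0 from hc x y h1 h2, map_zero] at a b d
    exact ⟨a.symm, b.symm, d.symm⟩
  have h12 : ∀ x : Alg c, X 0 x = 0 → X 1 x = 0 → φ x 1 2 = 0 := by
    intro x h1 h2
    by_contra hne
    obtain ⟨y, hy, hF⟩ := exists_ne_zero_of_five ![E 1 2, E 0 2, E 1 3, E 0 3, τ]
    have y12 : φ y 1 2 = 0 := hF 0
    obtain ⟨r1, r2, -⟩ := hrel x y h1 h2
    rw [y12] at r1 r2
    have y01 : φ y 0 1 = 0 := by simpa [hne] using r1
    have y23 : φ y 2 3 = 0 := by simpa [hne] using r2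
    exact hy (h0 y ((hφ y).ext_four y01 (hF 1) (hF 3) y12 (hF 2) y23) (hF 4))
  have h01 : ∀ x : Alg c, X 0 x = 0 → X 1 x = 0 → φ x 0 1 = 0 := by
    intro x h1 h2
    by_contra hne
    obtain ⟨y, hy, hF⟩ := exists_ne_zero_of_five ![E 0 1, E 2 3, E 0 2, E 0 3, τ]
    obtain ⟨r1, -, r3⟩ := hrel x y h1 h2
    rw [h12 x h1 h2] at r1
    have y12 : φ y 1 2 = 0 := by simpa [hne] using r1
    rw [show φ y 0 1 = 0 from hF 0, show φ y 2 3 = 0 from hF 1, show φ y 0 2 = 0 from hF 2] at r3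
    have y13 : φ y 1 3 = 0 := by simpa [hne] using r3
    exact hy (h0 y ((hφ y).ext_four (hF 0) (hF 2) (hF 3) y12 y13 (hF 1)) (hF 4))
  have h23 : ∀ x : Alg c, X 0 x = 0 → X 1 x = 0 → φ x 2 3 = 0 := by
    intro x h1 h2
    by_contra hne
    obtain ⟨y, hy, hF⟩ := exists_ne_zero_of_five ![E 0 1, E 2 3, E 1 3, E 0 3, τ]
    obtain ⟨-, r2, r3⟩ := hrel x y h1 h2
    rw [h12 x h1 h2] at r2
    have y12 : φ y 1 2 = 0 := by simpa [hne] using r2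
    rw [show φ y 0 1 = 0 from hF 0, show φ y 2 3 = 0 from hF 1, show φ y 1 3 = 0 from hF 2] at r3
    have y02 : φ y 0 2 = 0 := by simpa [hne] using r3
    exact hy (h0 y ((hφ y).ext_four (hF 0) y02 (hF 3) y12 (hF 2) (hF 1)) (hF 4))
  -- On the central elements at hand only the entries `02`, `13`, `03` and `τ` are left.
  have hsurj : Function.Surjective (LinearMap.pi ![X 0, X 1, E 0 2, E 1 3, E 0 3, τ]) := by
    refine (LinearMap.injective_iff_surjective_of_finrank_eq_finrank
      (by rw [finrank_alg, finrank_fin_fun])).1 ((injective_iff_map_eq_zero _).2 fun x hx => ?_)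
    have x0 : X 0 x = 0 := congrFun hx 0
    have x1 : X 1 x = 0 := congrFun hx 1
    exact h0 x ((hφ x).ext_four (h01 x x0 x1) (congrFun hx 2) (congrFun hx 4) (h12 x x0 x1)
      (congrFun hx 3) (h23 x x0 x1)) (congrFun hx 5)
  obtain ⟨x, hx⟩ := hsurj ![0, 0, 1, 0, 0, 0]
  obtain ⟨x', hx'⟩ := hsurj ![0, 0, 0, 1, 0, 0]
  obtain ⟨y, hy, hF⟩ := exists_ne_zero_of_five ![E 1 2, E 0 2, E 1 3, E 0 3, τ]
  have y23 : φ y 2 3 = 0 := by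
    have x0 : X 0 x = 0 := congrFun hx 0
    have x1 : X 1 x = 0 := congrFun hx 1
    obtain ⟨-, -, r⟩ := hrel x y x0 x1
    rw [h01 x x0 x1, h23 x x0 x1, show φ x 0 2 = 1 from congrFun hx 2,
      show φ x 1 3 = 0 from congrFun hx 3] at r
    simpa using r
  have y01 : φ y 0 1 = 0 := by
    have x0 : X 0 x' = 0 := congrFun hx' 0
    have x1 : X 1 x' = 0 := congrFun hx' 1
    obtain ⟨-, -, r⟩ := hrel x' y x0 x1
    rw [h01 x' x0 x1, h23 x' x0 x1, show φ x' 0 2 = 0 from congrFun hx' 2,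
      show φ x' 1 3 = 1 from congrFun hx' 3] at r
    simpa using r
  exact hy (h0 y ((hφ y).ext_four y01 (hF 1) (hF 3) (hF 0) (hF 2) y23) (hF 4))

end SizeFour

end NilSix

namespace NilSix
variable {k : Type u}
attribute [local instance] LieRing.ofAssociativeRing

open Module

/-! ### Matrices of size five -/

section SizeFive

variable [Field k]

theorem IsUpper.eq_upperFive {A : Matrix (Fin 5) (Fin 5) k} (hA : IsUpper 1 A) :
    A = upperFive 0 (A 0 1) (A 0 2) (A 0 3) (A 0 4) (A 1 2) (A 1 3) (A 1 4) (A 2 3) (A 2 4)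
      (A 3 4) := by
  ext i j
  fin_cases i <;> fin_cases j <;> first | rfl | exact hA.apply_eq_zero _ _ (by decide)

theorem IsUpper.ext_three_five {A : Matrix (Fin 5) (Fin 5) k} (hA : IsUpper 3 A)
    (h03 : A 0 3 = 0) (h14 : A 1 4 = 0) (h04 : A 0 4 = 0) : A = 0 := by
  ext i j
  fin_cases i <;> fin_cases j <;> first | assumption | exact hA _ _ (by decide)

/-- The entries of the commutator of two strictly upper triangular `5 × 5` matrices. -/
theorem IsUpper.lie_apply_five {X Y : Matrix (Fin 5) (Fin 5) k} (hX : IsUpper 1 X)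
    (hY : IsUpper 1 Y) :
    (⁅X, Y⁆ 0 1 = 0 ∧ ⁅X, Y⁆ 1 2 = 0 ∧ ⁅X, Y⁆ 2 3 = 0 ∧ ⁅X, Y⁆ 3 4 = 0) ∧
    ⁅X, Y⁆ 0 2 = X 0 1 * Y 1 2 - Y 0 1 * X 1 2 ∧
    ⁅X, Y⁆ 1 3 = X 1 2 * Y 2 3 - Y 1 2 * X 2 3 ∧
    ⁅X, Y⁆ 2 4 = X 2 3 * Y 3 4 - Y 2 3 * X 3 4 ∧
    ⁅X, Y⁆ 0 3 = X 0 1 * Y 1 3 - Y 0 1 * X 1 3 + (X 0 2 * Y 2 3 - Y 0 2 * X 2 3) ∧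
    ⁅X, Y⁆ 1 4 = X 1 2 * Y 2 4 - Y 1 2 * X 2 4 + (X 1 3 * Y 3 4 - Y 1 3 * X 3 4) ∧
    ⁅X, Y⁆ 0 4 = X 0 1 * Y 1 4 - Y 0 1 * X 1 4 +
      (X 0 2 * Y 2 4 - Y 0 2 * X 2 4 + (X 0 3 * Y 3 4 - Y 0 3 * X 3 4)) := by
  have h : ⁅X, Y⁆ = X * Y - Y * X := Ring.lie_def X Y
  rw [hX.eq_upperFive, hY.eq_upperFive, upperFive_lie, ← hX.eq_upperFive, ← hY.eq_upperFive] at h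
  exact ⟨⟨congrFun (congrFun h 0) 1, congrFun (congrFun h 1) 2, congrFun (congrFun h 2) 3,
    congrFun (congrFun h 3) 4⟩, congrFun (congrFun h 0) 2, congrFun (congrFun h 1) 3,
    congrFun (congrFun h 2) 4, congrFun (congrFun h 0) 3, congrFun (congrFun h 1) 4,
    congrFun (congrFun h 0) 4⟩

/-- The entries of `⁅U, ⁅X, Y⁆⁆` for strictly upper triangular `5 × 5` matrices. -/
theorem lie_lie_apply_five {X Y U : Matrix (Fin 5) (Fin 5) k} (hX : IsUpper 1 X)
    (hY : IsUpper 1 Y) (hU : IsUpper 1 U) :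
    ⁅U, ⁅X, Y⁆⁆ 0 3 = U 0 1 * (X 1 2 * Y 2 3 - Y 1 2 * X 2 3) -
      (X 0 1 * Y 1 2 - Y 0 1 * X 1 2) * U 2 3 ∧
    ⁅U, ⁅X, Y⁆⁆ 1 4 = U 1 2 * (X 2 3 * Y 3 4 - Y 2 3 * X 3 4) -
      (X 1 2 * Y 2 3 - Y 1 2 * X 2 3) * U 3 4 ∧
    ⁅U, ⁅X, Y⁆⁆ 0 4 = U 0 1 * (X 1 2 * Y 2 4 - Y 1 2 * X 2 4 + (X 1 3 * Y 3 4 - Y 1 3 * X 3 4)) +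
      (U 0 2 * (X 2 3 * Y 3 4 - Y 2 3 * X 3 4) - (X 0 1 * Y 1 2 - Y 0 1 * X 1 2) * U 2 4) -
      (X 0 1 * Y 1 3 - Y 0 1 * X 1 3 + (X 0 2 * Y 2 3 - Y 0 2 * X 2 3)) * U 3 4 := by
  obtain ⟨⟨w01, w12, w23, w34⟩, w02, w13, w24, w03, w14, -⟩ := hX.lie_apply_five hY
  have hW : IsUpper 1 ⁅X, Y⁆ := (hX.lie hY).mono (by norm_num)
  obtain ⟨-, -, -, -, z03, z14, z04⟩ := hU.lie_apply_five hW
  refine ⟨?_, ?_, ?_⟩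
  · rw [z03, w01, w02, w13, w23]; ring
  · rw [z14, w12, w13, w24, w34]; ring
  · rw [z04, w01, w02, w03, w14, w24, w34]; ring

/-- Let `X`, `Y`, `A` be strictly upper triangular, commuting with the threefold brackets
`Z₁ = ⁅X, ⁅X, Y⁆⁆` and `Z₂ = ⁅Y, ⁅X, Y⁆⁆`. Suppose that `Z₁` and `Z₂` are linearly independent and
that their entries `03` are not both zero. Then the entries `14` of `Z₁`, `Z₂` are the multiple by a
common `e` of the entries `03`, and the entries `34` of `X`, `Y` are the multiple by the same `e` of
the entries `01`. If `⁅X, A⁆` and `⁅Y, A⁆` have entries in the places of threefold brackets only,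
`A` vanishes on the superdiagonal. -/
theorem exists_ratio [CharZero k] {X Y A : Matrix (Fin 5) (Fin 5) k}
    (hX : IsUpper 1 X) (hY : IsUpper 1 Y) (hA : IsUpper 1 A)
    (hX1 : ⁅X, ⁅X, ⁅X, Y⁆⁆⁆ = 0) (hX2 : ⁅X, ⁅Y, ⁅X, Y⁆⁆⁆ = 0)
    (hY1 : ⁅Y, ⁅X, ⁅X, Y⁆⁆⁆ = 0) (hY2 : ⁅Y, ⁅Y, ⁅X, Y⁆⁆⁆ = 0)
    (hA1 : ⁅A, ⁅X, ⁅X, Y⁆⁆⁆ = 0) (hA2 : ⁅A, ⁅Y, ⁅X, Y⁆⁆⁆ = 0)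
    (hind : ∀ s t : k, s • ⁅X, ⁅X, Y⁆⁆ + t • ⁅Y, ⁅X, Y⁆⁆ = 0 → s = 0 ∧ t = 0)
    (hXA : IsUpper 3 ⁅X, A⁆) (hYA : IsUpper 3 ⁅Y, A⁆)
    (h03 : ¬(⁅X, ⁅X, Y⁆⁆ 0 3 = 0 ∧ ⁅Y, ⁅X, Y⁆⁆ 0 3 = 0)) :
    ∃ e : k, ⁅X, ⁅X, Y⁆⁆ 1 4 = e * ⁅X, ⁅X, Y⁆⁆ 0 3 ∧ ⁅Y, ⁅X, Y⁆⁆ 1 4 = e * ⁅Y, ⁅X, Y⁆⁆ 0 3 ∧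
      X 3 4 = e * X 0 1 ∧ Y 3 4 = e * Y 0 1 ∧ X 0 1 * Y 1 2 - Y 0 1 * X 1 2 ≠ 0 ∧
      (e ≠ 0 → X 0 1 * (X 1 2 * Y 2 3 - Y 1 2 * X 2 3) = 0 ∧
        Y 0 1 * (X 1 2 * Y 2 3 - Y 1 2 * X 2 3) = 0) ∧
      A 0 1 = 0 ∧ A 1 2 = 0 ∧ A 2 3 = 0 ∧ A 3 4 = 0 := by
  have hZ : ∀ U, IsUpper 1 U → IsUpper 3 ⁅U, ⁅X, Y⁆⁆ := fun U hU => hU.lie (hX.lie hY)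
  have hcen : ∀ T U : Matrix (Fin 5) (Fin 5) k, IsUpper 1 T → IsUpper 1 U → ⁅T, ⁅U, ⁅X, Y⁆⁆⁆ = 0 →
      T 0 1 * ⁅U, ⁅X, Y⁆⁆ 1 4 = ⁅U, ⁅X, Y⁆⁆ 0 3 * T 3 4 := by
    intro T U hT hU h
    have hu := hZ U hU
    obtain ⟨-, -, -, -, -, -, h04⟩ := hT.lie_apply_five (hu.mono (by norm_num))
    rw [h, hu 0 1 (by decide), hu 0 2 (by decide), hu 2 4 (by decide), hu 3 4 (by decide),
      Matrix.zero_apply] at h04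
    linear_combination -h04
  have x1 := hcen X X hX hX hX1
  have x2 := hcen X Y hX hY hX2
  have y1 := hcen Y X hY hX hY1
  have y2 := hcen Y Y hY hY hY2
  have a1 := hcen A X hA hX hA1
  have a2 := hcen A Y hA hY hA2
  obtain ⟨α1, β1, γ1⟩ := lie_lie_apply_five hX hY hX
  obtain ⟨α2, β2, γ2⟩ := lie_lie_apply_five hX hY hY
  -- The two pairs of entries `03` and `14` are proportional: otherwise the entries `01` of `X` and
  -- `Y` vanish, and then so do the entries `03`.
  have hdet : ⁅X, ⁅X, Y⁆⁆ 0 3 * ⁅Y, ⁅X, Y⁆⁆ 1 4 = ⁅Y, ⁅X, Y⁆⁆ 0 3 * ⁅X, ⁅X, Y⁆⁆ 1 4 := by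
    by_contra hne
    have hne' := sub_ne_zero.2 hne
    have hx : X 0 1 = 0 := (mul_eq_zero.1 (show (⁅X, ⁅X, Y⁆⁆ 0 3 * ⁅Y, ⁅X, Y⁆⁆ 1 4 -
      ⁅Y, ⁅X, Y⁆⁆ 0 3 * ⁅X, ⁅X, Y⁆⁆ 1 4) * X 0 1 = 0 by
        linear_combination ⁅X, ⁅X, Y⁆⁆ 0 3 * x2 - ⁅Y, ⁅X, Y⁆⁆ 0 3 * x1)).resolve_left hne'
    have hy : Y 0 1 = 0 := (mul_eq_zero.1 (show (⁅X, ⁅X, Y⁆⁆ 0 3 * ⁅Y, ⁅X, Y⁆⁆ 1 4 -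
      ⁅Y, ⁅X, Y⁆⁆ 0 3 * ⁅X, ⁅X, Y⁆⁆ 1 4) * Y 0 1 = 0 by
        linear_combination ⁅X, ⁅X, Y⁆⁆ 0 3 * y2 - ⁅Y, ⁅X, Y⁆⁆ 0 3 * y1)).resolve_left hne'
    rw [hx, hy] at α1 α2
    exact h03 ⟨by rw [α1]; ring, by rw [α2]; ring⟩
  obtain ⟨e, he1, he2, hex, hey, hea⟩ : ∃ e : k, ⁅X, ⁅X, Y⁆⁆ 1 4 = e * ⁅X, ⁅X, Y⁆⁆ 0 3 ∧
      ⁅Y, ⁅X, Y⁆⁆ 1 4 = e * ⁅Y, ⁅X, Y⁆⁆ 0 3 ∧ X 3 4 = e * X 0 1 ∧ Y 3 4 = e * Y 0 1 ∧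
      A 3 4 = e * A 0 1 := by
    by_cases h1 : ⁅X, ⁅X, Y⁆⁆ 0 3 = 0
    · have h2 : ⁅Y, ⁅X, Y⁆⁆ 0 3 ≠ 0 := fun h2 => h03 ⟨h1, h2⟩
      have h3 : ⁅X, ⁅X, Y⁆⁆ 1 4 = 0 := by
        rw [h1, zero_mul] at hdet
        exact (mul_eq_zero.1 hdet.symm).resolve_left h2
      refine ⟨⁅Y, ⁅X, Y⁆⁆ 1 4 / ⁅Y, ⁅X, Y⁆⁆ 0 3, by rw [h1, h3, mul_zero], by field_simp,
        ?_, ?_, ?_⟩ <;> field_simp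
      · linear_combination -x2
      · linear_combination -y2
      · linear_combination -a2
    · refine ⟨⁅X, ⁅X, Y⁆⁆ 1 4 / ⁅X, ⁅X, Y⁆⁆ 0 3, by field_simp, ?_, ?_, ?_, ?_⟩ <;> field_simp
      · linear_combination hdet
      · linear_combination -x1
      · linear_combination -y1
      · linear_combination -a1
  have h13 : e ≠ 0 → X 0 1 * (X 1 2 * Y 2 3 - Y 1 2 * X 2 3) = 0 ∧
      Y 0 1 * (X 1 2 * Y 2 3 - Y 1 2 * X 2 3) = 0 := by
    intro he
    rw [β1, α1, hex, hey] at he1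
    rw [β2, α2, hex, hey] at he2
    have h3 : (-3 * e : k) ≠ 0 := mul_ne_zero (by norm_num) he
    exact ⟨(mul_eq_zero.1 (show (-3 * e) * (X 0 1 * (X 1 2 * Y 2 3 - Y 1 2 * X 2 3)) = 0 by
      linear_combination he1)).resolve_left h3,
      (mul_eq_zero.1 (show (-3 * e) * (Y 0 1 * (X 1 2 * Y 2 3 - Y 1 2 * X 2 3)) = 0 by
      linear_combination he2)).resolve_left h3⟩
  have hm : X 0 1 * Y 1 2 - Y 0 1 * X 1 2 ≠ 0 := by
    intro hm
    rw [hm] at α1 α2 γ1 γ2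
    rcases eq_or_ne e 0 with he | he
    swap
    · exact h03 ⟨by rw [α1, (h13 he).1]; ring, by rw [α2, (h13 he).2]; ring⟩
    -- Now `Y₀₁ Z₁ = X₀₁ Z₂`.
    have h := hind (Y 0 1) (-X 0 1) (by
      refine IsUpper.ext_three_five (fun i j hij => ?_) ?_ ?_ ?_ <;>
        rw [Matrix.add_apply, Matrix.smul_apply, Matrix.smul_apply, smul_eq_mul, smul_eq_mul]
      · rw [hZ X hX i j hij, hZ Y hY i j hij]; ring
      · rw [α1, α2]; ring
      · rw [he1, he2, α1, α2]; ring
      · rw [γ1, γ2, hex, hey, he]; ring)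
    rw [h.1] at α2
    rw [neg_eq_zero.1 h.2] at α1
    exact h03 ⟨by rw [α1]; ring, by rw [α2]; ring⟩
  obtain ⟨-, x02, x13, -⟩ := hX.lie_apply_five hA
  obtain ⟨-, y02, y13, -⟩ := hY.lie_apply_five hA
  rw [hXA 0 2 (by decide)] at x02
  rw [hXA 1 3 (by decide)] at x13
  rw [hYA 0 2 (by decide)] at y02
  rw [hYA 1 3 (by decide)] at y13
  have hA01 : A 0 1 = 0 := (mul_eq_zero.1 (show (X 0 1 * Y 1 2 - Y 0 1 * X 1 2) * A 0 1 = 0 by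
    linear_combination X 0 1 * y02 - Y 0 1 * x02)).resolve_left hm
  have hA12 : A 1 2 = 0 := (mul_eq_zero.1 (show (X 0 1 * Y 1 2 - Y 0 1 * X 1 2) * A 1 2 = 0 by
    linear_combination X 1 2 * y02 - Y 1 2 * x02)).resolve_left hm
  rw [hA12] at x13 y13
  have hA23 : A 2 3 = 0 := (mul_eq_zero.1 (show (X 0 1 * Y 1 2 - Y 0 1 * X 1 2) * A 2 3 = 0 by
    linear_combination Y 0 1 * x13 - X 0 1 * y13)).resolve_left hm
  exact ⟨e, he1, he2, hex, hey, hm, h13, hA01, hA12, hA23, by rw [hea, hA01, mul_zero]⟩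

/-- Two independent matrices `Z`, `Z'` whose entries `14` are the multiple by a common `e` of the
entries `03` are told apart by the entries `03` and `04`. -/
theorem det_ne_zero {Z Z' : Matrix (Fin 5) (Fin 5) k} (hZ : IsUpper 3 Z) (hZ' : IsUpper 3 Z')
    (hind : ∀ s t : k, s • Z + t • Z' = 0 → s = 0 ∧ t = 0) {e : k}
    (he : Z 1 4 = e * Z 0 3) (he' : Z' 1 4 = e * Z' 0 3) (h03 : ¬(Z 0 3 = 0 ∧ Z' 0 3 = 0)) :
    Z 0 3 * Z' 0 4 - Z' 0 3 * Z 0 4 ≠ 0 := by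
  intro hd
  have h := hind (Z' 0 3) (-Z 0 3) (by
    refine IsUpper.ext_three_five (fun i j hij => ?_) ?_ ?_ ?_ <;>
      rw [Matrix.add_apply, Matrix.smul_apply, Matrix.smul_apply, smul_eq_mul, smul_eq_mul]
    · rw [hZ i j hij, hZ' i j hij]; ring
    · ring
    · rw [he, he']; ring
    · linear_combination -hd)
  exact h03 ⟨neg_eq_zero.1 h.2, h.1⟩

/-- In the situation of `exists_ratio`, a matrix `A` that commutes with `X` and `Y` is a linear
combination of `Z₁` and `Z₂`. -/
theorem not_independent_of_commute [CharZero k] {X Y A : Matrix (Fin 5) (Fin 5) k}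
    (hX : IsUpper 1 X) (hY : IsUpper 1 Y) (hA : IsUpper 1 A)
    (hX1 : ⁅X, ⁅X, ⁅X, Y⁆⁆⁆ = 0) (hX2 : ⁅X, ⁅Y, ⁅X, Y⁆⁆⁆ = 0)
    (hY1 : ⁅Y, ⁅X, ⁅X, Y⁆⁆⁆ = 0) (hY2 : ⁅Y, ⁅Y, ⁅X, Y⁆⁆⁆ = 0)
    (hA1 : ⁅A, ⁅X, ⁅X, Y⁆⁆⁆ = 0) (hA2 : ⁅A, ⁅Y, ⁅X, Y⁆⁆⁆ = 0)
    (hind : ∀ s t u : k, s • ⁅X, ⁅X, Y⁆⁆ + t • ⁅Y, ⁅X, Y⁆⁆ + u • A = 0 → s = 0 ∧ t = 0 ∧ u = 0)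
    (hXA : ⁅X, A⁆ = 0) (hYA : ⁅Y, A⁆ = 0)
    (h03 : ¬(⁅X, ⁅X, Y⁆⁆ 0 3 = 0 ∧ ⁅Y, ⁅X, Y⁆⁆ 0 3 = 0)) : False := by
  have hind' : ∀ s t : k, s • ⁅X, ⁅X, Y⁆⁆ + t • ⁅Y, ⁅X, Y⁆⁆ = 0 → s = 0 ∧ t = 0 := fun s t h => by
    have := hind s t 0 (by rw [h, zero_smul, add_zero])
    exact ⟨this.1, this.2.1⟩
  have h0 : IsUpper 3 (0 : Matrix (Fin 5) (Fin 5) k) := fun _ _ _ => rfl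
  obtain ⟨e, he1, he2, hex, hey, hm, h13, hA01, hA12, hA23, hA34⟩ :=
    exists_ratio hX hY hA hX1 hX2 hY1 hY2 hA1 hA2 hind' (hXA ▸ h0) (hYA ▸ h0) h03
  have hZ : ∀ U, IsUpper 1 U → IsUpper 3 ⁅U, ⁅X, Y⁆⁆ := fun U hU => hU.lie (hX.lie hY)
  have hd := det_ne_zero (hZ X hX) (hZ Y hY) hind' he1 he2 h03
  obtain ⟨α1, -, γ1⟩ := lie_lie_apply_five hX hY hX
  obtain ⟨α2, -, γ2⟩ := lie_lie_apply_five hX hY hY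
  obtain ⟨-, -, -, -, x03, x14, x04⟩ := hX.lie_apply_five hA
  obtain ⟨-, -, -, -, y03, y14, y04⟩ := hY.lie_apply_five hA
  rw [hXA, Matrix.zero_apply, hA01, hA23] at x03
  rw [hXA, Matrix.zero_apply, hA12, hA34, hex] at x14
  rw [hXA, Matrix.zero_apply, hA01, hA34, hex] at x04
  rw [hYA, Matrix.zero_apply, hA01, hA23] at y03
  rw [hYA, Matrix.zero_apply, hA12, hA34, hey] at y14
  rw [hYA, Matrix.zero_apply, hA01, hA34, hey] at y04
  rw [hex, hey] at γ1 γ2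
  -- The rows `(X₀₁, Y₀₁)` and `(X₁₂, Y₁₂)` are independent; in particular neither is zero.
  have cancel : ∀ a : k, X 0 1 * a = 0 → Y 0 1 * a = 0 → a = 0 := fun a h h' =>
    (mul_eq_zero.1 (show (X 0 1 * Y 1 2 - Y 0 1 * X 1 2) * a = 0 by
      linear_combination Y 1 2 * h - X 1 2 * h')).resolve_left hm
  have cancel' : ∀ a : k, X 1 2 * a = 0 → Y 1 2 * a = 0 → a = 0 := fun a h h' =>
    (mul_eq_zero.1 (show (X 0 1 * Y 1 2 - Y 0 1 * X 1 2) * a = 0 by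
      linear_combination X 0 1 * h' - Y 0 1 * h)).resolve_left hm
  have hA02 : A 0 2 = 0 ∧ A 1 3 = 0 := by
    by_cases he : e = 0
    · subst he
      have h24 : A 2 4 = 0 := cancel' _ (by linear_combination -x14) (by linear_combination -y14)
      rw [h24] at x04 y04
      have h02 : A 0 2 = 0 := by
        by_contra hne
        have h1 : X 0 1 * Y 2 3 - Y 0 1 * X 2 3 = 0 := (mul_eq_zero.1 (show A 0 2 *
          (X 0 1 * Y 2 3 - Y 0 1 * X 2 3) = 0 by
            linear_combination X 0 1 * y03 - Y 0 1 * x03)).resolve_left hne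
        have h2 : X 0 1 * Y 2 4 - Y 0 1 * X 2 4 = 0 := (mul_eq_zero.1 (show A 0 2 *
          (X 0 1 * Y 2 4 - Y 0 1 * X 2 4) = 0 by
            linear_combination X 0 1 * y04 - Y 0 1 * x04)).resolve_left hne
        have h3 : X 2 3 * Y 2 4 - Y 2 3 * X 2 4 = 0 :=
          cancel _ (by linear_combination X 2 3 * h2 - X 2 4 * h1)
            (by linear_combination Y 2 3 * h2 - Y 2 4 * h1)
        apply hd
        rw [α1, α2, γ1, γ2]
        linear_combination 2 * (X 0 1 * Y 1 2 - Y 0 1 * X 1 2) ^ 2 * h3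
      rw [h02] at x03 y03
      exact ⟨h02, cancel _ (by linear_combination -x03) (by linear_combination -y03)⟩
    · have h23 := cancel _ (h13 he).1 (h13 he).2
      have hne : X 0 1 * Y 2 3 - Y 0 1 * X 2 3 ≠ 0 := by
        intro h
        have hx : X 2 3 = 0 := (mul_eq_zero.1 (show (X 0 1 * Y 1 2 - Y 0 1 * X 1 2) * X 2 3 = 0 by
          linear_combination X 1 2 * h - X 0 1 * h23)).resolve_left hm
        have hy : Y 2 3 = 0 := (mul_eq_zero.1 (show (X 0 1 * Y 1 2 - Y 0 1 * X 1 2) * Y 2 3 = 0 by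
          linear_combination Y 1 2 * h - Y 0 1 * h23)).resolve_left hm
        exact h03 ⟨by rw [α1, hx, hy]; ring, by rw [α2, hx, hy]; ring⟩
      exact ⟨(mul_eq_zero.1 (show (X 0 1 * Y 2 3 - Y 0 1 * X 2 3) * A 0 2 = 0 by
        linear_combination X 0 1 * y03 - Y 0 1 * x03)).resolve_left hne,
        (mul_eq_zero.1 (show (X 0 1 * Y 2 3 - Y 0 1 * X 2 3) * A 1 3 = 0 by
        linear_combination Y 2 3 * -x03 + X 2 3 * y03)).resolve_left hne⟩
  rw [hA02.2] at x14 y14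
  have hA24 : A 2 4 = 0 := cancel' _ (by linear_combination -x14) (by linear_combination -y14)
  rw [hA02.1, hA24] at x04 y04
  have hA14 : A 1 4 - e * A 0 3 = 0 :=
    cancel _ (by linear_combination -x04) (by linear_combination -y04)
  -- In the entries `03` and `04`, the three matrices are dependent by Cramer's rule.
  refine hd (hind (-(A 0 3 * ⁅Y, ⁅X, Y⁆⁆ 0 4 - A 0 4 * ⁅Y, ⁅X, Y⁆⁆ 0 3))
    (-(⁅X, ⁅X, Y⁆⁆ 0 3 * A 0 4 - ⁅X, ⁅X, Y⁆⁆ 0 4 * A 0 3))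
    (⁅X, ⁅X, Y⁆⁆ 0 3 * ⁅Y, ⁅X, Y⁆⁆ 0 4 - ⁅Y, ⁅X, Y⁆⁆ 0 3 * ⁅X, ⁅X, Y⁆⁆ 0 4) ?_).2.2
  have hA3 : IsUpper 3 A := by
    intro i j hij
    fin_cases i <;> fin_cases j <;>
      first
        | assumption | exact hA02.1 | exact hA02.2 | exact hA.apply_eq_zero _ _ (by decide)
        | simp at hij
  refine IsUpper.ext_three_five (fun i j hij => ?_) ?_ ?_ ?_ <;>
    rw [Matrix.add_apply, Matrix.add_apply, Matrix.smul_apply, Matrix.smul_apply,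
      Matrix.smul_apply, smul_eq_mul, smul_eq_mul, smul_eq_mul]
  · rw [hZ X hX i j hij, hZ Y hY i j hij, hA3 i j hij]; ring
  · ring
  · rw [he1, he2, sub_eq_zero.1 hA14]; ring
  · ring

/-- `T` is an eigenvalue of `!![0, K * ε; K, 0]` with eigenvector `(a, b)`. -/
theorem exists_sq_eq {K T a b ε : k} (hK : K ≠ 0) (h : ¬(a = 0 ∧ b = 0)) (ha : T * a = K * ε * b)
    (hb : T * b = K * a) : ∃ t : k, t ^ 2 = ε := by
  have hb0 : b ≠ 0 := by
    rintro rfl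
    rw [mul_zero] at hb
    exact h ⟨(mul_eq_zero.1 hb.symm).resolve_left hK, rfl⟩
  refine ⟨T / K, ?_⟩
  rw [div_pow, div_eq_iff (pow_ne_zero 2 hK)]
  exact mul_right_cancel₀ hb0 (by linear_combination T * hb + K * ha)

/-- In the situation of `exists_ratio`, if `⁅X, A⁆ = ε Z₂` and `⁅Y, A⁆ = Z₁`, then `ε` is a square.
In either case for `e` the equations say that a linear map of the plane with matrix
`!![0, K ε; K, 0]` has an eigenvector over `k`. -/
theorem exists_sq_eq_of_lie_eq [CharZero k] {X Y A : Matrix (Fin 5) (Fin 5) k} {ε : k}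
    (hX : IsUpper 1 X) (hY : IsUpper 1 Y) (hA : IsUpper 1 A)
    (hX1 : ⁅X, ⁅X, ⁅X, Y⁆⁆⁆ = 0) (hX2 : ⁅X, ⁅Y, ⁅X, Y⁆⁆⁆ = 0)
    (hY1 : ⁅Y, ⁅X, ⁅X, Y⁆⁆⁆ = 0) (hY2 : ⁅Y, ⁅Y, ⁅X, Y⁆⁆⁆ = 0)
    (hA1 : ⁅A, ⁅X, ⁅X, Y⁆⁆⁆ = 0) (hA2 : ⁅A, ⁅Y, ⁅X, Y⁆⁆⁆ = 0)
    (hind : ∀ s t : k, s • ⁅X, ⁅X, Y⁆⁆ + t • ⁅Y, ⁅X, Y⁆⁆ = 0 → s = 0 ∧ t = 0)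
    (hXA : ⁅X, A⁆ = ε • ⁅Y, ⁅X, Y⁆⁆) (hYA : ⁅Y, A⁆ = ⁅X, ⁅X, Y⁆⁆)
    (h03 : ¬(⁅X, ⁅X, Y⁆⁆ 0 3 = 0 ∧ ⁅Y, ⁅X, Y⁆⁆ 0 3 = 0)) : ∃ t : k, t ^ 2 = ε := by
  have hZ : ∀ U, IsUpper 1 U → IsUpper 3 ⁅U, ⁅X, Y⁆⁆ := fun U hU => hU.lie (hX.lie hY)
  have hXA3 : IsUpper 3 ⁅X, A⁆ := fun i j hij => by
    rw [hXA, Matrix.smul_apply, hZ Y hY i j hij, smul_zero]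
  obtain ⟨e, he1, he2, hex, hey, hm, h13, hA01, hA12, hA23, hA34⟩ :=
    exists_ratio hX hY hA hX1 hX2 hY1 hY2 hA1 hA2 hind hXA3 (hYA ▸ hZ X hX) h03
  have hd := det_ne_zero (hZ X hX) (hZ Y hY) hind he1 he2 h03
  obtain ⟨α1, -, γ1⟩ := lie_lie_apply_five hX hY hX
  obtain ⟨α2, -, γ2⟩ := lie_lie_apply_five hX hY hY
  obtain ⟨-, -, -, -, x03, x14, x04⟩ := hX.lie_apply_five hA
  obtain ⟨-, -, -, -, y03, y14, y04⟩ := hY.lie_apply_five hA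
  rw [hXA, Matrix.smul_apply, smul_eq_mul, hA01, hA23] at x03
  rw [hXA, Matrix.smul_apply, smul_eq_mul, hA12, hA34, hex, he2] at x14
  rw [hXA, Matrix.smul_apply, smul_eq_mul, hA01, hA34, hex] at x04
  rw [hYA, hA01, hA23] at y03
  rw [hYA, hA12, hA34, hey, he1] at y14
  rw [hYA, hA01, hA34, hey] at y04
  rw [hex, hey] at γ1 γ2
  have cancel : ∀ a : k, X 0 1 * a = 0 → Y 0 1 * a = 0 → a = 0 := fun a h h' =>
    (mul_eq_zero.1 (show (X 0 1 * Y 1 2 - Y 0 1 * X 1 2) * a = 0 by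
      linear_combination Y 1 2 * h - X 1 2 * h')).resolve_left hm
  have cancel' : ∀ a : k, X 1 2 * a = 0 → Y 1 2 * a = 0 → a = 0 := fun a h h' =>
    (mul_eq_zero.1 (show (X 0 1 * Y 1 2 - Y 0 1 * X 1 2) * a = 0 by
      linear_combination X 0 1 * h' - Y 0 1 * h)).resolve_left hm
  by_cases he : e = 0
  · subst he
    have h24 : A 2 4 = 0 := cancel' _ (by linear_combination -x14) (by linear_combination -y14)
    rw [h24, γ2] at x04
    rw [h24, γ1] at y04
    rw [α2] at x03
    rw [α1] at y03
    have hD : X 2 3 * Y 2 4 - Y 2 3 * X 2 4 ≠ 0 := by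
      intro h3
      apply hd
      rw [α1, α2, γ1, γ2]
      linear_combination 2 * (X 0 1 * Y 1 2 - Y 0 1 * X 1 2) ^ 2 * h3
    refine exists_sq_eq (K := -2 * (X 0 1 * Y 1 2 - Y 0 1 * X 1 2) *
      (X 2 3 * Y 2 4 - Y 2 3 * X 2 4)) (T := (X 0 1 * Y 2 4 - Y 0 1 * X 2 4) * A 1 3 +
      (X 2 3 * Y 0 1 - Y 2 3 * X 0 1) * A 1 4 - (X 2 3 * Y 2 4 - Y 2 3 * X 2 4) * A 0 2)
      (a := X 0 1) (b := Y 0 1) (mul_ne_zero (mul_ne_zero (by norm_num) hm) hD) ?_ ?_ ?_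
    · rintro ⟨h, h'⟩
      rw [h, h'] at hm
      exact hm (by ring)
    · linear_combination -(X 0 1 * Y 2 4 - Y 0 1 * X 2 4) * x03 -
        (X 2 3 * Y 0 1 - Y 2 3 * X 0 1) * x04
    · linear_combination -(X 0 1 * Y 2 4 - Y 0 1 * X 2 4) * y03 -
        (X 2 3 * Y 0 1 - Y 2 3 * X 0 1) * y04
  · have h23 := cancel _ (h13 he).1 (h13 he).2
    have hX23 : ∀ a b : k, a = 0 ∧ b = 0 → a = X 2 3 → b = Y 2 3 → False := by
      rintro a b ⟨rfl, rfl⟩ hx hy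
      exact h03 ⟨by rw [α1, ← hx, ← hy]; ring, by rw [α2, ← hx, ← hy]; ring⟩
    have hne : X 0 1 * Y 2 3 - Y 0 1 * X 2 3 ≠ 0 := by
      intro h
      have hx : X 2 3 = 0 := (mul_eq_zero.1 (show (X 0 1 * Y 1 2 - Y 0 1 * X 1 2) * X 2 3 = 0 by
        linear_combination X 1 2 * h - X 0 1 * h23)).resolve_left hm
      have hy : Y 2 3 = 0 := (mul_eq_zero.1 (show (X 0 1 * Y 1 2 - Y 0 1 * X 1 2) * Y 2 3 = 0 by
        linear_combination Y 1 2 * h - Y 0 1 * h23)).resolve_left hm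
      exact hX23 _ _ ⟨hx, hy⟩ rfl rfl
    rw [h23] at α1 α2
    rw [α2] at x03 x14
    rw [α1] at y03 y14
    refine exists_sq_eq (K := -2 * e * (X 0 1 * Y 1 2 - Y 0 1 * X 1 2) *
      (X 0 1 * Y 2 3 - Y 0 1 * X 2 3)) (T := (X 0 1 * Y 1 2 - Y 0 1 * X 1 2) * A 2 4 -
      e * (X 0 1 * Y 2 3 - Y 0 1 * X 2 3) * A 0 2)
      (a := X 2 3) (b := Y 2 3) (mul_ne_zero (mul_ne_zero (mul_ne_zero (by norm_num) he) hm) hne)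
      (fun h => hX23 _ _ h rfl rfl) ?_ ?_
    · linear_combination -(X 0 1 * Y 2 3 - Y 0 1 * X 2 3) * x14 -
        e * (X 0 1 * Y 2 3 - Y 0 1 * X 2 3) * x03 - X 0 1 * A 2 4 * h23
    · linear_combination -(X 0 1 * Y 2 3 - Y 0 1 * X 2 3) * y14 -
        e * (X 0 1 * Y 2 3 - Y 0 1 * X 2 3) * y03 - Y 0 1 * A 2 4 * h23

/-- Minus the reflection of a matrix in the antidiagonal. For a representation by strictly upper
triangular matrices this describes the dual representation in the reversed dual basis. -/
def negReflect {n : ℕ} : Matrix (Fin n) (Fin n) k →ₗ⁅k⁆ Matrix (Fin n) (Fin n) k where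
  toFun A := -(A.transpose.submatrix Fin.rev Fin.rev)
  map_add' A B := by ext i j; simp; ring
  map_smul' t A := by ext i j; simp
  map_lie' {A B} := by
    have h : ∀ A B : Matrix (Fin n) (Fin n) k, (A.transpose * B.transpose).submatrix Fin.rev Fin.rev
        = A.transpose.submatrix Fin.rev Fin.rev * B.transpose.submatrix Fin.rev Fin.rev :=
      fun A B => (Matrix.submatrix_mul_equiv A.transpose B.transpose Fin.rev Fin.revPerm
        Fin.rev).symm
    change -((⁅A, B⁆).transpose.submatrix Fin.rev Fin.rev) =
      ⁅-(A.transpose.submatrix Fin.rev Fin.rev), -(B.transpose.submatrix Fin.rev Fin.rev)⁆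
    rw [Ring.lie_def, Ring.lie_def, Matrix.transpose_sub, Matrix.transpose_mul,
      Matrix.transpose_mul, Matrix.submatrix_sub, Pi.sub_apply, Pi.sub_apply, h, h, neg_mul_neg,
      neg_mul_neg, neg_sub]

theorem negReflect_apply {n : ℕ} (A : Matrix (Fin n) (Fin n) k) (i j : Fin n) :
    negReflect A i j = -A j.rev i.rev := rfl

theorem IsUpper.negReflect {n m : ℕ} {A : Matrix (Fin n) (Fin n) k} (hA : IsUpper m A) :
    IsUpper m (negReflect A) := fun i j hij => by
  rw [negReflect_apply, hA _ _ (by rw [Fin.val_rev, Fin.val_rev]; omega), neg_zero]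

theorem negReflect_injective {n : ℕ} :
    Function.Injective (negReflect : Matrix (Fin n) (Fin n) k →ₗ⁅k⁆ _) := fun A B h => by
  ext i j
  have h1 := congrFun (congrFun h j.rev) i.rev
  rwa [negReflect_apply, negReflect_apply, Fin.rev_rev, Fin.rev_rev, neg_inj] at h1

/-- After passage to the dual representation if necessary, the condition on the entries `03` in
`exists_ratio` is satisfied. -/
theorem HasUpperRep.exists_apply_ne_zero {c : Name k} (h : HasUpperRep c 5) (x y : Alg c)
    (hind : ∀ s t : k, s • ⁅x, ⁅x, y⁆⁆ + t • ⁅y, ⁅x, y⁆⁆ = 0 → s = 0 ∧ t = 0) :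
    ∃ φ : Alg c →ₗ⁅k⁆ Matrix (Fin 5) (Fin 5) k, (∀ x, IsUpper 1 (φ x)) ∧ (∀ x, φ x = 0 → x = 0) ∧
      ¬(⁅φ x, ⁅φ x, φ y⁆⁆ 0 3 = 0 ∧ ⁅φ y, ⁅φ x, φ y⁆⁆ 0 3 = 0) := by
  obtain ⟨φ, hφ, h0⟩ := h
  by_cases h03 : ⁅φ x, ⁅φ x, φ y⁆⁆ 0 3 = 0 ∧ ⁅φ y, ⁅φ x, φ y⁆⁆ 0 3 = 0
  swap
  · exact ⟨φ, hφ, h0, h03⟩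
  refine ⟨negReflect.comp φ, fun x => (hφ x).negReflect, fun x hx => h0 x (negReflect_injective
    (hx.trans (map_zero _).symm)), ?_⟩
  simp only [LieHom.comp_apply, ← LieHom.map_lie, negReflect_apply, neg_eq_zero]
  simp only [LieHom.map_lie]
  rintro ⟨h14, h14'⟩
  have h14 : ⁅φ x, ⁅φ x, φ y⁆⁆ 1 4 = 0 := h14
  have h14' : ⁅φ y, ⁅φ x, φ y⁆⁆ 1 4 = 0 := h14'
  -- The two brackets lie on the line spanned by the elementary matrix `E₀₄`.
  have hu : ∀ z, IsUpper 3 ⁅φ z, ⁅φ x, φ y⁆⁆ := fun z => (hφ z).lie ((hφ x).lie (hφ y))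
  have h1 : ∀ s t : k, s * ⁅φ x, ⁅φ x, φ y⁆⁆ 0 4 + t * ⁅φ y, ⁅φ x, φ y⁆⁆ 0 4 = 0 →
      s = 0 ∧ t = 0 := by
    intro s t hst
    refine hind s t (h0 _ ?_)
    rw [map_add, map_smul, map_smul]
    simp only [LieHom.map_lie]
    refine IsUpper.ext_three_five (fun i j hij => ?_) ?_ ?_ ?_ <;>
      rw [Matrix.add_apply, Matrix.smul_apply, Matrix.smul_apply, smul_eq_mul, smul_eq_mul]
    · rw [hu x i j hij, hu y i j hij]; ring
    · rw [h03.1, h03.2]; ring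
    · rw [h14, h14']; ring
    · exact hst
  have h2 := h1 (⁅φ y, ⁅φ x, φ y⁆⁆ 0 4) (-⁅φ x, ⁅φ x, φ y⁆⁆ 0 4) (by ring)
  have h3 := h1 1 0 (by rw [neg_eq_zero.1 h2.2]; ring)
  exact one_ne_zero h3.1

/-- An algebra in which `⁅x, ⁅x, y⁆⁆`, `⁅y, ⁅x, y⁆⁆` are central and together with a further element
that commutes with `x` and `y` independent has no faithful representation by strictly upper
triangular `5 × 5` matrices. -/
theorem HasUpperRep.false_of_commute [CharZero k] {c : Name k} (h : HasUpperRep c 5) (x y a : Alg c)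
    (hc : ∀ z t : Alg c, ⁅z, ⁅t, ⁅x, y⁆⁆⁆ = 0)
    (hind : ∀ s t u : k, s • ⁅x, ⁅x, y⁆⁆ + t • ⁅y, ⁅x, y⁆⁆ + u • a = 0 → s = 0 ∧ t = 0 ∧ u = 0)
    (hxa : ⁅x, a⁆ = 0) (hya : ⁅y, a⁆ = 0) : False := by
  obtain ⟨φ, hφ, h0, h03⟩ := h.exists_apply_ne_zero x y fun s t hst => by
    have := hind s t 0 (by rw [hst, zero_smul, add_zero])
    exact ⟨this.1, this.2.1⟩
  have hc' : ∀ z t : Alg c, ⁅φ z, ⁅φ t, ⁅φ x, φ y⁆⁆⁆ = 0 := fun z t => by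
    simp only [← LieHom.map_lie, hc, map_zero]
  refine not_independent_of_commute (hφ x) (hφ y) (hφ a) (hc' _ _) (hc' _ _) (hc' _ _) (hc' _ _)
    (hc' _ _) (hc' _ _) (fun s t u hst => hind s t u (h0 _ ?_)) ?_ ?_ h03
  · simpa only [map_add, map_smul, LieHom.map_lie] using hst
  · rw [← LieHom.map_lie, hxa, map_zero]
  · rw [← LieHom.map_lie, hya, map_zero]

theorem HasUpperRep.exists_sq_eq [CharZero k] {c : Name k} (h : HasUpperRep c 5) (x y a : Alg c)
    (hc : ∀ z t : Alg c, ⁅z, ⁅t, ⁅x, y⁆⁆⁆ = 0)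
    (hind : ∀ s t : k, s • ⁅x, ⁅x, y⁆⁆ + t • ⁅y, ⁅x, y⁆⁆ = 0 → s = 0 ∧ t = 0) {ε : k}
    (hxa : ⁅x, a⁆ = ε • ⁅y, ⁅x, y⁆⁆) (hya : ⁅y, a⁆ = ⁅x, ⁅x, y⁆⁆) : ∃ t : k, t ^ 2 = ε := by
  obtain ⟨φ, hφ, h0, h03⟩ := h.exists_apply_ne_zero x y hind
  have hc' : ∀ z t : Alg c, ⁅φ z, ⁅φ t, ⁅φ x, φ y⁆⁆⁆ = 0 := fun z t => by
    simp only [← LieHom.map_lie, hc, map_zero]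
  refine exists_sq_eq_of_lie_eq (hφ x) (hφ y) (hφ a) (hc' _ _) (hc' _ _) (hc' _ _) (hc' _ _)
    (hc' _ _) (hc' _ _) (fun s t hst => hind s t (h0 _ ?_)) ?_ ?_ h03
  · simpa only [map_add, map_smul, LieHom.map_lie] using hst
  · rw [← LieHom.map_lie, hxa, map_smul, LieHom.map_lie, LieHom.map_lie]
  · rw [← LieHom.map_lie, hya, LieHom.map_lie, LieHom.map_lie]

end SizeFive

end NilSix

namespace NilSix
variable {k : Type u}
attribute [local instance] LieRing.ofAssociativeRing

open Name

/-! ### The values for the individual algebras -/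

section Values

/-- The `i`-th vector of the basis in which the bracket is given. -/
def basisVec [Zero k] [One k] (i : Fin 6) : Fin 6 → k := Pi.single i 1

variable [Field k] {c : Name k} {m n : ℕ}

theorem not_hasScalarUpperRep_four_of_ne_zero {x y z t : Fin 6 → k} {i : Fin 6}
    (h : bracket c x (bracket c y (bracket c z t)) i = 1) : ¬HasScalarUpperRep c 4 := fun h4 => by
  rw [show bracket c x (bracket c y (bracket c z t)) = 0 from
    h4.lie_lie_lie_eq_zero (c := c) x y z t] at h
  exact zero_ne_one h

theorem not_hasScalarUpperRep_four_of_independent {x y z x' y' z' : Fin 6 → k} {i j : Fin 6}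
    (h : bracket c x (bracket c y z) j = 1) (h0 : bracket c x (bracket c y z) i = 0)
    (h1 : bracket c x' (bracket c y' z') i = 1) : ¬HasScalarUpperRep c 4 := fun h4 => by
  refine h4.not_independent (c := c) (x := x) (y := y) (z := z) (x' := x') (y' := y') (z' := z')
    (fun h' => ?_) (LinearMap.proj i : (Fin 6 → k) →ₗ[k] k) h0 h1
  rw [show bracket c x (bracket c y z) = 0 from h'] at h
  exact zero_ne_one h

theorem not_hasUpperRep_four_of_central (i j : Fin 6) (hij : i ≠ j)
    (hi : ∀ y, bracket c (basisVec i) y = 0) (hj : ∀ y, bracket c (basisVec j) y = 0) :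
    ¬HasUpperRep c 4 := fun h4 => by
  refine h4.not_independent_of_central (c := c) (z := basisVec i) (z' := basisVec j) hi hj
    (fun h' => ?_) (LinearMap.proj j : (Fin 6 → k) →ₗ[k] k) ?_ ?_
  · exact one_ne_zero ((Pi.single_eq_same (M := fun _ => k) i 1).symm.trans (congrFun h' i))
  · exact Pi.single_eq_of_ne hij.symm _
  · exact Pi.single_eq_same j _

theorem values_self (h : n ∈ faithfulNilDims k (Alg c))
    (h' : ∀ l ∈ faithfulDims k (Alg c), n ≤ l) : Values c n n :=
  ⟨⟨faithfulNilDims_subset c h, h'⟩, h, fun _ hl => h' _ (faithfulNilDims_subset c hl)⟩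

theorem le_of_not_hasUpperRep (h : ¬HasUpperRep c n) (hm : m ∈ faithfulNilDims k (Alg c)) :
    n + 1 ≤ m := by
  by_contra! hlt
  exact h (hasUpperRep_of_mem_faithfulNilDims hm (Nat.le_of_lt_succ hlt))

variable [CharZero k]

theorem values_five {f : (Fin 6 → k) → Matrix (Fin 5) (Fin 5) k} (hf : IsFaithfulNilrep c f)
    (h : ¬HasScalarUpperRep c 4) : Values c 5 5 := by
  have := hf.isNilpotent_alg
  refine values_self hf.mem_faithfulNilDims fun l hl => ?_
  by_contra! hlt
  exact h (hasScalarUpperRep_four hl (Nat.le_of_lt_succ hlt))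

theorem values_six {f : (Fin 6 → k) → Matrix (Fin 6) (Fin 6) k} (hf : IsFaithfulNilrep c f)
    {v x y z t : Fin 6 → k} {i : Fin 6}
    (h : bracket c v (bracket c x (bracket c y (bracket c z t))) i = 1) : Values c 6 6 := by
  have := hf.isNilpotent_alg
  refine values_self hf.mem_faithfulNilDims fun l hl =>
    six_le_of_lie_lie_lie_lie_ne_zero (c := c) hl (v := v) (w := x) (x := y) (y := z) (z := t)
      fun h' => ?_
  rw [show bracket c v (bracket c x (bracket c y (bracket c z t))) = 0 from h'] at h
  exact zero_ne_one h

theorem values_four_five {f : (Fin 6 → k) → Matrix (Fin 4) (Fin 4) k} (hf : IsFaithfulRep c f)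
    {g : (Fin 6 → k) → Matrix (Fin 5) (Fin 5) k} (hg : IsFaithfulNilrep c g)
    (h : ¬HasUpperRep c 4) : Values c 4 5 := by
  have := hg.isNilpotent_alg
  exact ⟨⟨hf.mem_faithfulDims, fun l hl => four_le_of_mem_faithfulDims hl⟩,
    hg.mem_faithfulNilDims, fun l hl => le_of_not_hasUpperRep h hl⟩

theorem values_L19_four {ε α : k} (h0 : α ≠ 0) (h : α ^ 2 + ε = 0) : Values (L19 ε) 4 4 := by
  have := (isFaithfulNilrep_nil19sq ε α h0 h).isNilpotent_alg
  exact values_self (isFaithfulNilrep_nil19sq ε α h0 h).mem_faithfulNilDims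
    fun l hl => four_le_of_mem_faithfulDims hl

theorem values_L3 : Values (L3 : Name k) 4 5 :=
  values_four_five isFaithfulRep_rep3 isFaithfulNilrep_nil3
    (not_hasUpperRep_four_of_central 3 4 (by decide)
      (fun y => by simp [bracket, w, basisVec])
      (fun y => by simp [bracket, w, basisVec]))

theorem values_L4 : Values (L4 : Name k) 4 5 :=
  values_four_five isFaithfulRep_rep4 isFaithfulNilrep_nil4
    (not_hasUpperRep_four_of_central 4 5 (by decide)
      (fun y => by simp [bracket, w, basisVec])
      (fun y => by simp [bracket, w, basisVec]))

theorem values_L5 : Values (L5 : Name k) 4 5 :=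
  values_four_five isFaithfulRep_rep5 isFaithfulNilrep_nil5
    (not_hasUpperRep_four_of_central 4 5 (by decide)
      (fun y => by simp [bracket, w, basisVec])
      (fun y => by simp [bracket, w, basisVec]))

theorem values_L8 : Values (L8 : Name k) 4 5 :=
  values_four_five isFaithfulRep_rep8 isFaithfulNilrep_nil8
    (not_hasUpperRep_four_of_central 3 4 (by decide)
      (fun y => by simp [bracket, w, basisVec])
      (fun y => by simp [bracket, w, basisVec]))

theorem values_L1 : Values (L1 : Name k) 5 5 :=
  values_five isFaithfulNilrep_nil1 (not_hasScalarUpperRep_four_of_central fun x y _ _ => by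
    simp [bracket])

theorem values_L2 : Values (L2 : Name k) 5 5 :=
  values_five isFaithfulNilrep_nil2 (not_hasScalarUpperRep_four_of_central fun x y h0 h1 => by
    simp [bracket, w, h0, h1])

theorem values_L6 : Values (L6 : Name k) 5 5 :=
  values_five isFaithfulNilrep_nil6 (not_hasScalarUpperRep_four_of_ne_zero (x := basisVec 0)
    (y := basisVec 0) (z := basisVec 0) (t := basisVec 1) (i := 4)
    (by simp [bracket, w, basisVec]))

theorem values_L7 : Values (L7 : Name k) 5 5 :=
  values_five isFaithfulNilrep_nil7 (not_hasScalarUpperRep_four_of_ne_zero (x := basisVec 0)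
    (y := basisVec 0) (z := basisVec 0) (t := basisVec 1) (i := 4)
    (by simp [bracket, w, basisVec]))

theorem values_L11 : Values (L11 : Name k) 5 5 :=
  values_five isFaithfulNilrep_nil11 (not_hasScalarUpperRep_four_of_ne_zero (x := basisVec 0)
    (y := basisVec 0) (z := basisVec 0) (t := basisVec 1) (i := 5)
    (by simp [bracket, w, basisVec]))

theorem values_L12 : Values (L12 : Name k) 5 5 :=
  values_five isFaithfulNilrep_nil12 (not_hasScalarUpperRep_four_of_ne_zero (x := basisVec 0)
    (y := basisVec 0) (z := basisVec 0) (t := basisVec 1) (i := 5)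
    (by simp [bracket, w, basisVec]))

theorem values_L13 : Values (L13 : Name k) 5 5 :=
  values_five isFaithfulNilrep_nil13 (not_hasScalarUpperRep_four_of_ne_zero (x := basisVec 0)
    (y := basisVec 0) (z := basisVec 0) (t := basisVec 1) (i := 5)
    (by simp [bracket, w, basisVec]))

theorem values_L21 (ε : k) : Values (L21 ε) 5 5 := by
  have h : ¬HasScalarUpperRep (L21 ε) 4 := not_hasScalarUpperRep_four_of_ne_zero (x := basisVec 0)
    (y := basisVec 0) (z := basisVec 0) (t := basisVec 1) (i := 5)
    (by simp [bracket, w, basisVec])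
  rcases eq_or_ne ε 0 with rfl | h0
  · exact values_five isFaithfulNilrep_nil21zero h
  · exact values_five (isFaithfulNilrep_nil21 ε h0) h

theorem values_L14 : Values (L14 : Name k) 6 6 :=
  values_six isFaithfulNilrep_nil14 (v := basisVec 1) (x := basisVec 0) (y := basisVec 0)
    (z := basisVec 0) (t := basisVec 1) (i := 5)
    (by simp [bracket, w, basisVec])

theorem values_L15 : Values (L15 : Name k) 6 6 :=
  values_six isFaithfulNilrep_nil15 (v := basisVec 0) (x := basisVec 0) (y := basisVec 0)
    (z := basisVec 0) (t := basisVec 1) (i := 5)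
    (by simp [bracket, w, basisVec])

theorem values_L16 : Values (L16 : Name k) 6 6 :=
  values_six isFaithfulNilrep_nil16 (v := basisVec 1) (x := basisVec 0) (y := basisVec 0)
    (z := basisVec 0) (t := basisVec 1) (i := 5)
    (by simp [bracket, w, basisVec])

theorem values_L17 : Values (L17 : Name k) 6 6 :=
  values_six isFaithfulNilrep_nil17 (v := basisVec 0) (x := basisVec 0) (y := basisVec 0)
    (z := basisVec 0) (t := basisVec 1) (i := 5)
    (by simp [bracket, w, basisVec])

theorem values_L18 : Values (L18 : Name k) 6 6 :=
  values_six isFaithfulNilrep_nil18 (v := basisVec 0) (x := basisVec 0) (y := basisVec 0)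
    (z := basisVec 0) (t := basisVec 1) (i := 5)
    (by simp [bracket, w, basisVec])

/-- The hypotheses say that the centre lies in the derived algebra and contains two of the basis
vectors. -/
theorem values_five_of_centre {f : (Fin 6 → k) → Matrix (Fin 5) (Fin 5) k}
    (hf : IsFaithfulNilrep c f)
    (hc : ∀ x, (∀ y, bracket c x y = 0) → ∃ a b a' b', x = bracket c a b + bracket c a' b')
    (i j : Fin 6) (hij : i ≠ j) (hi : ∀ y, bracket c (basisVec i) y = 0)
    (hj : ∀ y, bracket c (basisVec j) y = 0) : Values c 5 5 :=
  values_five hf fun h => not_hasUpperRep_four_of_central i j hij hi hj (h.hasUpperRep hc)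

theorem values_L22 (ε : k) : Values (L22 ε) 5 5 := by
  refine values_five_of_centre (isFaithfulNilrep_nil22 ε) (fun x hx => ?_) 4 5 (by decide)
      (fun y => by simp [bracket, w, basisVec])
      (fun y => by simp [bracket, w, basisVec])
  have h0 := hx (basisVec 0)
  have h1 := hx (basisVec 1)
  have h2 := hx (basisVec 2)
  simp [bracket, w, basisVec, funext_iff, Fin.forall_fin_succ] at h0 h1 h2
  refine ⟨basisVec 0, ![0, x 4, x 5, 0, 0, 0], 0, 0, ?_⟩
  funext i
  fin_cases i <;> simp [bracket, w, basisVec, h0, h1, h2]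

theorem values_L23 : Values (L23 : Name k) 5 5 := by
  refine values_five_of_centre isFaithfulNilrep_nil23 (fun x hx => ?_) 4 5 (by decide)
      (fun y => by simp [bracket, w, basisVec])
      (fun y => by simp [bracket, w, basisVec])
  have h0 := hx (basisVec 0)
  have h1 := hx (basisVec 1)
  simp [bracket, w, basisVec, funext_iff, Fin.forall_fin_succ] at h0 h1
  refine ⟨basisVec 0, ![0, 0, x 4, x 5, 0, 0], 0, 0, ?_⟩
  funext i
  fin_cases i <;> simp [bracket, w, basisVec, h0, h1]

theorem values_L25 : Values (L25 : Name k) 5 5 := by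
  refine values_five_of_centre isFaithfulNilrep_nil25 (fun x hx => ?_) 4 5 (by decide)
      (fun y => by simp [bracket, w, basisVec])
      (fun y => by simp [bracket, w, basisVec])
  have h0 := hx (basisVec 0)
  have h1 := hx (basisVec 1)
  simp [bracket, w, basisVec, funext_iff, Fin.forall_fin_succ] at h0 h1
  refine ⟨basisVec 0, ![0, 0, x 4, x 5, 0, 0], 0, 0, ?_⟩
  funext i
  fin_cases i <;> simp [bracket, w, basisVec, h0, h1]

theorem values_L26 : Values (L26 : Name k) 5 5 := by
  refine values_five_of_centre isFaithfulNilrep_nil26 (fun x hx => ?_) 4 5 (by decide)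
      (fun y => by simp [bracket, w, basisVec])
      (fun y => by simp [bracket, w, basisVec])
  have h0 := hx (basisVec 0)
  have h1 := hx (basisVec 1)
  simp [bracket, w, basisVec, funext_iff, Fin.forall_fin_succ] at h0 h1
  refine ⟨basisVec 0, ![0, x 3, x 4, 0, 0, 0], basisVec 1, ![0, 0, x 5, 0, 0, 0], ?_⟩
  funext i
  fin_cases i <;> simp [bracket, w, basisVec, h0, h1]

/-- The derived algebra of `L10` is only two-dimensional, that of the strictly upper triangular
`4 × 4` matrices is three-dimensional. -/
theorem values_L10 : Values (L10 : Name k) 5 5 := by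
  refine values_five isFaithfulNilrep_nil10 fun h => ?_
  obtain ⟨p, q, r, -, -, -, hind, -⟩ := (h.hasUpperRep (c := L10) fun x hx => by
    have h0 := hx (basisVec 0)
    have h1 := hx (basisVec 1)
    have h3 := hx (basisVec 3)
    have h4 := hx (basisVec 4)
    simp [bracket, w, basisVec, funext_iff, Fin.forall_fin_succ] at h0 h1 h3 h4
    refine ⟨basisVec 0, ![0, 0, x 5, 0, 0, 0], 0, 0, ?_⟩
    funext i
    fin_cases i <;> simp [bracket, w, basisVec, h0, h1, h3, h4]).exists_generators
  have hs : ∀ x y : Fin 6 → k, bracket L10 x y =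
      ![0, 0, bracket L10 x y 2, 0, 0, bracket L10 x y 5] := fun x y => rfl
  have hz : ∀ s t u : k,
      s * bracket L10 p q 2 + t * bracket L10 q r 2 + u * bracket L10 p (bracket L10 q r) 2 = 0 →
      s * bracket L10 p q 5 + t * bracket L10 q r 5 + u * bracket L10 p (bracket L10 q r) 5 = 0 →
      s = 0 ∧ t = 0 ∧ u = 0 := fun s t u h2 h5 => hind s t u (by
    rw [hs p q, hs p (bracket L10 q r), hs q r]
    funext i
    fin_cases i <;> simp
    · exact h2
    · exact h5)
  generalize bracket L10 p (bracket L10 q r) = v at hz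
  generalize bracket L10 p q = s at hz
  generalize bracket L10 q r = t at hz
  obtain ⟨-, -, h1⟩ := hz (t 2 * v 5 - t 5 * v 2) (v 2 * s 5 - v 5 * s 2) (s 2 * t 5 - s 5 * t 2)
    (by ring) (by ring)
  obtain ⟨-, s2, -⟩ := hz (t 2) (-s 2) 0 (by ring) (by linear_combination -h1)
  obtain ⟨-, s5, -⟩ := hz (t 5) (-s 5) 0 (by linear_combination h1) (by ring)
  exact one_ne_zero (hz 1 0 0 (by rw [neg_eq_zero.1 s2]; ring) (by rw [neg_eq_zero.1 s5]; ring)).1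

/-- Two commuting elements that are independent modulo the derived algebra lie in the span of
`X₂`, `X₃` and the derived algebra. Then one of the relations of `HasUpperRep.exists_generators`
fails. -/
theorem not_hasUpperRep_four_of_bracket {F : (Fin 6 → k) → (Fin 6 → k) → k}
    (hF : ∀ x y, bracket c x y = ![0, 0, 0, w x y 0 1, w x y 0 2, F x y])
    (hd : ∀ x : Fin 6 → k, x 0 = 0 → x 1 = 0 → x 2 = 0 →
      ∃ a b a' b', x = bracket c a b + bracket c a' b')
    (hsq : ∀ p q, p 0 = 0 → q 0 ≠ 0 → bracket c p (bracket c p q) = 0 → p 1 = 0) :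
    ¬HasUpperRep c 4 := by
  intro h
  obtain ⟨p, q, r, hpr, hpq, hrq, hind, hgen⟩ := h.exists_generators
  have hd' : ∀ s t : k, (s • p + t • r) 0 = 0 → (s • p + t • r) 1 = 0 → (s • p + t • r) 2 = 0 →
      s = 0 ∧ t = 0 := fun s t h0 h1 h2 => by
    obtain ⟨a, b, a', b', hab⟩ := hd _ h0 h1 h2
    exact hgen s t a b a' b' 0 0 (by rw [hab, bracket_self, add_zero])
  rw [hF] at hpr
  have e3 : p 0 * r 1 - p 1 * r 0 = 0 := congrFun hpr 3
  have e4 : p 0 * r 2 - p 2 * r 0 = 0 := congrFun hpr 4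
  obtain ⟨r0, p0⟩ := hd' (-r 0) (p 0) (by simp; ring) (by simp; linear_combination e3)
    (by simp; linear_combination e4)
  rw [neg_eq_zero] at r0
  have q0 : q 0 ≠ 0 := by
    intro q0
    have hs : ∀ x y : Fin 6 → k, x 0 = 0 → y 0 = 0 →
        bracket c x y = ![0, 0, 0, 0, 0, F x y] := fun x y hx hy => by
      rw [hF, w, w, hx, hy]; simp
    rw [hs p q p0 q0, hs q r q0 r0] at hind
    have h1 := hind (F q r) (-F p q) 0 (by simp [mul_comm])
    have h2 := hind 1 0 0 (by simp [neg_eq_zero.1 h1.2.1])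
    exact one_ne_zero h2.1
  have p1 := hsq p q p0 q0 hpq
  have r1 := hsq r q r0 q0 hrq
  obtain ⟨r2, p2⟩ := hd' (r 2) (-p 2) (by simp [p0, r0]) (by simp [p1, r1]) (by simp; ring)
  exact one_ne_zero (hd' 1 0 (by simp [p0]) (by simp [p1]) (by simp [neg_eq_zero.1 p2])).1

theorem values_L20 : Values (L20 : Name k) 5 5 := by
  have hd : ∀ x : Fin 6 → k, x 0 = 0 → x 1 = 0 → x 2 = 0 →
      ∃ a b a' b', x = bracket L20 a b + bracket L20 a' b' := by
    intro x h0 h1 h2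
    refine ⟨basisVec 0, ![0, x 3, x 4, 0, 0, 0], basisVec 1, ![0, 0, 0, x 5, 0, 0], ?_⟩
    funext i
    fin_cases i <;> simp [bracket, w, basisVec, h0, h1, h2]
  refine values_five isFaithfulNilrep_nil20 fun h =>
    not_hasUpperRep_four_of_bracket (fun x y => rfl) hd (fun p q p0 q0 hp => ?_)
      (h.hasUpperRep fun x hx => ?_)
  · have h5 := congrFun hp 5
    simp [bracket, w, p0, q0] at h5
    exact h5
  · have h0 := hx (basisVec 0)
    have h1 := hx (basisVec 1)
    simp [bracket, w, basisVec, funext_iff, Fin.forall_fin_succ] at h0 h1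
    exact hd x (by simp [h1]) (by simp [h0]) (by simp [h0])

theorem values_L19_five (ε : k) (hε : ∀ α : k, α ≠ 0 → α ^ 2 + ε ≠ 0) : Values (L19 ε) 5 5 := by
  have hd : ∀ x : Fin 6 → k, x 0 = 0 → x 1 = 0 → x 2 = 0 →
      ∃ a b a' b', x = bracket (L19 ε) a b + bracket (L19 ε) a' b' := by
    intro x h0 h1 h2
    refine ⟨basisVec 0, ![0, x 3, x 4, 0, 0, 0], basisVec 1, ![0, 0, 0, x 5, 0, 0], ?_⟩
    funext i
    fin_cases i <;> simp [bracket, w, basisVec, h0, h1, h2]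
  refine values_five (isFaithfulNilrep_nil19 ε) fun h =>
    not_hasUpperRep_four_of_bracket (fun x y => rfl) hd (fun p q p0 q0 hp => ?_)
      (h.hasUpperRep fun x hx => ?_)
  · have h5 := congrFun hp 5
    simp [bracket, w, p0] at h5
    have h6 : p 1 ^ 2 + ε * p 2 ^ 2 = 0 := (mul_eq_zero.1 (show q 0 * (p 1 ^ 2 + ε * p 2 ^ 2) = 0 by
      linear_combination -h5)).resolve_left q0
    by_contra p1
    have p2 : p 2 ≠ 0 := by
      intro p2
      rw [p2] at h6
      exact p1 (by simpa using h6)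
    refine hε (p 1 / p 2) (div_ne_zero p1 p2) ?_
    field_simp
    linear_combination h6
  · have h0 := hx (basisVec 0)
    have h1 := hx (basisVec 1)
    simp [bracket, w, basisVec, funext_iff, Fin.forall_fin_succ] at h0 h1
    exact hd x (by simp [h1]) (by simp [h0]) (by simp [h0])

theorem values_L9 : Values (L9 : Name k) 5 6 := by
  have := (isFaithfulNilrep_nil9 (k := k)).isNilpotent_alg
  refine ⟨⟨isFaithfulRep_rep9.mem_faithfulDims, fun l hl => ?_⟩,
    isFaithfulNilrep_nil9.mem_faithfulNilDims, fun l hl => le_of_not_hasUpperRep (fun h => ?_) hl⟩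
  · by_contra! hlt
    exact not_hasScalarUpperRep_four_of_independent (c := L9) (x := basisVec 0) (y := basisVec 0)
      (z := basisVec 1) (x' := basisVec 1) (y' := basisVec 0) (z' := basisVec 1) (i := 4) (j := 3)
      (by simp [bracket, w, basisVec])
      (by simp [bracket, w, basisVec])
      (by simp [bracket, w, basisVec])
      (hasScalarUpperRep_four hl (Nat.le_of_lt_succ hlt))
  · refine h.false_of_commute (basisVec 0) (basisVec 1) (basisVec 5) (fun z t => ?_)
      (fun s t u hst => ?_) ?_ ?_
    · change bracket L9 z (bracket L9 t (bracket L9 (basisVec 0) (basisVec 1))) = 0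
      simp [bracket, w]
    · have hst : (s • bracket L9 (basisVec 0) (bracket L9 (basisVec 0) (basisVec 1)) +
        t • bracket L9 (basisVec 1) (bracket L9 (basisVec 0) (basisVec 1)) +
        u • basisVec 5 : Fin 6 → k) = (0 : Fin 6 → k) := hst
      have h3 := congrFun hst 3
      have h4 := congrFun hst 4
      have h5 := congrFun hst 5
      simp [bracket, w, basisVec] at h3 h4 h5
      exact ⟨h3, h4, h5⟩
    · change bracket L9 (basisVec 0) (basisVec 5) = (0 : Fin 6 → k)
      simp [bracket, w, basisVec]
    · change bracket L9 (basisVec 1) (basisVec 5) = (0 : Fin 6 → k)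
      simp [bracket, w, basisVec]

theorem values_L24_five (ε : k) (h : ∃ α : k, α ^ 2 - ε = 0) : Values (L24 ε) 5 5 := by
  have h4 : ¬HasScalarUpperRep (L24 ε) 4 := not_hasScalarUpperRep_four_of_independent
    (x := basisVec 0) (y := basisVec 0) (z := basisVec 1) (x' := basisVec 1) (y' := basisVec 0)
    (z' := basisVec 1) (i := 5) (j := 4) (by simp [bracket, w, basisVec])
    (by simp [bracket, w, basisVec])
    (by simp [bracket, w, basisVec])
  obtain ⟨α, hα⟩ := h
  rcases eq_or_ne α 1 with rfl | h1
  · exact values_five (isFaithfulNilrep_nil24sq ε (-1) (by linear_combination hα)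
      (by norm_num)) h4
  · exact values_five (isFaithfulNilrep_nil24sq ε α hα h1) h4

theorem values_L24_six (ε : k) (h : ∀ α : k, α ^ 2 - ε ≠ 0) : Values (L24 ε) 6 6 := by
  have := (isFaithfulNilrep_nil24 ε).isNilpotent_alg
  refine values_self (isFaithfulNilrep_nil24 ε).mem_faithfulNilDims fun l hl => ?_
  by_contra! hlt
  have h5 : HasScalarUpperRep (L24 ε) 5 := hasScalarUpperRep_five hl (Nat.le_of_lt_succ hlt)
    (x := basisVec 0) (y := basisVec 0) (z := basisVec 1) (x' := basisVec 1) (y' := basisVec 0)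
    (z' := basisVec 1) (LinearMap.proj 4 : (Fin 6 → k) →ₗ[k] k)
    (LinearMap.proj 5 : (Fin 6 → k) →ₗ[k] k)
    (show bracket (L24 ε) (basisVec 0) (bracket (L24 ε) (basisVec 0) (basisVec 1)) 4 = 1 by
      simp [bracket, w, basisVec])
    (show bracket (L24 ε) (basisVec 1) (bracket (L24 ε) (basisVec 0) (basisVec 1)) 4 = 0 by
      simp [bracket, w, basisVec])
    (show bracket (L24 ε) (basisVec 0) (bracket (L24 ε) (basisVec 0) (basisVec 1)) 5 = 0 by
      simp [bracket, w, basisVec])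
    (show bracket (L24 ε) (basisVec 1) (bracket (L24 ε) (basisVec 0) (basisVec 1)) 5 = 1 by
      simp [bracket, w, basisVec])
  obtain ⟨α, hα⟩ := (h5.hasUpperRep fun x hx => by
    have h0 := hx (basisVec 0)
    have h1 := hx (basisVec 1)
    simp [bracket, w, basisVec, funext_iff, Fin.forall_fin_succ] at h0 h1
    refine ⟨basisVec 0, ![0, 0, x 4, 0, 0, 0], basisVec 1,
      ![0, 0, x 5, 0, 0, 0], ?_⟩
    funext i
    fin_cases i <;> simp [bracket, w, basisVec, h0, h1]).exists_sq_eq (ε := ε)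
      (basisVec 0) (basisVec 1) (basisVec 3) (fun z t => by
        change bracket (L24 ε) z (bracket (L24 ε) t (bracket (L24 ε) (basisVec 0) (basisVec 1))) = 0
        simp [bracket, w, basisVec])
      (fun s t hst => by
        have hst : (s • bracket (L24 ε) (basisVec 0) (bracket (L24 ε) (basisVec 0) (basisVec 1)) +
          t • bracket (L24 ε) (basisVec 1) (bracket (L24 ε) (basisVec 0) (basisVec 1)) :
            Fin 6 → k) = (0 : Fin 6 → k) := hst
        have h4 := congrFun hst 4
        have h5 := congrFun hst 5
        simp [bracket, w, basisVec] at h4 h5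
        exact ⟨h4, h5⟩)
      (by
        change bracket (L24 ε) (basisVec 0) (basisVec 3) =
          ε • bracket (L24 ε) (basisVec 1) (bracket (L24 ε) (basisVec 0) (basisVec 1))
        simp [bracket, w, basisVec])
      (by
        change bracket (L24 ε) (basisVec 1) (basisVec 3) =
          bracket (L24 ε) (basisVec 0) (bracket (L24 ε) (basisVec 0) (basisVec 1))
        simp [bracket, w, basisVec])
  exact h α (sub_eq_zero.2 hα)

end Values

end NilSix

open NilSix Name in
theorem theoremA (k : Type u) [Field k] [CharZero k] :
    -- the values of `μ` (first number) and `μ_nil` (second number)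
    ((∀ ε : k, (∃ α : k, α ≠ 0 ∧ α ^ 2 + ε = 0) → Values (L19 ε) 4 4) ∧
      (∀ c ∈ ({L3, L4, L5, L8} : Set (Name k)), Values c 4 5) ∧
      (∀ c ∈ ({L1, L2, L6, L7, L10, L11, L12, L13, L20, L23, L25, L26} : Set (Name k)),
        Values c 5 5) ∧
      (∀ ε : k, Values (L21 ε) 5 5 ∧ Values (L22 ε) 5 5) ∧
      (∀ ε : k, (∃ α : k, α ^ 2 - ε = 0) → Values (L24 ε) 5 5) ∧
      (∀ ε : k, (∀ α : k, α ≠ 0 → α ^ 2 + ε ≠ 0) → Values (L19 ε) 5 5) ∧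
      Values (L9 : Name k) 5 6 ∧
      (∀ c ∈ ({L14, L15, L16, L17, L18} : Set (Name k)), Values c 6 6) ∧
      (∀ ε : k, (∀ α : k, α ^ 2 - ε ≠ 0) → Values (L24 ε) 6 6)) ∧
    -- explicit faithful representations of dimension `μ < μ_nil`
    (IsFaithfulRep (L3 : Name k) rep3 ∧ IsFaithfulRep (L4 : Name k) rep4 ∧
      IsFaithfulRep (L5 : Name k) rep5 ∧ IsFaithfulRep (L8 : Name k) rep8 ∧
      IsFaithfulRep (L9 : Name k) rep9) ∧
    -- explicit faithful nilrepresentations of dimension `μ_nil`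
    (IsFaithfulNilrep (L1 : Name k) nil1 ∧ IsFaithfulNilrep (L2 : Name k) nil2 ∧
      IsFaithfulNilrep (L3 : Name k) nil3 ∧ IsFaithfulNilrep (L4 : Name k) nil4 ∧
      IsFaithfulNilrep (L5 : Name k) nil5 ∧ IsFaithfulNilrep (L6 : Name k) nil6 ∧
      IsFaithfulNilrep (L7 : Name k) nil7 ∧ IsFaithfulNilrep (L8 : Name k) nil8 ∧
      IsFaithfulNilrep (L9 : Name k) nil9 ∧ IsFaithfulNilrep (L10 : Name k) nil10 ∧
      IsFaithfulNilrep (L11 : Name k) nil11 ∧ IsFaithfulNilrep (L12 : Name k) nil12 ∧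
      IsFaithfulNilrep (L13 : Name k) nil13 ∧ IsFaithfulNilrep (L14 : Name k) nil14 ∧
      IsFaithfulNilrep (L15 : Name k) nil15 ∧ IsFaithfulNilrep (L16 : Name k) nil16 ∧
      IsFaithfulNilrep (L17 : Name k) nil17 ∧ IsFaithfulNilrep (L18 : Name k) nil18 ∧
      (∀ ε α : k, α ≠ 0 → α ^ 2 + ε = 0 → IsFaithfulNilrep (L19 ε) (nil19sq α)) ∧
      (∀ ε : k, IsFaithfulNilrep (L19 ε) (nil19 ε)) ∧
      IsFaithfulNilrep (L20 : Name k) nil20 ∧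
      (∀ ε : k, ε ≠ 0 → IsFaithfulNilrep (L21 ε) (nil21 ε)) ∧
      IsFaithfulNilrep (L21 (0 : k)) nil21zero ∧
      (∀ ε : k, IsFaithfulNilrep (L22 ε) (nil22 ε)) ∧
      IsFaithfulNilrep (L23 : Name k) nil23 ∧
      (∀ ε α : k, α ^ 2 - ε = 0 → α ≠ 1 → IsFaithfulNilrep (L24 ε) (nil24sq α)) ∧
      (∀ ε : k, IsFaithfulNilrep (L24 ε) (nil24 ε)) ∧
      IsFaithfulNilrep (L25 : Name k) nil25 ∧ IsFaithfulNilrep (L26 : Name k) nil26) := by 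
  refine ⟨⟨?_, ?_, ?_, ?_, ?_, ?_, ?_, ?_, ?_⟩, ⟨?_, ?_, ?_, ?_, ?_⟩, ?_⟩
  · rintro ε ⟨α, h0, h⟩
    exact values_L19_four h0 h
  · rintro c (rfl | rfl | rfl | rfl)
    exacts [values_L3, values_L4, values_L5, values_L8]
  · rintro c (rfl | rfl | rfl | rfl | rfl | rfl | rfl | rfl | rfl | rfl | rfl | rfl)
    exacts [values_L1, values_L2, values_L6, values_L7, values_L10, values_L11, values_L12,
      values_L13, values_L20, values_L23, values_L25, values_L26]
  · exact fun ε => ⟨values_L21 ε, values_L22 ε⟩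
  · exact values_L24_five
  · exact values_L19_five
  · exact values_L9
  · rintro c (rfl | rfl | rfl | rfl | rfl)
    exacts [values_L14, values_L15, values_L16, values_L17, values_L18]
  · exact values_L24_six
  · exact isFaithfulRep_rep3
  · exact isFaithfulRep_rep4
  · exact isFaithfulRep_rep5
  · exact isFaithfulRep_rep8
  · exact isFaithfulRep_rep9
  · exact ⟨isFaithfulNilrep_nil1, isFaithfulNilrep_nil2, isFaithfulNilrep_nil3,
      isFaithfulNilrep_nil4, isFaithfulNilrep_nil5, isFaithfulNilrep_nil6, isFaithfulNilrep_nil7,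
      isFaithfulNilrep_nil8, isFaithfulNilrep_nil9, isFaithfulNilrep_nil10, isFaithfulNilrep_nil11,
      isFaithfulNilrep_nil12, isFaithfulNilrep_nil13, isFaithfulNilrep_nil14,
      isFaithfulNilrep_nil15, isFaithfulNilrep_nil16, isFaithfulNilrep_nil17,
      isFaithfulNilrep_nil18, isFaithfulNilrep_nil19sq, isFaithfulNilrep_nil19,
      isFaithfulNilrep_nil20, isFaithfulNilrep_nil21, isFaithfulNilrep_nil21zero,
      isFaithfulNilrep_nil22, isFaithfulNilrep_nil23, isFaithfulNilrep_nil24sq,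
      isFaithfulNilrep_nil24, isFaithfulNilrep_nil25, isFaithfulNilrep_nil26⟩
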